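/- A \emph{translator} is a smooth immersion $x=(x_1,x_2,x_3):\Sigma^2\to\mathbb{R}^3$ of a connected surface without boundary, complete in the induced metric, whose mean curvature vector satisfies $\mathbf{H}=e_3^{\perp}$, where $\perp$ denotes the component normal to $\Sigma$. It is \emph{parabolic} if every function $v\in C^0(\Sigma)\cap W^{1,2}_{\mathrm{loc}}(\Sigma)$ that is bounded above and satisfies $\Delta v\ge 0$ weakly, for the Laplacian $\Delta$ of the induced metric, is constant. \textbf{Theorem.} Let $\Sigma^2$ be a parabolic translator in $\mathbb{R}^3$ contained in a vertical slab $\{a\le x_1\le a+\lambda\pi\}$ of width $\lambda\pi$, where $a\in\mathbb{R}$ and $\lambda\in[1,\sqrt2]$. Suppose that $$\Sigma\subseteq\Big\{\Big(1-\frac{\lambda^2}{2}\Big)x_3+\alpha x_2\ge c\Big\}$$ for some $c\in\mathbb{R}$ and some $\alpha\in\mathbb{R}$ with $\alpha^2\ge\lambda^2-1$. Then $\lambda=1$, $\alpha=0$, and $\Sigma$ is a grim reaper cylinder: the immersion is an embedding, and for some $b\in\mathbb{R}$ its image is $$\{(x_1,x_2,b-\log\sin(x_1-a)) : a<x_1<a+\pi,\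 x_2\in\mathbb{R}\}.$$ -/

import Mathlib

open scoped Manifold ContDiff Topology ENNReal
open MeasureTheory

noncomputable section

namespace Translator

/-- The Euclidean plane, in which the charts of a surface take their values. -/
abbrev E2 := EuclideanSpace ℝ (Fin 2)

/-- Euclidean three-space. The coordinates `x 0`, `x 1`, `x 2` are the usual
`x₁`, `x₂`, `x₃`. -/
abbrev E3 := EuclideanSpace ℝ (Fin 3)

/-- The direction of translation. -/
def e₃ : E3 := EuclideanSpace.single 2 1

/-! ### Local parametrizations -/

/-- The partial derivative `∂ᵢ X` of a map on the plane. -/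
def partialDeriv {V : Type*} [NormedAddCommGroup V] [NormedSpace ℝ V]
    (i : Fin 2) (X : E2 → V) (y : E2) : V :=
  fderiv ℝ X y (EuclideanSpace.single i 1)

/-- The matrix `gᵢⱼ = ⟨∂ᵢ X, ∂ⱼ X⟩` of the first fundamental form of a local
parametrization `X`. -/
def firstForm (X : E2 → E3) (y : E2) : Matrix (Fin 2) (Fin 2) ℝ :=
  Matrix.of fun i j => inner ℝ (partialDeriv i X y) (partialDeriv j X y)

/-- The normal component `v^⊥` of a vector `v` along a local parametrization `X`: its
orthogonal projection to the orthogonal complement of the tangent plane. -/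
def normalPart (X : E2 → E3) (y : E2) (v : E3) : E3 :=
  (LinearMap.range (fderiv ℝ X y : E2 →ₗ[ℝ] E3))ᗮ.starProjection v

/-- The mean curvature vector, that is the trace `∑ gⁱʲ (∂ᵢ ∂ⱼ X)^⊥` of the vector valued
second fundamental form. -/
def meanCurvature (X : E2 → E3) (y : E2) : E3 :=
  ∑ i, ∑ j, (firstForm X y)⁻¹ i j •
    normalPart X y (partialDeriv i (partialDeriv j X) y)

/-! ### Immersed surfaces -/

variable {M : Type*} [TopologicalSpace M] [ChartedSpace E2 M]

/-- The intrinsic distance of an immersed surface: the infimum of the lengths of the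
`C¹` curves in the surface that join the two points. -/
def intrinsicDist (F : M → E3) (p q : M) : ℝ≥0∞ :=
  ⨅ (γ : ℝ → M) (_ : ContMDiffOn 𝓘(ℝ, ℝ) (𝓡 2) 1 γ (Set.Icc 0 1))
    (_ : γ 0 = p) (_ : γ 1 = q), ∫⁻ t in Set.Icc (0 : ℝ) 1, ‖deriv (F ∘ γ) t‖ₑ

/-- Completeness of the induced metric: every sequence which is Cauchy for the intrinsic
distance converges in the surface. -/
def IsCompleteSurface (F : M → E3) : Prop :=
  ∀ s : ℕ → M,
    (∀ ε : ℝ≥0∞, 0 < ε → ∃ N, ∀ m ≥ N, ∀ n ≥ N, intrinsicDist F (s m) (s n) < ε) →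
    ∃ p, Filter.Tendsto s Filter.atTop (𝓝 p)

/-- `F : M → ℝ³` is a translator: a smooth immersion, complete in the induced
metric, with mean curvature vector `H = e₃^⊥`, the equation being read in all smooth
charts of `M`. (Connectedness is asked of the type `M`.) -/
structure IsTranslator (F : M → E3) : Prop where
  smooth : ContMDiff (𝓡 2) 𝓘(ℝ, E3) ∞ F
  immersion : ∀ p, Function.Injective (mfderiv (𝓡 2) 𝓘(ℝ, E3) F p)
  complete : IsCompleteSurface F
  meanCurvature_eq : ∀ e ∈ IsManifold.maximalAtlas (𝓡 2) ∞ M, ∀ y ∈ e.target,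
    meanCurvature (F ∘ e.symm) y = normalPart (F ∘ e.symm) y e₃

/-! ### Parabolicity -/

/-- The smooth, compactly supported functions on an open subset `U` of the plane. -/
def IsTestFunction (U : Set E2) (ψ : E2 → ℝ) : Prop :=
  ContDiff ℝ ∞ ψ ∧ HasCompactSupport ψ ∧ tsupport ψ ⊆ U

/-- `G` is a weak gradient of `v` on `U`, and it is locally square integrable there. -/
def IsWeakGradient (U : Set E2) (v : E2 → ℝ) (G : E2 → E2) : Prop :=
  (∀ K ⊆ U, IsCompact K → MemLp G 2 (volume.restrict K)) ∧
  ∀ ψ, IsTestFunction U ψ → ∀ i,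
    ∫ y in U, v y * partialDeriv i ψ y = -∫ y in U, G y i * ψ y

/-- `u` is continuous, of class `W^{1,2}_loc`, and `Δ u ≥ 0` weakly for the Laplacian of
the induced metric: with `g` the metric in a chart,
`∫ ⟨∇u, ∇ψ⟩ dvol = ∫ ∑ gⁱʲ ∂ᵢu ∂ⱼψ √(det g) dy ≤ 0` for each test function `ψ ≥ 0`
supported in the chart. -/
def IsWeaklySubharmonic (F : M → E3) (u : M → ℝ) : Prop :=
  Continuous u ∧
  ∀ e ∈ IsManifold.maximalAtlas (𝓡 2) ∞ M, ∃ G : E2 → E2,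
    IsWeakGradient e.target (u ∘ e.symm) G ∧
    ∀ ψ, IsTestFunction e.target ψ → (∀ y, 0 ≤ ψ y) →
      ∫ y in e.target, (∑ i, ∑ j,
        (firstForm (F ∘ e.symm) y)⁻¹ i j * G y i * partialDeriv j ψ y) *
          √(firstForm (F ∘ e.symm) y).det ≤ 0

/-- The surface is parabolic: every weakly subharmonic function in
`C⁰ ∩ W^{1,2}_loc` that is bounded above is constant. -/
def IsParabolic (F : M → E3) : Prop :=
  ∀ u : M → ℝ, IsWeaklySubharmonic F u → BddAbove (Set.range u) → ∃ k, ∀ p, u p = k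

/-! ### The grim reaper cylinder -/

/-- The grim reaper cylinder `x₃ = b - log (sin (x₁ - a))`, `a < x₁ < a + π`. It is the
translate by `(a, 0, b)` of the standard one. -/
def grimReaperCylinder (a b : ℝ) : Set E3 :=
  {x | x 0 ∈ Set.Ioo a (a + Real.pi) ∧ x 2 = b - Real.log (Real.sin (x 0 - a))}

end Translator

end

/-!
The theorem is a Liouville theorem for one function on the surface,
`P = sin ((x₁ - a) / λ) exp ((x₃ + α x₂) / λ²)`, called `barrier` below. It is nonnegative because
the surface lies in the slab.

With the weight `κ = exp (-(2 / λ²) ((1 - λ² / 2) x₃ + α x₂))`, the translator equation gives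
`div (κ ∇P) ≤ 0`: by `test_inequality`, the divergence is a nonnegative multiple of
`(λ² - 1 - α²) n₁² - (n₂ - α n₃)²`, where `n` is the normal, and this is where `α² ≥ λ² - 1` enters.
The half-space condition says exactly that `κ` is bounded.

Testing `div (κ ∇P) ≤ 0` with `φ² / (P + 1)` yields `hardy_inequality`,
`∫ κ |∇P|² (P + 1)⁻² φ² ≤ 4 (sup κ) ∫ |∇φ|²` for all test functions `φ`. If `P` is not constant, then
on some nonempty open set `∫ φ²` is controlled by the energy `∫ |∇φ|²`. This is impossible on a
parabolic surface (`not_isHardySet_of_isParabolic`). Indeed, such a control spreads to all compact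
sets (`isHardySet_of_isCompact`), so that the Riesz representation theorem solves `-Δ u = ρ` for a
bump function `ρ ≥ 0`, with `u ≥ 0` in the energy space (`exists_variational_solution`); then `-u`
is subharmonic and bounded above without being constant. Parabolicity concerns continuous functions,
and the continuity of `u` is the regularity theorem `IsWeakSolution.exists_continuousOn`. There the
logarithm of the distance in `ℝ³` serves as a parametrix in a chart: `surfaceDiv_kernelField` splits
the Laplacian of its regularization into an approximate identity and a bounded error, and
`IsWeakSolution.representation` is the resulting representation formula.

So `P` is constant (`exists_barrier_eq`). If the constant is `0`, then `x₁` is constant; if it is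
positive, then `x₃` is a function of `(x₁, x₂)` on the open strip. In both cases the immersion factors
through a projection to an open convex set of the plane, and completeness makes this projection a
homeomorphism onto the whole set, by lifting segments (`isOpenEmbedding_of_isCompleteSurface`). The
surface is therefore a vertical plane, which violates the half-space condition, or an entire graph over
the strip. On the middle line of the strip the half-space condition forces `α = 0`; then
`λ² - 1 ≤ α²` gives `λ = 1`, and the graph is the grim reaper cylinder.
-/

noncomputable section

namespace Translator

/-! ### Geometry of a parametrized surface -/

/-- The cross product of two vectors of `ℝ³`. -/
def cross (p q : E3) : E3 :=
  !₂[p 1 * q 2 - p 2 * q 1, p 2 * q 0 - p 0 * q 2, p 0 * q 1 - p 1 * q 0]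

/-- The (not normalized) normal `∂₀X × ∂₁X` of a parametrized surface. -/
def chartNormal (X : E2 → E3) (y : E2) : E3 :=
  cross (partialDeriv 0 X y) (partialDeriv 1 X y)

/-- The gradient of `f` for the induced metric, `∑ gⁱʲ ∂ᵢf ∂ⱼX`, as a vector of `ℝ³`. -/
def chartGrad (X : E2 → E3) (f : E2 → ℝ) (y : E2) : E3 :=
  ∑ i, ∑ j, ((firstForm X y)⁻¹ i j * partialDeriv i f y) • partialDeriv j X y

/-- The area density `√det g` of a parametrized surface. -/
def areaDensity (X : E2 → E3) (y : E2) : ℝ := √(firstForm X y).det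

/-- The vector `√det g ∑ gⁱʲ ∂ᵢX`; its divergence is the mean curvature vector times the
area density. -/
def flux (X : E2 → E3) (j : Fin 2) (y : E2) : E3 :=
  areaDensity X y • ∑ i, (firstForm X y)⁻¹ i j • partialDeriv i X y

lemma inner_E3 (p q : E3) : inner ℝ p q = p 0 * q 0 + p 1 * q 1 + p 2 * q 2 := by
  simp [PiLp.inner_apply, Fin.sum_univ_three]; ring

lemma cross_zero (p q : E3) : cross p q 0 = p 1 * q 2 - p 2 * q 1 := rfl
lemma cross_one (p q : E3) : cross p q 1 = p 2 * q 0 - p 0 * q 2 := rfl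
lemma cross_two (p q : E3) : cross p q 2 = p 0 * q 1 - p 1 * q 0 := rfl

lemma inner_cross_left (p q : E3) : inner ℝ p (cross p q) = 0 := by
  simp only [inner_E3, cross_zero, cross_one, cross_two]; ring

lemma inner_cross_right (p q : E3) : inner ℝ q (cross p q) = 0 := by
  simp only [inner_E3, cross_zero, cross_one, cross_two]; ring

/-- Lagrange's identity. -/
lemma inner_cross_self (p q : E3) :
    inner ℝ (cross p q) (cross p q) = inner ℝ p p * inner ℝ q q - inner ℝ p q ^ 2 := by
  simp only [inner_E3, cross_zero, cross_one, cross_two]; ring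

lemma inner_cross_comm (p q : E3) :
    inner ℝ (cross q p) (cross q p) = inner ℝ (cross p q) (cross p q) := by
  rw [inner_cross_self, inner_cross_self, real_inner_comm p q, mul_comm]

/-- Expansion of the normal component of a vector in terms of the Gram matrix. -/
lemma inner_cross_mul_cross (p q a : E3) (k : Fin 3) :
    inner ℝ a (cross p q) * cross p q k =
      (inner ℝ p p * inner ℝ q q - inner ℝ p q ^ 2) * a k
      - (inner ℝ q q * inner ℝ a p - inner ℝ p q * inner ℝ a q) * p k
      - (inner ℝ p p * inner ℝ a q - inner ℝ p q * inner ℝ a p) * q k := by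
  obtain rfl | rfl | rfl : k = 0 ∨ k = 1 ∨ k = 2 := by fin_cases k <;> simp
  all_goals
    simp only [inner_E3, cross_zero, cross_one, cross_two]
    ring

lemma det_firstForm (X : E2 → E3) (y : E2) :
    (firstForm X y).det = inner ℝ (chartNormal X y) (chartNormal X y) := by
  rw [Matrix.det_fin_two, chartNormal, inner_cross_self]
  simp only [firstForm, Matrix.of_apply]
  rw [real_inner_comm (partialDeriv 0 X y) (partialDeriv 1 X y)]; ring

lemma fderiv_apply_eq_sum {V : Type*} [NormedAddCommGroup V] [NormedSpace ℝ V]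
    (f : E2 → V) (y v : E2) :
    fderiv ℝ f y v = v 0 • partialDeriv 0 f y + v 1 • partialDeriv 1 f y := by
  have hv : v = v 0 • EuclideanSpace.single (0 : Fin 2) (1 : ℝ)
      + v 1 • EuclideanSpace.single (1 : Fin 2) (1 : ℝ) := by
    ext i; fin_cases i <;> simp
  conv_lhs => rw [hv]
  rw [map_add, map_smul, map_smul]; rfl

lemma cross_ne_zero {p q : E3} (h : ∀ a b : ℝ, a • p + b • q = 0 → a = 0 ∧ b = 0) :
    inner ℝ (cross p q) (cross p q) ≠ 0 := by
  intro h0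
  rw [inner_cross_self] at h0
  -- `⟨q,q⟩ p - ⟨p,q⟩ q` has square length `⟨q,q⟩ (⟨p,p⟩⟨q,q⟩ - ⟨p,q⟩²)`
  have h1 : (inner ℝ q q : ℝ) • p + (-(inner ℝ p q : ℝ)) • q = 0 := by
    rw [← inner_self_eq_zero (𝕜 := ℝ)]
    simp only [inner_add_left, inner_add_right, inner_smul_left, inner_smul_right,
      RCLike.conj_to_real]
    rw [real_inner_comm p q]
    linear_combination (inner ℝ q q : ℝ) * h0
  have h2 := (h _ _ h1).1
  have h3 : q = 0 := inner_self_eq_zero.mp h2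
  have := (h 0 1 (by simp [h3])).2
  norm_num at this

lemma det_firstForm_pos {X : E2 → E3} {y : E2} (h : Function.Injective (fderiv ℝ X y)) :
    0 < (firstForm X y).det := by
  rw [det_firstForm]
  refine lt_of_le_of_ne real_inner_self_nonneg (Ne.symm (cross_ne_zero ?_))
  intro a b hab
  have h1 : fderiv ℝ X y (!₂[a, b]) = fderiv ℝ X y 0 := by
    rw [fderiv_apply_eq_sum, map_zero]; simpa using hab
  have h2 := h h1
  exact ⟨by simpa using congrArg (fun v : E2 => v 0) h2,
    by simpa using congrArg (fun v : E2 => v 1) h2⟩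

lemma inv_firstForm (X : E2 → E3) (y : E2) :
    (firstForm X y)⁻¹ = ((firstForm X y).det)⁻¹ •
      !![firstForm X y 1 1, -firstForm X y 0 1; -firstForm X y 1 0, firstForm X y 0 0] := by
  rw [Matrix.inv_def, Matrix.adjugate_fin_two, Ring.inverse_eq_inv']

lemma inv_firstForm_comm (X : E2 → E3) (y : E2) (i j : Fin 2) :
    (firstForm X y)⁻¹ i j = (firstForm X y)⁻¹ j i := by
  have : (firstForm X y) 0 1 = (firstForm X y) 1 0 := by
    simp [firstForm, real_inner_comm]
  rw [inv_firstForm]; fin_cases i <;> fin_cases j <;> simp [this]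

/-- Polarized form of the fact that `∑ gⁱʲ ∂ᵢX ⊗ ∂ⱼX` is the orthogonal projection to the
tangent plane. -/
lemma sum_inv_firstForm {X : E2 → E3} {y : E2} (h : 0 < (firstForm X y).det) (u v : E3) :
    ∑ i, ∑ j, (firstForm X y)⁻¹ i j * (inner ℝ u (partialDeriv i X y) *
      inner ℝ v (partialDeriv j X y)) =
    inner ℝ u v - inner ℝ u (chartNormal X y) * inner ℝ v (chartNormal X y) /
      (firstForm X y).det := by
  rw [inv_firstForm, eq_sub_iff_add_eq]
  have hd := h.ne'
  rw [det_firstForm] at hd ⊢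
  simp only [Fin.sum_univ_two, Matrix.smul_apply, smul_eq_mul, Matrix.of_apply, firstForm,
    Matrix.cons_val', Matrix.cons_val_zero, Matrix.cons_val_one, Matrix.cons_val_fin_one]
  field_simp
  simp only [inner_E3, chartNormal, cross_zero, cross_one, cross_two]
  ring

lemma inner_partialDeriv_chartNormal (X : E2 → E3) (y : E2) (i : Fin 2) :
    inner ℝ (partialDeriv i X y) (chartNormal X y) = 0 := by
  fin_cases i
  · exact inner_cross_left _ _
  · exact inner_cross_right _ _

lemma inner_chartGrad_left (X : E2 → E3) (f : E2 → ℝ) (y : E2) (u : E3) :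
    inner ℝ u (chartGrad X f y) =
      ∑ i, ∑ j, (firstForm X y)⁻¹ i j * (partialDeriv i f y * inner ℝ u (partialDeriv j X y)) := by
  simp only [chartGrad, inner_sum, inner_smul_right, mul_assoc]

lemma chartGrad_mem_range (X : E2 → E3) (f : E2 → ℝ) (y : E2) :
    chartGrad X f y ∈ LinearMap.range (fderiv ℝ X y : E2 →ₗ[ℝ] E3) := by
  refine Submodule.sum_mem _ fun i _ => Submodule.sum_mem _ fun j _ => ?_
  exact Submodule.smul_mem _ _ ⟨_, rfl⟩

lemma inner_chartGrad_partialDeriv {X : E2 → E3} {y : E2} (h : 0 < (firstForm X y).det)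
    (f : E2 → ℝ) (k : Fin 2) :
    inner ℝ (chartGrad X f y) (partialDeriv k X y) = partialDeriv k f y := by
  rw [real_inner_comm, inner_chartGrad_left, inv_firstForm]
  have hd := h.ne'
  rw [Matrix.det_fin_two] at hd
  have hc : inner ℝ (partialDeriv 1 X y) (partialDeriv 0 X y) =
    inner ℝ (partialDeriv 0 X y) (partialDeriv 1 X y) := real_inner_comm _ _
  rw [Matrix.det_fin_two]
  revert k
  refine Fin.forall_fin_two.mpr ⟨?_, ?_⟩ <;>
  · simp only [Fin.sum_univ_two, Matrix.smul_apply, smul_eq_mul, Matrix.of_apply, firstForm,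
      Matrix.cons_val', Matrix.cons_val_zero, Matrix.cons_val_one, Matrix.cons_val_fin_one,
      hc] at hd ⊢
    rw [← pow_two] at hd
    field_simp
    ring

lemma inner_chartGrad_fderiv {X : E2 → E3} {y : E2} (h : 0 < (firstForm X y).det)
    (f : E2 → ℝ) (v : E2) :
    inner ℝ (chartGrad X f y) (fderiv ℝ X y v) = fderiv ℝ f y v := by
  rw [fderiv_apply_eq_sum, fderiv_apply_eq_sum, inner_add_right, inner_smul_right,
    inner_smul_right, inner_chartGrad_partialDeriv h, inner_chartGrad_partialDeriv h]; rfl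

/-- The gradient is the only tangent vector which represents the differential. -/
lemma eq_chartGrad {X : E2 → E3} {y : E2} (h : 0 < (firstForm X y).det) {f : E2 → ℝ} {w : E3}
    (hw : w ∈ LinearMap.range (fderiv ℝ X y : E2 →ₗ[ℝ] E3))
    (hf : ∀ v, inner ℝ w (fderiv ℝ X y v) = fderiv ℝ f y v) : w = chartGrad X f y := by
  obtain ⟨v, hv⟩ := Submodule.sub_mem _ hw (chartGrad_mem_range X f y)
  have : inner ℝ (w - chartGrad X f y) (w - chartGrad X f y) = (0 : ℝ) := by
    conv_lhs => rw [← hv]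
    change inner ℝ (fderiv ℝ X y v) (fderiv ℝ X y v) = (0 : ℝ)
    have h1 : fderiv ℝ X y v = w - chartGrad X f y := hv
    nth_rewrite 1 [h1]
    rw [inner_sub_left, hf, inner_chartGrad_fderiv h, sub_self]
  exact sub_eq_zero.mp (inner_self_eq_zero.mp this)

/-- The gradient of the restriction to the surface of a function of `ℝ³` is the tangential
part of the gradient. -/
lemma chartGrad_eq_of_partialDeriv {X : E2 → E3} {y : E2} (h : 0 < (firstForm X y).det)
    {f : E2 → ℝ} {b : E3} (hf : ∀ i, partialDeriv i f y = inner ℝ b (partialDeriv i X y)) (u : E3) :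
    inner ℝ u (chartGrad X f y) = inner ℝ u b - inner ℝ u (chartNormal X y) *
      inner ℝ b (chartNormal X y) / (firstForm X y).det := by
  rw [inner_chartGrad_left]
  simp only [hf]
  rw [sum_inv_firstForm h b u, real_inner_comm]; ring

lemma normalPart_eq {X : E2 → E3} {y : E2} (h : 0 < (firstForm X y).det) (v : E3) :
    normalPart X y v =
      (inner ℝ v (chartNormal X y) / (firstForm X y).det) • chartNormal X y := by
  have hn : ∀ w, inner ℝ (fderiv ℝ X y w) (chartNormal X y) = 0 := by
    intro w
    rw [fderiv_apply_eq_sum, inner_add_left, inner_smul_left, inner_smul_left,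
      inner_partialDeriv_chartNormal, inner_partialDeriv_chartNormal]; simp
  refine Submodule.eq_starProjection_of_mem_of_inner_eq_zero ?_ ?_
  · refine Submodule.smul_mem _ _ ?_
    rw [Submodule.mem_orthogonal]
    rintro _ ⟨w, rfl⟩
    exact hn w
  · -- `v - normal part` is tangent, so it is orthogonal to all that is normal
    have hmem : v - (inner ℝ v (chartNormal X y) / (firstForm X y).det) • chartNormal X y ∈
        LinearMap.range (fderiv ℝ X y : E2 →ₗ[ℝ] E3) := by
      have : v - (inner ℝ v (chartNormal X y) / (firstForm X y).det) • chartNormal X y =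
          ∑ i, ∑ j, ((firstForm X y)⁻¹ i j * inner ℝ v (partialDeriv i X y)) •
            partialDeriv j X y := by
        refine ext_inner_left ℝ fun u => ?_
        rw [inner_sub_right, inner_smul_right]
        simp only [inner_sum, inner_smul_right, mul_assoc]
        rw [sum_inv_firstForm h v u, real_inner_comm u v]; ring
      rw [this]
      exact Submodule.sum_mem _ fun i _ => Submodule.sum_mem _ fun j _ =>
        Submodule.smul_mem _ _ ⟨_, rfl⟩
    intro w hw
    exact (Submodule.mem_orthogonal _ _).mp hw _ hmem

/-! ### The divergence of the flux -/

/-- Derivative of a component of the flux along a curve: `p` and `q` are the values of the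
two partial derivatives of the parametrization along the curve. -/
lemma hasDerivAt_fluxAux {p q : ℝ → E3} {p' q' : E3} {t : ℝ} (hp : HasDerivAt p p' t)
    (hq : HasDerivAt q q' t)
    (h : 0 < (inner ℝ (cross (p t) (q t)) (cross (p t) (q t)) : ℝ)) (k : Fin 3) :
    HasDerivAt (fun s => (inner ℝ (q s) (q s) * p s k - inner ℝ (p s) (q s) * q s k) /
      √(inner ℝ (cross (p s) (q s)) (cross (p s) (q s))))
      ((2 * inner ℝ (q t) q' * p t k + inner ℝ (q t) (q t) * p' k
        - (inner ℝ p' (q t) + inner ℝ (p t) q') * q t k - inner ℝ (p t) (q t) * q' k) /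
        √(inner ℝ (cross (p t) (q t)) (cross (p t) (q t)))
       - (inner ℝ (q t) (q t) * p t k - inner ℝ (p t) (q t) * q t k) *
        (inner ℝ (p t) p' * inner ℝ (q t) (q t) + inner ℝ (p t) (p t) * inner ℝ (q t) q' -
          inner ℝ (p t) (q t) * (inner ℝ p' (q t) + inner ℝ (p t) q')) /
        √(inner ℝ (cross (p t) (q t)) (cross (p t) (q t))) ^ 3) t := by
  have hpk : HasDerivAt (fun s => p s k) (p' k) t :=
    (EuclideanSpace.proj (𝕜 := ℝ) k).hasFDerivAt.comp_hasDerivAt t hp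
  have hqk : HasDerivAt (fun s => q s k) (q' k) t :=
    (EuclideanSpace.proj (𝕜 := ℝ) k).hasFDerivAt.comp_hasDerivAt t hq
  have hpp := hp.inner ℝ hp
  have hqq := hq.inner ℝ hq
  have hpq := hp.inner ℝ hq
  have hs := Real.sqrt_pos.mpr h
  rw [inner_cross_self] at h hs
  have hD := ((hpp.mul hqq).sub (hpq.pow 2)).sqrt (by simpa using h.ne')
  have := ((hqq.mul hpk).sub (hpq.mul hqk)).div hD (by simpa using hs.ne')
  simp only [inner_cross_self]
  convert! this using 1
  rw [real_inner_comm p' (p t), real_inner_comm q' (q t)]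
  simp only [Pi.mul_apply, Pi.sub_apply, Pi.pow_apply]
  field_simp
  ring

lemma flux_eq {X : E2 → E3} {y : E2} (h : 0 < (firstForm X y).det) :
    flux X 0 y = (areaDensity X y)⁻¹ •
      ((inner ℝ (partialDeriv 1 X y) (partialDeriv 1 X y) : ℝ) • partialDeriv 0 X y -
      (inner ℝ (partialDeriv 0 X y) (partialDeriv 1 X y) : ℝ) • partialDeriv 1 X y) ∧
    flux X 1 y = (areaDensity X y)⁻¹ •
      ((inner ℝ (partialDeriv 0 X y) (partialDeriv 0 X y) : ℝ) • partialDeriv 1 X y -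
      (inner ℝ (partialDeriv 0 X y) (partialDeriv 1 X y) : ℝ) • partialDeriv 0 X y) := by
  have hs : 0 < areaDensity X y := Real.sqrt_pos.mpr h
  have hs2 : (firstForm X y).det = areaDensity X y ^ 2 := (Real.sq_sqrt h.le).symm
  have hc : inner ℝ (partialDeriv 1 X y) (partialDeriv 0 X y) =
    inner ℝ (partialDeriv 0 X y) (partialDeriv 1 X y) := real_inner_comm _ _
  constructor <;>
  · rw [flux, inv_firstForm, hs2]
    simp only [Fin.sum_univ_two, Matrix.smul_apply, smul_eq_mul, Matrix.of_apply, firstForm,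
      Matrix.cons_val', Matrix.cons_val_zero, Matrix.cons_val_one, Matrix.cons_val_fin_one, hc]
    match_scalars <;> field_simp

/-- The parametrization `X` is smooth near `y` and immersive there. -/
structure IsRegularAt (X : E2 → E3) (y : E2) : Prop where
  smooth_nhds : ∀ᶠ z in 𝓝 y, ContDiffAt ℝ ∞ X z
  det_pos : 0 < (firstForm X y).det

lemma contDiffAt_partialDeriv {V : Type*} [NormedAddCommGroup V] [NormedSpace ℝ V] {f : E2 → V}
    {y : E2} (hf : ContDiffAt ℝ ∞ f y) (i : Fin 2) :
    ContDiffAt ℝ ∞ (partialDeriv i f) y :=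
  (hf.fderiv_right (m := ∞) le_rfl).clm_apply contDiffAt_const

lemma partialDeriv_comm {X : E2 → E3} {y : E2} (hX : ContDiffAt ℝ ∞ X y) (i j : Fin 2) :
    partialDeriv i (partialDeriv j X) y = partialDeriv j (partialDeriv i X) y := by
  have hd : DifferentiableAt ℝ (fderiv ℝ X) y :=
    (hX.fderiv_right (m := ∞) le_rfl).differentiableAt (by simp)
  have h1 : ∀ i j, partialDeriv i (partialDeriv j X) y = fderiv ℝ (fderiv ℝ X) y
      (EuclideanSpace.single i 1) (EuclideanSpace.single j 1) := by
    intro i j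
    change fderiv ℝ (fun y => fderiv ℝ X y (EuclideanSpace.single j 1)) y _ = _
    rw [fderiv_clm_apply hd (differentiableAt_const _)]
    simp
  rw [h1, h1]
  exact ((hX.of_le (m := 2) (by exact WithTop.coe_le_coe.mpr le_top)).isSymmSndFDerivAt (by simp)).eq _ _

lemma hasDerivAt_line {V : Type*} [NormedAddCommGroup V] [NormedSpace ℝ V] {f : E2 → V} {y : E2}
    (hf : DifferentiableAt ℝ f y) (i : Fin 2) :
    HasDerivAt (fun t : ℝ => f (y + t • EuclideanSpace.single i (1 : ℝ))) (partialDeriv i f y) 0 := by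
  have h1 : HasDerivAt (fun t : ℝ => y + t • EuclideanSpace.single i (1 : ℝ))
      (EuclideanSpace.single i (1 : ℝ)) 0 := by
    simpa using ((hasDerivAt_id (0 : ℝ)).smul_const (EuclideanSpace.single i (1 : ℝ))).const_add y
  have h2 : HasFDerivAt f (fderiv ℝ f y) (y + (0 : ℝ) • EuclideanSpace.single i (1 : ℝ)) := by
    simpa using hf.hasFDerivAt
  exact h2.comp_hasDerivAt _ h1

lemma contDiffAt_coord {V : Type*} [NormedAddCommGroup V] [NormedSpace ℝ V] {f : V → E3} {y : V}
    (hf : ContDiffAt ℝ ∞ f y) (k : Fin 3) : ContDiffAt ℝ ∞ (fun z => f z k) y :=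
  (EuclideanSpace.proj (𝕜 := ℝ) k).contDiff.contDiffAt.comp y hf

lemma contDiffAt_firstForm {X : E2 → E3} {y : E2} (hX : ContDiffAt ℝ ∞ X y) (i j : Fin 2) :
    ContDiffAt ℝ ∞ (fun z => firstForm X z i j) y :=
  (contDiffAt_partialDeriv hX i).inner ℝ (contDiffAt_partialDeriv hX j)

lemma contDiffAt_det_firstForm {X : E2 → E3} {y : E2} (hX : ContDiffAt ℝ ∞ X y) :
    ContDiffAt ℝ ∞ (fun z => (firstForm X z).det) y := by
  simp only [Matrix.det_fin_two]
  exact ((contDiffAt_firstForm hX 0 0).mul (contDiffAt_firstForm hX 1 1)).sub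
    ((contDiffAt_firstForm hX 0 1).mul (contDiffAt_firstForm hX 1 0))

lemma areaDensity_eq (X : E2 → E3) (y : E2) :
    areaDensity X y = √(inner ℝ (cross (partialDeriv 0 X y) (partialDeriv 1 X y))
      (cross (partialDeriv 0 X y) (partialDeriv 1 X y))) := by
  rw [areaDensity, det_firstForm]; rfl

namespace IsRegularAt

variable {X : E2 → E3} {y : E2}

lemma smooth (hX : IsRegularAt X y) : ContDiffAt ℝ ∞ X y := hX.smooth_nhds.self_of_nhds

lemma contDiffAt_areaDensity (hX : IsRegularAt X y) : ContDiffAt ℝ ∞ (areaDensity X) y :=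
  (contDiffAt_det_firstForm hX.smooth).sqrt hX.det_pos.ne'

lemma areaDensity_pos (hX : IsRegularAt X y) : 0 < areaDensity X y := Real.sqrt_pos.mpr hX.det_pos

lemma contDiffAt_inv_firstForm (hX : IsRegularAt X y) (i j : Fin 2) :
    ContDiffAt ℝ ∞ (fun z => (firstForm X z)⁻¹ i j) y := by
  have hd := (contDiffAt_det_firstForm hX.smooth).inv hX.det_pos.ne'
  simp only [inv_firstForm]
  fin_cases i <;> fin_cases j <;> simp
  · exact hd.mul (contDiffAt_firstForm hX.smooth 1 1)
  · exact (hd.mul (contDiffAt_firstForm hX.smooth 0 1)).neg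
  · exact (hd.mul (contDiffAt_firstForm hX.smooth 1 0)).neg
  · exact hd.mul (contDiffAt_firstForm hX.smooth 0 0)

lemma contDiffAt_flux (hX : IsRegularAt X y) (j : Fin 2) : ContDiffAt ℝ ∞ (flux X j) y :=
  hX.contDiffAt_areaDensity.smul (ContDiffAt.sum fun i _ =>
    (hX.contDiffAt_inv_firstForm i j).smul (contDiffAt_partialDeriv hX.smooth i))

lemma contDiffAt_chartGrad (hX : IsRegularAt X y) {f : E2 → ℝ}
    (hf : ContDiffAt ℝ ∞ f y) :
    ContDiffAt ℝ ∞ (chartGrad X f) y :=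
  ContDiffAt.sum fun i _ => ContDiffAt.sum fun j _ =>
    ((hX.contDiffAt_inv_firstForm i j).mul (contDiffAt_partialDeriv hf i)).smul (contDiffAt_partialDeriv hX.smooth j)

lemma eventually (hX : IsRegularAt X y) : ∀ᶠ z in 𝓝 y, IsRegularAt X z := by
  filter_upwards [hX.smooth_nhds.eventually_nhds,
    (contDiffAt_det_firstForm hX.smooth).continuousAt.eventually_const_lt hX.det_pos] with z h1 h2
  exact ⟨h1, h2⟩

/-- The divergence of the flux is the mean curvature vector times the area density. -/
lemma sum_partialDeriv_flux (hX : IsRegularAt X y) :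
    ∑ j, partialDeriv j (flux X j) y = areaDensity X y • meanCurvature X y := by
  have hp : ∀ i j, HasDerivAt (fun t : ℝ => partialDeriv i X
      (y + t • EuclideanSpace.single j (1 : ℝ))) (partialDeriv j (partialDeriv i X) y) 0 :=
    fun i j => hasDerivAt_line ((contDiffAt_partialDeriv hX.smooth i).differentiableAt (by simp)) j
  have hc : ∀ (j : Fin 2) (k : Fin 3), HasDerivAt (fun t : ℝ => flux X j
      (y + t • EuclideanSpace.single j (1 : ℝ)) k) (partialDeriv j (flux X j) y k) 0 :=
    fun j k => (EuclideanSpace.proj (𝕜 := ℝ) k).hasFDerivAt.comp_hasDerivAt _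
      (hasDerivAt_line ((hX.contDiffAt_flux j).differentiableAt (by simp)) j)
  have hev : ∀ j : Fin 2, ∀ᶠ t : ℝ in 𝓝 0,
      IsRegularAt X (y + t • EuclideanSpace.single j (1 : ℝ)) := by
    intro j
    have : Filter.Tendsto (fun t : ℝ => y + t • EuclideanSpace.single j (1 : ℝ)) (𝓝 0) (𝓝 y) := by
      have h := ((continuous_id (X := ℝ)).smul
        (continuous_const (y := (EuclideanSpace.single j (1 : ℝ) : E2)))).const_add y |>.tendsto 0
      simpa using h
    exact this.eventually hX.eventually
  have h := hX.det_pos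
  rw [det_firstForm, chartNormal] at h
  ext k
  have e0 := (hasDerivAt_fluxAux (hp 0 0) (hp 1 0) (by simpa using h) k).unique
    ((hc 0 k).congr_of_eventuallyEq ((hev 0).mono fun t ht => by
      dsimp only
      rw [(flux_eq ht.det_pos).1, areaDensity_eq]
      simp [div_eq_inv_mul]))
  have e1 := (hasDerivAt_fluxAux (hp 1 1) (hp 0 1) (by
      rw [inner_cross_comm]; simpa using h) k).unique
    ((hc 1 k).congr_of_eventuallyEq ((hev 1).mono fun t ht => by
      dsimp only
      rw [(flux_eq ht.det_pos).2, areaDensity_eq, inner_cross_comm,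
        real_inner_comm (partialDeriv 0 X _) (partialDeriv 1 X _)]
      simp [div_eq_inv_mul]))
  simp only [zero_smul, add_zero] at e0 e1
  have hs : 0 < areaDensity X y := hX.areaDensity_pos
  have hs2 : areaDensity X y ^ 2 = (firstForm X y).det := Real.sq_sqrt hX.det_pos.le
  have hsym : √(inner ℝ (cross (partialDeriv 1 X y) (partialDeriv 0 X y))
      (cross (partialDeriv 1 X y) (partialDeriv 0 X y))) = areaDensity X y := by
    rw [areaDensity_eq, inner_cross_comm]
  rw [← areaDensity_eq] at e0
  rw [hsym] at e1
  simp only [meanCurvature, inv_firstForm, normalPart_eq hX.det_pos, ← hs2]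
  simp only [Fin.sum_univ_two, PiLp.add_apply, PiLp.smul_apply,
    smul_eq_mul, ← e0, ← e1, Matrix.smul_apply, Matrix.of_apply, firstForm,
    Matrix.cons_val', Matrix.cons_val_zero, Matrix.cons_val_one, Matrix.cons_val_fin_one]
  rw [partialDeriv_comm hX.smooth 1 0]
  rw [det_firstForm, chartNormal] at hs2
  rw [chartNormal]
  generalize areaDensity X y = s at hs hs2 ⊢
  generalize partialDeriv 0 X y = p at hs2 ⊢
  generalize partialDeriv 1 X y = q at hs2 ⊢
  generalize partialDeriv 0 (partialDeriv 0 X) y = a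
  generalize partialDeriv 0 (partialDeriv 1 X) y = b
  generalize partialDeriv 1 (partialDeriv 1 X) y = c
  have h1 := inner_cross_mul_cross p q a k
  have h2 := inner_cross_mul_cross p q b k
  have h3 := inner_cross_mul_cross p q c k
  rw [inner_cross_self] at hs2
  clear hp hc hev h e0 e1 hsym
  simp only [real_inner_comm a p, real_inner_comm b p, real_inner_comm b q,
    real_inner_comm c q, real_inner_comm p q]
  generalize (inner ℝ p p : ℝ) = pp at *
  generalize (inner ℝ q q : ℝ) = qq at *
  generalize (inner ℝ p q : ℝ) = pq at *
  field_simp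
  rw [hs2]
  linear_combination -qq * h1 + 2 * pq * h2 - pp * h3

end IsRegularAt

/-! ### Integration by parts in a chart -/

namespace IsTestFunction

variable {U : Set E2} {ψ χ : E2 → ℝ}

lemma eq_zero (hψ : IsTestFunction U ψ) {y : E2} (hy : y ∉ U) : ψ y = 0 :=
  image_eq_zero_of_notMem_tsupport fun h => hy (hψ.2.2 h)

lemma tsupport_partialDeriv_subset (ψ : E2 → ℝ) (i : Fin 2) :
    tsupport (partialDeriv i ψ) ⊆ tsupport ψ :=
  tsupport_fderiv_apply_subset ℝ _

lemma partialDeriv (hψ : IsTestFunction U ψ) (i : Fin 2) :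
    IsTestFunction U (partialDeriv i ψ) :=
  ⟨contDiff_iff_contDiffAt.mpr fun _ => contDiffAt_partialDeriv hψ.1.contDiffAt i,
    hψ.2.1.mono' (subset_trans (subset_tsupport _) (tsupport_partialDeriv_subset ψ i)),
    (tsupport_partialDeriv_subset ψ i).trans hψ.2.2⟩

lemma mul (hχ : IsTestFunction U χ) {g : E2 → ℝ} (hg : ∀ y ∈ U, ContDiffAt ℝ ∞ g y) :
    IsTestFunction U (fun y => g y * χ y) := by
  refine ⟨?_, hχ.2.1.mul_left, (tsupport_mul_subset_right).trans hχ.2.2⟩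
  rw [contDiff_iff_contDiffAt]
  intro y
  by_cases hy : y ∈ tsupport χ
  · exact (hg y (hχ.2.2 hy)).mul hχ.1.contDiffAt
  · refine (contDiffAt_const (c := (0 : ℝ))).congr_of_eventuallyEq ?_
    filter_upwards [(isClosed_tsupport χ).isOpen_compl.mem_nhds hy] with z hz
    simp [image_eq_zero_of_notMem_tsupport hz]

lemma integrable (hψ : IsTestFunction U ψ) : Integrable ψ :=
  hψ.1.continuous.integrable_of_hasCompactSupport hψ.2.1

lemma setIntegral_mul (hψ : IsTestFunction U ψ) (f : E2 → ℝ) :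
    ∫ y in U, f y * ψ y = ∫ y, f y * ψ y :=
  setIntegral_eq_integral_of_forall_compl_eq_zero fun y hy => by simp [hψ.eq_zero hy]

/-- The product of a test function and a locally integrable function is integrable. -/
lemma integrable_mul (hψ : IsTestFunction U ψ) {f : E2 → ℝ}
    (hf : ∀ K ⊆ U, IsCompact K → IntegrableOn f K) : Integrable (fun y => f y * ψ y) := by
  have h1 : IntegrableOn (fun y => f y * ψ y) (tsupport ψ) :=
    (hf _ hψ.2.2 hψ.2.1).mul_continuousOn hψ.1.continuous.continuousOn hψ.2.1
  rwa [integrableOn_iff_integrable_of_support_subset] at h1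
  intro y hy
  exact subset_tsupport _ (Function.mem_support.mpr (right_ne_zero_of_mul hy))

lemma integral_mul_partialDeriv (hψ : IsTestFunction U ψ) {f : E2 → ℝ}
    (hf : ∀ y ∈ U, ContDiffAt ℝ ∞ f y) (i : Fin 2) :
    ∫ y, f y * Translator.partialDeriv i ψ y = -∫ y, Translator.partialDeriv i f y * ψ y := by
  refine integral_mul_fderiv_eq_neg_fderiv_mul_of_integrable ?_ ?_ ?_ ?_ ?_
  · exact (hψ.mul fun y hy => contDiffAt_partialDeriv (hf y hy) i).integrable
  · exact ((hψ.partialDeriv i).mul hf).integrable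
  · exact (hψ.mul hf).integrable
  · exact fun y hy => (hf y (hψ.2.2 hy)).differentiableAt (by simp)
  · exact fun y _ => hψ.1.contDiffAt.differentiableAt (by simp)

end IsTestFunction

/-- The divergence along the surface of the tangential part of a vector field `b` of `ℝ³`
given along the surface. -/
def surfaceDiv (X : E2 → E3) (b : E2 → E3) (y : E2) : ℝ :=
  ∑ i, ∑ j, (firstForm X y)⁻¹ i j * inner ℝ (partialDeriv j b y) (partialDeriv i X y) +
    inner ℝ (b y) (meanCurvature X y)

lemma partialDeriv_inner {b c : E2 → E3} {y : E2} (hb : ContDiffAt ℝ ∞ b y)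
    (hc : ContDiffAt ℝ ∞ c y) (i : Fin 2) :
    partialDeriv i (fun z => inner ℝ (b z) (c z)) y =
      inner ℝ (partialDeriv i b y) (c y) + inner ℝ (b y) (partialDeriv i c y) := by
  rw [partialDeriv, fderiv_inner_apply ℝ (hb.differentiableAt (by simp))
    (hc.differentiableAt (by simp)), add_comm]; rfl

lemma partialDeriv_mul {f g : E2 → ℝ} {y : E2} (hf : ContDiffAt ℝ ∞ f y)
    (hg : ContDiffAt ℝ ∞ g y) (i : Fin 2) :
    partialDeriv i (fun z => f z * g z) y = partialDeriv i f y * g y + f y * partialDeriv i g y := by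
  rw [partialDeriv, fderiv_fun_mul (hf.differentiableAt (by simp)) (hg.differentiableAt (by simp))]
  simp [partialDeriv]; ring

lemma sum_inner_flux_mul (X : E2 → E3) (b : E3) (d : Fin 2 → ℝ) (y : E2) :
    ∑ j, inner ℝ b (flux X j y) * d j =
      areaDensity X y * ∑ i, ∑ j, (firstForm X y)⁻¹ i j * (d i * inner ℝ b (partialDeriv j X y)) := by
  simp only [flux, inner_smul_right, inner_add_right, Fin.sum_univ_two,
    inv_firstForm_comm X y 1 0]
  ring

lemma sum_inner_flux_mul_partialDeriv (X : E2 → E3) (b : E3) (ψ : E2 → ℝ) (y : E2) :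
    ∑ j, inner ℝ b (flux X j y) * partialDeriv j ψ y =
      areaDensity X y * inner ℝ b (chartGrad X ψ y) := by
  rw [sum_inner_flux_mul, inner_chartGrad_left]

lemma IsRegularAt.sum_partialDeriv_inner_flux {X : E2 → E3} {y : E2} (hX : IsRegularAt X y)
    {b : E2 → E3} (hb : ContDiffAt ℝ ∞ b y) :
    ∑ j, partialDeriv j (fun z => inner ℝ (b z) (flux X j z)) y =
      areaDensity X y * surfaceDiv X b y := by
  simp only [partialDeriv_inner hb (hX.contDiffAt_flux _), Finset.sum_add_distrib, ← inner_sum,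
    hX.sum_partialDeriv_flux, inner_smul_right, surfaceDiv, mul_add]
  congr 1
  simp only [flux, inner_smul_right, inner_add_right, Fin.sum_univ_two]
  ring

/-- Divergence theorem on a coordinate patch. -/
lemma IsTestFunction.integral_inner_chartGrad {U : Set E2} {ψ : E2 → ℝ} (hψ : IsTestFunction U ψ)
    {X b : E2 → E3} (hX : ∀ y ∈ U, IsRegularAt X y) (hb : ∀ y ∈ U, ContDiffAt ℝ ∞ b y) :
    ∫ y, areaDensity X y * inner ℝ (b y) (chartGrad X ψ y) =
      -∫ y, areaDensity X y * surfaceDiv X b y * ψ y := by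
  have hc : ∀ j, ∀ y ∈ U, ContDiffAt ℝ ∞ (fun z => inner ℝ (b z) (flux X j z)) y :=
    fun j y hy => (hb y hy).inner ℝ ((hX y hy).contDiffAt_flux j)
  simp only [← sum_inner_flux_mul_partialDeriv]
  rw [integral_finsetSum _ fun j _ => ((hψ.partialDeriv j).mul (hc j)).integrable]
  simp only [hψ.integral_mul_partialDeriv (hc _), Finset.sum_neg_distrib]
  rw [← integral_finsetSum _ fun j _ =>
    (hψ.mul fun y hy => contDiffAt_partialDeriv (hc j y hy) j).integrable]
  congr 1
  refine integral_congr_ae (.of_forall fun y => ?_)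
  dsimp only
  by_cases hy : y ∈ U
  · rw [← Finset.sum_mul, (hX y hy).sum_partialDeriv_inner_flux (hb y hy)]
  · simp [hψ.eq_zero hy]

/-! ### The parametrix -/

lemma sum_inv_firstForm_self {X : E2 → E3} {y : E2} (h : 0 < (firstForm X y).det) :
    ∑ i, ∑ j, (firstForm X y)⁻¹ i j * inner ℝ (partialDeriv j X y) (partialDeriv i X y) = 2 := by
  have h1 : ((firstForm X y)⁻¹ * firstForm X y).trace = 2 := by
    rw [Matrix.nonsing_inv_mul _ (isUnit_iff_ne_zero.mpr h.ne')]; simp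
  rw [← h1, Matrix.trace]
  simp only [Matrix.diag, Matrix.mul_apply, firstForm, Matrix.of_apply]

/-- The regularized gradient of `log |x - a|` along the surface. -/
def kernelField (X : E2 → E3) (ε : ℝ) (a : E3) (y : E2) : E3 :=
  (‖X y - a‖ ^ 2 + ε ^ 2)⁻¹ • (X y - a)

/-- The regularized `log |x - a|`. -/
def logKernel (X : E2 → E3) (ε : ℝ) (a : E3) (y : E2) : ℝ :=
  Real.log (‖X y - a‖ ^ 2 + ε ^ 2) / 2

/-- The part of the Laplacian of `logKernel` which stays bounded as `ε → 0`. -/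
def kernelError (X : E2 → E3) (ε : ℝ) (a : E3) (y : E2) : ℝ :=
  2 * inner ℝ (X y - a) (chartNormal X y) ^ 2 /
      ((firstForm X y).det * (‖X y - a‖ ^ 2 + ε ^ 2) ^ 2) +
    inner ℝ (X y - a) (meanCurvature X y) / (‖X y - a‖ ^ 2 + ε ^ 2)

variable {X : E2 → E3} {y : E2} {ε : ℝ} {a : E3}

lemma contDiffAt_kernel_sq (hX : ContDiffAt ℝ ∞ X y) :
    ContDiffAt ℝ ∞ (fun z => ‖X z - a‖ ^ 2 + ε ^ 2) y :=
  ((hX.sub contDiffAt_const).norm_sq ℝ).add contDiffAt_const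

lemma kernel_sq_pos (hε : 0 < ε) : 0 < ‖X y - a‖ ^ 2 + ε ^ 2 := by positivity

lemma contDiffAt_kernelField (hX : ContDiffAt ℝ ∞ X y) (hε : 0 < ε) :
    ContDiffAt ℝ ∞ (kernelField X ε a) y :=
  ((contDiffAt_kernel_sq hX).inv (kernel_sq_pos hε).ne').smul (hX.sub contDiffAt_const)

lemma contDiffAt_logKernel (hX : ContDiffAt ℝ ∞ X y) (hε : 0 < ε) :
    ContDiffAt ℝ ∞ (logKernel X ε a) y :=
  ((contDiffAt_kernel_sq hX).log (kernel_sq_pos hε).ne').div_const 2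

lemma hasFDerivAt_kernel_sq (hX : DifferentiableAt ℝ X y) :
    HasFDerivAt (fun z => ‖X z - a‖ ^ 2 + ε ^ 2)
      (2 • (innerSL ℝ (X y - a)).comp (fderiv ℝ X y)) y :=
  ((hX.hasFDerivAt.sub_const a).norm_sq).add_const _

lemma partialDeriv_logKernel (hX : DifferentiableAt ℝ X y) (hε : 0 < ε) (i : Fin 2) :
    partialDeriv i (logKernel X ε a) y = inner ℝ (kernelField X ε a y) (partialDeriv i X y) := by
  have h1 := ((hasFDerivAt_kernel_sq (a := a) (ε := ε) hX).log
    (kernel_sq_pos hε).ne').mul_const (2 : ℝ)⁻¹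
  have h2 : HasFDerivAt (logKernel X ε a) _ y := h1
  rw [partialDeriv, h2.fderiv, kernelField, inner_smul_left]
  simp [partialDeriv, inner_sub_left]
  ring

lemma partialDeriv_kernelField (hX : DifferentiableAt ℝ X y) (hε : 0 < ε) (i : Fin 2) :
    partialDeriv i (kernelField X ε a) y =
      (‖X y - a‖ ^ 2 + ε ^ 2)⁻¹ • partialDeriv i X y -
      (2 * inner ℝ (X y - a) (partialDeriv i X y) / (‖X y - a‖ ^ 2 + ε ^ 2) ^ 2) • (X y - a) := by
  have h2 := ((hasDerivAt_inv (kernel_sq_pos (X := X) (y := y) (a := a) hε).ne').comp_hasFDerivAt y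
    (hasFDerivAt_kernel_sq (a := a) (ε := ε) hX)).smul (hX.hasFDerivAt.sub_const a)
  have h3 : HasFDerivAt (kernelField X ε a) _ y := h2
  rw [partialDeriv, h3.fderiv]
  rw [sub_eq_add_neg (_ • partialDeriv i X y), ← neg_smul]
  simp only [add_apply, smul_apply,
    ContinuousLinearMap.smulRight_apply, ContinuousLinearMap.comp_apply, innerSL_apply_apply]
  congr 2
  simp only [partialDeriv, nsmul_eq_mul, smul_eq_mul]
  push_cast
  ring

/-- The kernel is a parametrix: its Laplacian is the sum of an approximate identity and of an
error which is bounded, since `⟨X y - X z, N⟩` vanishes to second order at `y = z`. -/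
lemma surfaceDiv_kernelField (hX : IsRegularAt X y) (hε : 0 < ε) :
    surfaceDiv X (kernelField X ε a) y =
      2 * ε ^ 2 / (‖X y - a‖ ^ 2 + ε ^ 2) ^ 2 + kernelError X ε a y := by
  have hs := (kernel_sq_pos (X := X) (y := y) (a := a) hε).ne'
  have hD := hX.det_pos.ne'
  have h1 := sum_inv_firstForm hX.det_pos (X y - a) (X y - a)
  have h2 := sum_inv_firstForm_self hX.det_pos
  have h3 : ∑ i, ∑ j, (firstForm X y)⁻¹ i j *
      inner ℝ (partialDeriv j (kernelField X ε a) y) (partialDeriv i X y) =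
      (‖X y - a‖ ^ 2 + ε ^ 2)⁻¹ * 2 - 2 / (‖X y - a‖ ^ 2 + ε ^ 2) ^ 2 *
      (inner ℝ (X y - a) (X y - a) - inner ℝ (X y - a) (chartNormal X y) *
        inner ℝ (X y - a) (chartNormal X y) / (firstForm X y).det) := by
    have h4 : (‖X y - a‖ ^ 2 + ε ^ 2)⁻¹ * 2 = (‖X y - a‖ ^ 2 + ε ^ 2)⁻¹ * ∑ i, ∑ j,
      (firstForm X y)⁻¹ i j * inner ℝ (partialDeriv j X y) (partialDeriv i X y) := by rw [h2]
    rw [← h1, h4]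
    simp only [partialDeriv_kernelField (hX.smooth.differentiableAt (by simp)) hε]
    generalize X y - a = w
    simp only [Fin.sum_univ_two, inner_sub_left, inner_smul_left, RCLike.conj_to_real]
    ring
  rw [surfaceDiv, h3, kernelError, kernelField, inner_smul_left, real_inner_self_eq_norm_sq]
  simp only [RCLike.conj_to_real]
  field_simp
  ring

/-! ### Local estimates for the parametrix -/

lemma meanCurvature_eq_smul {X : E2 → E3} {y : E2} (h : 0 < (firstForm X y).det) :
    meanCurvature X y = (∑ i, ∑ j, (firstForm X y)⁻¹ i j *
      (inner ℝ (partialDeriv i (partialDeriv j X) y) (chartNormal X y) / (firstForm X y).det)) •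
        chartNormal X y := by
  simp only [meanCurvature, normalPart_eq h, smul_smul, Finset.sum_smul]

lemma contDiffAt_chartNormal {X : E2 → E3} {y : E2} (hX : ContDiffAt ℝ ∞ X y) :
    ContDiffAt ℝ ∞ (chartNormal X) y := by
  have h : ∀ i k, ContDiffAt ℝ ∞ (fun z => partialDeriv i X z k) y :=
    fun i k => contDiffAt_coord (contDiffAt_partialDeriv hX i) k
  rw [contDiffAt_euclidean]
  intro k
  obtain rfl | rfl | rfl : k = 0 ∨ k = 1 ∨ k = 2 := by fin_cases k <;> simp
  · exact ((h 0 1).mul (h 1 2)).sub ((h 0 2).mul (h 1 1))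
  · exact ((h 0 2).mul (h 1 0)).sub ((h 0 0).mul (h 1 2))
  · exact ((h 0 0).mul (h 1 1)).sub ((h 0 1).mul (h 1 0))

lemma inner_fderiv_chartNormal (X : E2 → E3) (y v : E2) :
    inner ℝ (fderiv ℝ X y v) (chartNormal X y) = 0 := by
  rw [fderiv_apply_eq_sum, inner_add_left, inner_smul_left, inner_smul_left,
    inner_partialDeriv_chartNormal, inner_partialDeriv_chartNormal]; simp

lemma injective_of_det_firstForm_pos {X : E2 → E3} {y : E2} (h : 0 < (firstForm X y).det) :
    Function.Injective (fderiv ℝ X y) := by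
  rw [injective_iff_map_eq_zero]
  intro v hv
  by_contra hne
  obtain ⟨i, hi⟩ : ∃ i, v i ≠ 0 := by
    by_contra! h0
    exact hne (by ext i; simpa using h0 i)
  have h1 := fun f : E2 → ℝ => inner_chartGrad_fderiv h f v
  have h2 := h1 fun z => z i
  rw [hv, inner_zero_right] at h2
  have h3 : fderiv ℝ (fun z : E2 => z i) y = EuclideanSpace.proj (𝕜 := ℝ) i :=
    (EuclideanSpace.proj (𝕜 := ℝ) i).hasFDerivAt.fderiv
  rw [h3] at h2
  exact hi h2.symm

lemma IsRegularAt.injective_fderiv {X : E2 → E3} {y : E2} (hX : IsRegularAt X y) :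
    Function.Injective (fderiv ℝ X y) :=
  injective_of_det_firstForm_pos hX.det_pos

lemma IsRegularAt.continuousAt_curvatureFactor {X : E2 → E3} {y : E2} (hX : IsRegularAt X y) :
    ContinuousAt (fun y => ∑ i, ∑ j, (firstForm X y)⁻¹ i j *
      (inner ℝ (partialDeriv i (partialDeriv j X) y) (chartNormal X y) / (firstForm X y).det)) y := by
  have : ContDiffAt ℝ ∞ (fun y => ∑ i, ∑ j, (firstForm X y)⁻¹ i j *
      (inner ℝ (partialDeriv i (partialDeriv j X) y) (chartNormal X y) /
        (firstForm X y).det)) y :=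
    ContDiffAt.sum fun i _ => ContDiffAt.sum fun j _ => (hX.contDiffAt_inv_firstForm i j).mul
      ((ContDiffAt.inner ℝ (contDiffAt_partialDeriv (contDiffAt_partialDeriv hX.smooth j) i)
        (contDiffAt_chartNormal hX.smooth)).div (contDiffAt_det_firstForm hX.smooth)
          hX.det_pos.ne')
  exact this.continuousAt

/-- A ball of radius `4 r` on which the parametrization is bilipschitz and departs only to
second order from its tangent planes. -/
structure IsGoodBall (X : E2 → E3) (x₀ : E2) (r m C : ℝ) : Prop where
  r_pos : 0 < r
  m_pos : 0 < m
  C_pos : 0 < C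
  regular : ∀ y ∈ Metric.closedBall x₀ (4 * r), IsRegularAt X y
  lower : ∀ y ∈ Metric.closedBall x₀ (4 * r), ∀ z ∈ Metric.closedBall x₀ (4 * r),
    m * ‖y - z‖ ≤ ‖X y - X z‖
  upper : ∀ y ∈ Metric.closedBall x₀ (4 * r), ∀ z ∈ Metric.closedBall x₀ (4 * r),
    ‖X y - X z‖ ≤ C * ‖y - z‖
  normal : ∀ y ∈ Metric.closedBall x₀ (4 * r), ∀ z ∈ Metric.closedBall x₀ (4 * r),
    |inner ℝ (X y - X z) (chartNormal X y)| ≤ C * ‖y - z‖ ^ 2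
  curvature : ∀ y ∈ Metric.closedBall x₀ (4 * r), ∀ z ∈ Metric.closedBall x₀ (4 * r),
    |inner ℝ (X y - X z) (meanCurvature X y)| ≤ C * ‖y - z‖ ^ 2
  fderiv_lower : ∀ y ∈ Metric.closedBall x₀ (4 * r), ∀ v, m * ‖v‖ ≤ ‖fderiv ℝ X y v‖
  det_lower : ∀ y ∈ Metric.closedBall x₀ (4 * r), m ≤ (firstForm X y).det

/-- Taylor's formula at a regular point. The chord `X y - X z` is tangent at `y` up to a second
order term, so that its products with the normal and with the mean curvature vector, a multiple of
the normal, are of second order. -/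
lemma exists_isGoodBall {X : E2 → E3} {U : Set E2} (hU : IsOpen U)
    (hX : ∀ y ∈ U, IsRegularAt X y) {x₀ : E2} (hx₀ : x₀ ∈ U) :
    ∃ r m C, Metric.closedBall x₀ (4 * r) ⊆ U ∧ IsGoodBall X x₀ r m C := by
  have hR := hX x₀ hx₀
  have hsm : ContDiffAt ℝ 1 (fderiv ℝ X) x₀ :=
    (hR.smooth.fderiv_right (m := ∞) le_rfl).of_le (WithTop.coe_le_coe.mpr le_top)
  -- the derivative is bounded below near `x₀`
  obtain ⟨K, hK, hanti⟩ := LinearMap.exists_antilipschitzWith (fderiv ℝ X x₀ : E2 →ₗ[ℝ] E3)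
    (LinearMap.ker_eq_bot.mpr hR.injective_fderiv)
  have hlow0 : ∀ v, (K : ℝ)⁻¹ * ‖v‖ ≤ ‖fderiv ℝ X x₀ v‖ := by
    intro v
    have h := hanti.le_mul_dist v 0
    simp only [dist_zero_right, map_zero] at h
    rw [inv_mul_le_iff₀ (by exact_mod_cast hK)]
    exact h
  set κ : ℝ := (K : ℝ)⁻¹ with hκ
  have hκ0 : 0 < κ := by rw [hκ]; exact inv_pos.mpr (by exact_mod_cast hK)
  have hnear : ∀ᶠ y in 𝓝 x₀, ‖fderiv ℝ X y - fderiv ℝ X x₀‖ ≤ κ / 2 := by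
    filter_upwards [hsm.continuousAt (Metric.closedBall_mem_nhds _ (half_pos hκ0))] with y hy
    rwa [Set.mem_preimage, Metric.mem_closedBall, dist_eq_norm] at hy
  obtain ⟨L, s, hs, hlip⟩ := hsm.exists_lipschitzOnWith
  have hmem : ∀ᶠ y in 𝓝 x₀, y ∈ U ∧ y ∈ s ∧ ‖fderiv ℝ X y - fderiv ℝ X x₀‖ ≤ κ / 2 :=
    Filter.Eventually.and (hU.mem_nhds hx₀) (Filter.Eventually.and hs hnear)
  obtain ⟨ρ, hρ, hball⟩ := Metric.eventually_nhds_iff_ball.mp hmem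
  set r := ρ / 8 with hr
  have hr0 : 0 < r := by positivity
  have hsub : Metric.closedBall x₀ (4 * r) ⊆ Metric.ball x₀ ρ :=
    Metric.closedBall_subset_ball (by rw [hr]; linarith)
  set B := Metric.closedBall x₀ (4 * r) with hB
  have hBc : IsCompact B := isCompact_closedBall _ _
  have hBconv : Convex ℝ B := convex_closedBall _ _
  have hreg : ∀ y ∈ B, IsRegularAt X y := fun y hy => hX y (hball y (hsub hy)).1
  have hdiff : ∀ y ∈ B, DifferentiableAt ℝ X y :=
    fun y hy => (hreg y hy).smooth.differentiableAt (by simp)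
  -- first order Taylor estimate with base point `x₀`
  have hT1 : ∀ y ∈ B, ∀ z ∈ B, ‖X y - X z - fderiv ℝ X x₀ (y - z)‖ ≤ κ / 2 * ‖y - z‖ :=
    fun y hy z hz => hBconv.norm_image_sub_le_of_norm_fderiv_le' hdiff
      (fun w hw => (hball w (hsub hw)).2.2) hz hy
  -- second order Taylor estimate
  have hT2 : ∀ y ∈ B, ∀ z ∈ B, ‖X z - X y - fderiv ℝ X y (z - y)‖ ≤ L * ‖y - z‖ * ‖y - z‖ := by
    intro y hy z hz
    have h := (hBconv.inter (convex_closedBall y ‖y - z‖)).norm_image_sub_le_of_norm_fderiv_le'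
      (f := X) (φ := fderiv ℝ X y) (C := L * ‖y - z‖) (x := y) (y := z)
      (fun w hw => hdiff w hw.1) (fun w hw => ?_) ⟨hy, by simp⟩
      ⟨hz, by rw [Metric.mem_closedBall, dist_eq_norm, norm_sub_rev]⟩
    · rwa [norm_sub_rev z y] at h
    · refine (hlip.norm_sub_le (hball w (hsub hw.1)).2.1 (hball y (hsub hy)).2.1).trans ?_
      have := hw.2
      rw [Metric.mem_closedBall, dist_eq_norm] at this
      gcongr
  have hcn : ContinuousOn (fun y => ‖chartNormal X y‖) B :=
    fun y hy => (contDiffAt_chartNormal (hreg y hy).smooth).continuousAt.norm.continuousWithinAt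
  obtain ⟨N, hN⟩ := hBc.exists_bound_of_continuousOn hcn
  obtain ⟨Q, hQ⟩ := hBc.exists_bound_of_continuousOn
    (fun y hy => (hreg y hy).continuousAt_curvatureFactor.continuousWithinAt)
  have hx₀B : x₀ ∈ B := Metric.mem_closedBall_self (by positivity)
  have hN0 : 0 ≤ N := (norm_nonneg _).trans (hN x₀ hx₀B)
  have hQ0 : 0 ≤ Q := (norm_nonneg _).trans (hQ x₀ hx₀B)
  obtain ⟨y₁, hy₁, hmin⟩ := hBc.exists_isMinOn ⟨x₀, hx₀B⟩ (f := fun y => (firstForm X y).det)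
    (fun y hy => (contDiffAt_det_firstForm (hreg y hy).smooth).continuousAt.continuousWithinAt)
  have hnormal : ∀ y ∈ B, ∀ z ∈ B,
      |inner ℝ (X y - X z) (chartNormal X y)| ≤ L * N * ‖y - z‖ ^ 2 := by
    intro y hy z hz
    have h1 : (inner ℝ (X y - X z) (chartNormal X y) : ℝ) =
        -inner ℝ (X z - X y - fderiv ℝ X y (z - y)) (chartNormal X y) := by
      rw [inner_sub_left (X z - X y), inner_fderiv_chartNormal, sub_zero, ← inner_neg_left,
        neg_sub]
    rw [h1, abs_neg]
    refine (abs_real_inner_le_norm _ _).trans ?_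
    have h2 : ‖chartNormal X y‖ ≤ N := by simpa using hN y hy
    calc _ ≤ (L * ‖y - z‖ * ‖y - z‖) * N :=
          mul_le_mul (hT2 y hy z hz) h2 (norm_nonneg _) (by positivity)
      _ = _ := by ring
  refine ⟨r, min (κ / 2) (firstForm X y₁).det, ‖fderiv ℝ X x₀‖ + κ / 2 + L * N + Q * (L * N),
    fun y hy => (hball y (hsub hy)).1, hr0, ?_, by positivity, hreg, ?_, ?_, ?_, ?_, ?_, ?_⟩
  · exact lt_min (by positivity) (hreg y₁ hy₁).det_pos
  · intro y hy z hz
    have h1 := hT1 y hy z hz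
    have h2 := hlow0 (y - z)
    have h3 := norm_sub_norm_le (fderiv ℝ X x₀ (y - z)) (X y - X z)
    rw [norm_sub_rev (fderiv ℝ X x₀ (y - z))] at h3
    calc _ ≤ κ / 2 * ‖y - z‖ := by gcongr; exact min_le_left _ _
      _ ≤ _ := by linarith
  · intro y hy z hz
    have h1 := hT1 y hy z hz
    have h2 := (fderiv ℝ X x₀).le_opNorm (y - z)
    have h3 := norm_sub_norm_le (X y - X z) (fderiv ℝ X x₀ (y - z))
    calc _ ≤ (‖fderiv ℝ X x₀‖ + κ / 2) * ‖y - z‖ := by linarith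
      _ ≤ _ := by
        refine mul_le_mul_of_nonneg_right ?_ (by positivity)
        have : 0 ≤ (L : ℝ) * N := by positivity
        have : 0 ≤ Q * (L * N) := by positivity
        linarith
  · intro y hy z hz
    refine (hnormal y hy z hz).trans ?_
    refine mul_le_mul_of_nonneg_right ?_ (by positivity)
    have : 0 ≤ Q * (L * N) := by positivity
    have := norm_nonneg (fderiv ℝ X x₀)
    linarith
  · intro y hy z hz
    rw [meanCurvature_eq_smul (hreg y hy).det_pos, inner_smul_right, abs_mul]
    calc _ ≤ Q * (L * N * ‖y - z‖ ^ 2) :=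
          mul_le_mul (hQ y hy) (hnormal y hy z hz) (abs_nonneg _) hQ0
      _ = Q * (L * N) * ‖y - z‖ ^ 2 := by ring
      _ ≤ _ := by
        refine mul_le_mul_of_nonneg_right ?_ (by positivity)
        have : 0 ≤ (L : ℝ) * N := by positivity
        have := norm_nonneg (fderiv ℝ X x₀)
        linarith
  · intro y hy v
    have h1 := (fderiv ℝ X y - fderiv ℝ X x₀).le_opNorm v
    have h2 := hlow0 v
    have h4 := (hball y (hsub hy)).2.2
    have h3 := norm_sub_norm_le (fderiv ℝ X x₀ v) (fderiv ℝ X y v)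
    rw [norm_sub_rev (fderiv ℝ X x₀ v)] at h3
    have h5 : ‖fderiv ℝ X y - fderiv ℝ X x₀‖ * ‖v‖ ≤ κ / 2 * ‖v‖ := by gcongr
    have h6 : (fderiv ℝ X y - fderiv ℝ X x₀) v = fderiv ℝ X y v - fderiv ℝ X x₀ v := rfl
    rw [h6] at h1
    calc _ ≤ κ / 2 * ‖v‖ := by gcongr; exact min_le_left _ _
      _ ≤ _ := by linarith
  · exact fun y hy => (min_le_right _ _).trans (hmin hy)

/-! ### Representation of weak solutions by the parametrix -/

/-- Data of a weak solution of `-Δ h = f / √det g` on a coordinate patch `U`: here `h` is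
locally integrable with weak gradient `G`. -/
structure IsWeakSolution (X : E2 → E3) (U : Set E2) (h : E2 → ℝ) (G : E2 → E2) (f : E2 → ℝ) :
    Prop where
  isOpen : IsOpen U
  regular : ∀ y ∈ U, IsRegularAt X y
  integrable : ∀ K ⊆ U, IsCompact K → IntegrableOn h K
  integrable_grad (i : Fin 2) : ∀ K ⊆ U, IsCompact K → IntegrableOn (fun y => G y i) K
  weak_grad : ∀ ψ, IsTestFunction U ψ → ∀ i,
    ∫ y, h y * partialDeriv i ψ y = -∫ y, G y i * ψ y
  continuousOn : ContinuousOn f U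
  equation : ∀ ψ, IsTestFunction U ψ →
    ∫ y, areaDensity X y * ∑ i, ∑ j, (firstForm X y)⁻¹ i j * (G y i * partialDeriv j ψ y) =
      ∫ y, f y * ψ y

variable {X : E2 → E3} {U : Set E2} {h : E2 → ℝ} {G : E2 → E2} {f χ : E2 → ℝ}

lemma contDiffAt_inner_flux {y : E2} (hX : IsRegularAt X y) {b : E2 → E3}
    (hb : ContDiffAt ℝ ∞ b y) (j : Fin 2) :
    ContDiffAt ℝ ∞ (fun z => inner ℝ (b z) (flux X j z)) y :=
  hb.inner ℝ (hX.contDiffAt_flux j)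

/-- Green's representation formula for the regularized kernel with pole `a`, localized by `χ`. -/
lemma IsWeakSolution.representation (H : IsWeakSolution X U h G f) (hχ : IsTestFunction U χ)
    {ε : ℝ} (hε : 0 < ε) (a : E3) :
    ∫ y, h y * (areaDensity X y * (2 * ε ^ 2 / (‖X y - a‖ ^ 2 + ε ^ 2) ^ 2) * χ y) =
      (∫ y, areaDensity X y * (∑ i, ∑ j, (firstForm X y)⁻¹ i j * (G y i * partialDeriv j χ y)) *
        logKernel X ε a y) -
      (∫ y, h y * (areaDensity X y * inner ℝ (kernelField X ε a y) (chartGrad X χ y))) -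
      (∫ y, f y * χ y * logKernel X ε a y) -
      ∫ y, h y * (areaDensity X y * kernelError X ε a y * χ y) := by
  have hΓ : ∀ y ∈ U, ContDiffAt ℝ ∞ (logKernel X ε a) y :=
    fun y hy => contDiffAt_logKernel (H.regular y hy).smooth hε
  have hb : ∀ y ∈ U, ContDiffAt ℝ ∞ (kernelField X ε a) y :=
    fun y hy => contDiffAt_kernelField (H.regular y hy).smooth hε
  have hV := fun j => fun y hy => contDiffAt_inner_flux (H.regular y hy) (hb y hy) j
  have tΓ := hχ.mul hΓ
  have tV := fun j => hχ.mul (hV j)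
  have hχ0 : ∀ y ∉ U, ∀ i, partialDeriv i χ y = 0 := fun y hy i => (hχ.partialDeriv i).eq_zero hy
  -- the equation tested with `χ Γ`
  have e1 := H.equation _ tΓ
  have i1 : Integrable (fun y => areaDensity X y *
      (∑ i, ∑ j, (firstForm X y)⁻¹ i j * (G y i * partialDeriv j χ y)) * logKernel X ε a y) := by
    have : ∀ i j, Integrable (fun y => G y i * ((areaDensity X y * (firstForm X y)⁻¹ i j *
        logKernel X ε a y) * partialDeriv j χ y)) := fun i j =>
      ((hχ.partialDeriv j).mul fun y hy => (((H.regular y hy).contDiffAt_areaDensity.mul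
        ((H.regular y hy).contDiffAt_inv_firstForm i j)).mul (hΓ y hy))).integrable_mul
          (H.integrable_grad i)
    refine (integrable_finsetSum Finset.univ fun i _ =>
      integrable_finsetSum Finset.univ fun j _ => this i j).congr (.of_forall fun y => ?_)
    simp only [Fin.sum_univ_two]; ring
  have i2 : Integrable (fun y => ∑ i, G y i * (inner ℝ (kernelField X ε a y) (flux X i y) * χ y)) :=
    integrable_finsetSum _ fun i _ => (tV i).integrable_mul (H.integrable_grad i)
  have e2 : ∫ y, areaDensity X y * ∑ i, ∑ j, (firstForm X y)⁻¹ i j *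
        (G y i * partialDeriv j (fun y => logKernel X ε a y * χ y) y) =
      (∫ y, areaDensity X y * (∑ i, ∑ j, (firstForm X y)⁻¹ i j * (G y i * partialDeriv j χ y)) *
        logKernel X ε a y) +
      ∫ y, ∑ i, G y i * (inner ℝ (kernelField X ε a y) (flux X i y) * χ y) := by
    rw [← integral_add i1 i2]
    refine integral_congr_ae (.of_forall fun y => ?_)
    dsimp only
    by_cases hy : y ∈ U
    · have h1 := sum_inner_flux_mul X (kernelField X ε a y) (fun i => G y i) y
      have h2 : ∑ i, G y i * (inner ℝ (kernelField X ε a y) (flux X i y) * χ y) =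
          (∑ i, inner ℝ (kernelField X ε a y) (flux X i y) * G y i) * χ y := by
        rw [Finset.sum_mul]; exact Finset.sum_congr rfl fun i _ => by ring
      rw [h2, h1]
      simp only [partialDeriv_mul (hΓ y hy) hχ.1.contDiffAt, partialDeriv_logKernel
        ((H.regular y hy).smooth.differentiableAt (by simp)) hε, Fin.sum_univ_two]
      ring
    · simp only [tΓ.partialDeriv _ |>.eq_zero hy, hχ0 y hy, hχ.eq_zero hy]
      simp
  -- the weak gradient tested with `χ ⟨b, W⟩`
  have e3 := fun i => H.weak_grad _ (tV i) i
  have i3 : Integrable (fun y => h y * (areaDensity X y * inner ℝ (kernelField X ε a y)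
      (chartGrad X χ y))) := by
    refine (integrable_finsetSum Finset.univ fun j _ =>
      ((hχ.partialDeriv j).mul (hV j)).integrable_mul H.integrable).congr (.of_forall fun y => ?_)
    dsimp only
    rw [← Finset.mul_sum, sum_inner_flux_mul_partialDeriv]
  have i4 : Integrable (fun y => h y * (areaDensity X y * surfaceDiv X (kernelField X ε a) y *
      χ y)) := by
    refine (integrable_finsetSum Finset.univ fun j _ => (hχ.mul fun y hy =>
      contDiffAt_partialDeriv (hV j y hy) j).integrable_mul H.integrable).congr
        (.of_forall fun y => ?_)
    dsimp only
    by_cases hy : y ∈ U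
    · rw [← Finset.mul_sum, ← Finset.sum_mul,
        (H.regular y hy).sum_partialDeriv_inner_flux (hb y hy)]
    · simp [hχ.eq_zero hy]
  have e4 : (∫ y, h y * (areaDensity X y * inner ℝ (kernelField X ε a y) (chartGrad X χ y))) +
      ∫ y, h y * (areaDensity X y * surfaceDiv X (kernelField X ε a) y * χ y) =
      -∫ y, ∑ i, G y i * (inner ℝ (kernelField X ε a y) (flux X i y) * χ y) := by
    rw [integral_finsetSum _ fun i _ => (tV i).integrable_mul (H.integrable_grad i),
      ← Finset.sum_neg_distrib, ← integral_add i3 i4]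
    simp only [← e3]
    rw [← integral_finsetSum _ fun i _ => ((tV i).partialDeriv i).integrable_mul H.integrable]
    refine integral_congr_ae (.of_forall fun y => ?_)
    dsimp only
    rw [← Finset.mul_sum, ← mul_add]
    congr 1
    by_cases hy : y ∈ U
    · simp only [partialDeriv_mul (hV _ y hy) hχ.1.contDiffAt, Finset.sum_add_distrib]
      rw [← Finset.sum_mul, (H.regular y hy).sum_partialDeriv_inner_flux (hb y hy),
        sum_inner_flux_mul_partialDeriv]
      ring
    · simp only [(tV _).partialDeriv _ |>.eq_zero hy, hχ.eq_zero hy, chartGrad, hχ0 y hy]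
      simp
  -- split the Laplacian of the kernel
  have i5 : Integrable (fun y => h y * (areaDensity X y *
      (2 * ε ^ 2 / (‖X y - a‖ ^ 2 + ε ^ 2) ^ 2) * χ y)) := by
    refine (hχ.mul fun y hy => ?_).integrable_mul H.integrable
    have h1 := (contDiffAt_kernel_sq (a := a) (ε := ε) (H.regular y hy).smooth).pow 2
    exact (H.regular y hy).contDiffAt_areaDensity.mul
      (contDiffAt_const.div h1 (pow_pos (kernel_sq_pos hε) 2).ne')
  have e5 : (fun y => h y * (areaDensity X y * surfaceDiv X (kernelField X ε a) y * χ y)) =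
      fun y => h y * (areaDensity X y * (2 * ε ^ 2 / (‖X y - a‖ ^ 2 + ε ^ 2) ^ 2) * χ y) +
        h y * (areaDensity X y * kernelError X ε a y * χ y) := by
    funext y
    by_cases hy : y ∈ U
    · rw [surfaceDiv_kernelField (H.regular y hy) hε]; ring
    · simp [hχ.eq_zero hy]
  have i6 : Integrable (fun y => h y * (areaDensity X y * kernelError X ε a y * χ y)) := by
    refine (i4.sub i5).congr (.of_forall fun y => ?_)
    have := congrFun e5 y
    simp only [Pi.sub_apply]
    rw [this]; ring
  rw [e5, integral_add i5 i6] at e4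
  have e6 : ∫ y, f y * χ y * logKernel X ε a y = ∫ y, f y * (logKernel X ε a y * χ y) :=
    integral_congr_ae (.of_forall fun y => by ring)
  rw [e6]
  linarith

/-! ### Bounds for the parametrix -/

section Bounds

variable {X : E2 → E3} {x₀ : E2} {r m C : ℝ}

lemma IsGoodBall.kernel_sq_lower (H : IsGoodBall X x₀ r m C) (ε : ℝ) {y z : E2}
    (hy : y ∈ Metric.closedBall x₀ (4 * r)) (hz : z ∈ Metric.closedBall x₀ (4 * r)) :
    (m * ‖y - z‖) ^ 2 ≤ ‖X y - X z‖ ^ 2 + ε ^ 2 := by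
  have h1 := H.lower y hy z hz
  have h2 : 0 ≤ m * ‖y - z‖ := mul_nonneg H.m_pos.le (norm_nonneg _)
  have := pow_le_pow_left₀ h2 h1 2
  nlinarith [sq_nonneg ε]

lemma IsGoodBall.kernel_sq_pos_of_ne (H : IsGoodBall X x₀ r m C) (ε : ℝ) {y z : E2}
    (hy : y ∈ Metric.closedBall x₀ (4 * r)) (hz : z ∈ Metric.closedBall x₀ (4 * r)) (hyz : y ≠ z) :
    0 < ‖X y - X z‖ ^ 2 + ε ^ 2 :=
  lt_of_lt_of_le (pow_pos (mul_pos H.m_pos (norm_pos_iff.mpr (sub_ne_zero.mpr hyz))) 2)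
    (H.kernel_sq_lower ε hy hz)

/-- The error term stays bounded up to the pole: its numerators vanish to the order of its
denominators. -/
lemma IsGoodBall.abs_kernelError_le (H : IsGoodBall X x₀ r m C) (ε : ℝ) {y z : E2}
    (hy : y ∈ Metric.closedBall x₀ (4 * r)) (hz : z ∈ Metric.closedBall x₀ (4 * r)) :
    |kernelError X ε (X z) y| ≤ 2 * C ^ 2 / m ^ 5 + C / m ^ 2 := by
  have hm := H.m_pos
  have hC := H.C_pos
  by_cases hyz : y = z
  · subst hyz
    simp only [kernelError, sub_self, inner_zero_left]
    simp only [ne_eq, OfNat.ofNat_ne_zero, not_false_eq_true, zero_pow, mul_zero, zero_div,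
      add_zero, abs_zero]
    positivity
  have ht : 0 < ‖y - z‖ := norm_pos_iff.mpr (sub_ne_zero.mpr hyz)
  have hs := H.kernel_sq_pos_of_ne ε hy hz hyz
  have hlow := H.kernel_sq_lower ε hy hz
  have hD := H.det_lower y hy
  have hD0 := (H.regular y hy).det_pos
  have h1 := H.normal y hy z hz
  have h2 := H.curvature y hy z hz
  rw [kernelError]
  refine (abs_add_le _ _).trans (add_le_add ?_ ?_)
  · rw [abs_div, abs_of_pos (mul_pos hD0 (pow_pos hs 2)), abs_mul, abs_pow, abs_two]
    calc _ ≤ 2 * (C * ‖y - z‖ ^ 2) ^ 2 / (m * ((m * ‖y - z‖) ^ 2) ^ 2) := by gcongr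
      _ = _ := by field_simp
  · rw [abs_div, abs_of_pos hs]
    calc _ ≤ C * ‖y - z‖ ^ 2 / (m * ‖y - z‖) ^ 2 := by gcongr
      _ = _ := by field_simp

/-- The logarithm is dominated, uniformly in `ε`, by the integrable singularity `‖y - z‖⁻¹`. -/
lemma IsGoodBall.abs_logKernel_le (H : IsGoodBall X x₀ r m C) {ε : ℝ} (hε : |ε| ≤ 1) {y z : E2}
    (hy : y ∈ Metric.closedBall x₀ (4 * r)) (hz : z ∈ Metric.closedBall x₀ (4 * r))
    (hyz : y ≠ z) :
    |logKernel X ε (X z) y| ≤ ((C * (8 * r)) ^ 2 + 1) + m⁻¹ * ‖y - z‖⁻¹ := by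
  have hm := H.m_pos
  have ht : 0 < ‖y - z‖ := norm_pos_iff.mpr (sub_ne_zero.mpr hyz)
  have hs := H.kernel_sq_pos_of_ne ε hy hz hyz
  have hlow := H.kernel_sq_lower ε hy hz
  have hup := H.upper y hy z hz
  have h8 : ‖y - z‖ ≤ 8 * r := by
    rw [← dist_eq_norm]
    have := dist_triangle_right y z x₀
    rw [Metric.mem_closedBall] at hy hz
    linarith
  have hε2 : ε ^ 2 ≤ 1 := by rw [← sq_abs]; nlinarith [abs_nonneg ε]
  have hs2 : ‖X y - X z‖ ^ 2 + ε ^ 2 ≤ (C * (8 * r)) ^ 2 + 1 := by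
    have hC := H.C_pos
    have : ‖X y - X z‖ ≤ C * (8 * r) := hup.trans (by gcongr)
    gcongr
  have hmt : 0 < m * ‖y - z‖ := by positivity
  have hlog1 : Real.log (‖X y - X z‖ ^ 2 + ε ^ 2) ≤ ‖X y - X z‖ ^ 2 + ε ^ 2 - 1 :=
    Real.log_le_sub_one_of_pos hs
  have hlog2 : Real.log ((m * ‖y - z‖) ^ 2) ≤ Real.log (‖X y - X z‖ ^ 2 + ε ^ 2) :=
    Real.log_le_log (by positivity) hlow
  have hlog3 := Real.one_sub_inv_le_log_of_pos hmt
  rw [Real.log_pow] at hlog2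
  push_cast at hlog2
  rw [logKernel, abs_le, ← mul_inv]
  have h0 : 0 ≤ (m * ‖y - z‖)⁻¹ := by positivity
  have h00 : 0 ≤ (C * (8 * r)) ^ 2 := sq_nonneg _
  constructor <;> linarith

lemma IsGoodBall.norm_kernelField_le (H : IsGoodBall X x₀ r m C) (ε : ℝ) {y z : E2}
    (hy : y ∈ Metric.closedBall x₀ (4 * r)) (hz : z ∈ Metric.closedBall x₀ (4 * r)) :
    ‖kernelField X ε (X z) y‖ ≤ m⁻¹ * ‖y - z‖⁻¹ := by
  have hm := H.m_pos
  by_cases hyz : y = z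
  · simp [hyz, kernelField]
  have ht : 0 < ‖y - z‖ := norm_pos_iff.mpr (sub_ne_zero.mpr hyz)
  have hlow := H.lower y hy z hz
  have hw : 0 < ‖X y - X z‖ := lt_of_lt_of_le (by positivity) hlow
  rw [kernelField, norm_smul, norm_inv, Real.norm_of_nonneg (by positivity), ← mul_inv]
  calc _ ≤ (‖X y - X z‖ ^ 2)⁻¹ * ‖X y - X z‖ := by
        gcongr; nlinarith [sq_nonneg ε]
    _ = ‖X y - X z‖⁻¹ := by field_simp
    _ ≤ _ := by gcongr

end Bounds

section Continuity

variable {X : E2 → E3} {y z₀ : E2}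

lemma continuousAt_kernel_sq (hz : ContinuousAt X z₀) (y : E2) :
    ContinuousAt (fun p : ℝ × E2 => ‖X y - X p.2‖ ^ 2 + p.1 ^ 2) (0, z₀) := by
  have h : ContinuousAt (fun p : ℝ × E2 => X p.2) (0, z₀) :=
    ContinuousAt.comp (x := ((0 : ℝ), z₀)) (f := Prod.snd) hz continuousAt_snd
  exact ((continuousAt_const.sub h).norm.pow 2).add (continuousAt_fst.pow 2)

lemma continuousAt_logKernel (hz : ContinuousAt X z₀) (hy : X y ≠ X z₀) :
    ContinuousAt (fun p : ℝ × E2 => logKernel X p.1 (X p.2) y) (0, z₀) := by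
  have h : ‖X y - X z₀‖ ^ 2 + (0 : ℝ) ^ 2 ≠ 0 := by
    have := norm_pos_iff.mpr (sub_ne_zero.mpr hy)
    positivity
  exact ((continuousAt_kernel_sq hz y).log h).div_const 2

lemma continuousAt_kernelField (hz : ContinuousAt X z₀) (hy : X y ≠ X z₀) :
    ContinuousAt (fun p : ℝ × E2 => kernelField X p.1 (X p.2) y) (0, z₀) := by
  have h : ‖X y - X z₀‖ ^ 2 + (0 : ℝ) ^ 2 ≠ 0 := by
    have := norm_pos_iff.mpr (sub_ne_zero.mpr hy)
    positivity
  have h' : ContinuousAt (fun p : ℝ × E2 => X p.2) (0, z₀) :=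
    ContinuousAt.comp (x := ((0 : ℝ), z₀)) (f := Prod.snd) hz continuousAt_snd
  exact ((continuousAt_kernel_sq hz y).inv₀ h).smul (continuousAt_const.sub h')

lemma continuousAt_kernelError (hz : ContinuousAt X z₀) (hy : X y ≠ X z₀)
    (hD : (firstForm X y).det ≠ 0) :
    ContinuousAt (fun p : ℝ × E2 => kernelError X p.1 (X p.2) y) (0, z₀) := by
  have h : ‖X y - X z₀‖ ^ 2 + (0 : ℝ) ^ 2 ≠ 0 := by
    have := norm_pos_iff.mpr (sub_ne_zero.mpr hy)
    positivity
  have h' : ContinuousAt (fun p : ℝ × E2 => X y - X p.2) (0, z₀) :=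
    continuousAt_const.sub
      (ContinuousAt.comp (x := ((0 : ℝ), z₀)) (f := Prod.snd) hz continuousAt_snd)
  have hs := continuousAt_kernel_sq hz y
  refine ContinuousAt.add (ContinuousAt.div ?_ ?_ (mul_ne_zero hD (pow_ne_zero 2 h)))
    (ContinuousAt.div ?_ hs h)
  · exact continuousAt_const.mul ((h'.inner continuousAt_const).pow 2)
  · exact continuousAt_const.mul (hs.pow 2)
  · exact h'.inner continuousAt_const

end Continuity

section Measurability

variable {X : E2 → E3} {ν : Measure E2} (ε : ℝ) (a : E3)

lemma aemeasurable_kernel_sq (hX : AEMeasurable X ν) :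
    AEMeasurable (fun y => ‖X y - a‖ ^ 2 + ε ^ 2) ν :=
  ((hX.sub_const a).norm.pow_const 2).add_const _

lemma aemeasurable_logKernel (hX : AEMeasurable X ν) : AEMeasurable (logKernel X ε a) ν :=
  (aemeasurable_kernel_sq ε a hX).log.div_const 2

lemma aemeasurable_kernelField (hX : AEMeasurable X ν) : AEMeasurable (kernelField X ε a) ν :=
  (aemeasurable_kernel_sq ε a hX).inv.smul (hX.sub_const a)

lemma aemeasurable_kernelError (hX : AEMeasurable X ν) (hn : AEMeasurable (chartNormal X) ν)
    (hH : AEMeasurable (meanCurvature X) ν) (hD : AEMeasurable (fun y => (firstForm X y).det) ν) :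
    AEMeasurable (kernelError X ε a) ν :=
  (((((hX.sub_const a).inner hn).pow_const 2).const_mul 2).div
    (hD.mul ((aemeasurable_kernel_sq ε a hX).pow_const 2))).add
    (((hX.sub_const a).inner hH).div (aemeasurable_kernel_sq ε a hX))

end Measurability

/-! ### Continuity of the potentials -/

/-- A function of the regularization parameter and of the pole which is bounded, and continuous
at the parameter `0`. -/
def IsGoodPotential (x₀ : E2) (r : ℝ) (J : ℝ × E2 → ℝ) : Prop :=
  (∀ z ∈ Metric.ball x₀ r, ContinuousAt J (0, z)) ∧
    ∃ B, ∀ ε z, |ε| ≤ 1 → z ∈ Metric.ball x₀ r → |J (ε, z)| ≤ B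

lemma IsGoodPotential.sub {x₀ : E2} {r : ℝ} {J J' : ℝ × E2 → ℝ} (h : IsGoodPotential x₀ r J)
    (h' : IsGoodPotential x₀ r J') : IsGoodPotential x₀ r (fun p => J p - J' p) := by
  obtain ⟨B, hB⟩ := h.2
  obtain ⟨B', hB'⟩ := h'.2
  exact ⟨fun z hz => (h.1 z hz).sub (h'.1 z hz), B + B', fun ε z hε hz =>
    (abs_sub _ _).trans (add_le_add (hB ε z hε hz) (hB' ε z hε hz))⟩

lemma isGoodPotential_of_dominated {x₀ : E2} {r : ℝ} {ν : Measure E2} {Q : ℝ × E2 → E2 → ℝ}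
    {bound : E2 → ℝ} (hbound : Integrable bound ν)
    (hm : ∀ ε z, |ε| ≤ 1 → z ∈ Metric.ball x₀ r → AEStronglyMeasurable (Q (ε, z)) ν)
    (hb : ∀ ε z, |ε| ≤ 1 → z ∈ Metric.ball x₀ r → ∀ᵐ y ∂ν, ‖Q (ε, z) y‖ ≤ bound y)
    (hc : ∀ z ∈ Metric.ball x₀ r, ∀ᵐ y ∂ν, ContinuousAt (fun p => Q p y) (0, z)) :
    IsGoodPotential x₀ r (fun p => ∫ y, Q p y ∂ν) := by
  refine ⟨fun z hz => ?_, ∫ y, bound y ∂ν, fun ε z hε hz =>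
    norm_integral_le_of_norm_le hbound (hb ε z hε hz)⟩
  have hS : ∀ᶠ p : ℝ × E2 in 𝓝 (0, z), |p.1| ≤ 1 ∧ p.2 ∈ Metric.ball x₀ r := by
    have h1 : ∀ᶠ t : ℝ in 𝓝 0, |t| ≤ 1 := by
      filter_upwards [Metric.closedBall_mem_nhds (0 : ℝ) one_pos] with t ht
      simpa using ht
    exact h1.prod_nhds (Metric.isOpen_ball.mem_nhds hz)
  exact continuousAt_of_dominated (hS.mono fun p hp => hm p.1 p.2 hp.1 hp.2)
    (hS.mono fun p hp => hb p.1 p.2 hp.1 hp.2) hbound (hc z hz)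

lemma integrableOn_inv_norm (R : ℝ) :
    IntegrableOn (fun w : E2 => ‖w‖⁻¹) (Metric.ball 0 R) := by
  rw [integrableOn_fun_norm_addHaar volume (f := fun t : ℝ => t⁻¹)]
  refine (integrableOn_const (C := (1 : ℝ)) (by simp)).congr_fun (fun t ht => ?_) measurableSet_Ioo
  have : t ≠ 0 := ne_of_gt ht.1
  simp [this]

lemma ae_restrict_ne (ν : Measure E2) [NullSingletonClass ν] (z : E2) : ∀ᵐ y ∂ν, y ≠ z := by
  simp [ae_iff]

/-- A cut-off function adapted to a ball: it is `1` on the ball of radius `2 r` and is supported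
in the ball of radius `3 r`. -/
structure IsCutoff (U : Set E2) (x₀ : E2) (r : ℝ) (χ : E2 → ℝ) : Prop where
  test : IsTestFunction U χ
  eq_one : ∀ y ∈ Metric.ball x₀ (2 * r), χ y = 1
  tsupport_subset : tsupport χ ⊆ Metric.closedBall x₀ (3 * r)

lemma exists_isCutoff {U : Set E2} {x₀ : E2} {r : ℝ} (hr : 0 < r)
    (hU : Metric.closedBall x₀ (4 * r) ⊆ U) : ∃ χ, IsCutoff U x₀ r χ := by
  let f : ContDiffBump x₀ := ⟨2 * r, 3 * r, by positivity, by linarith⟩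
  refine ⟨f, ⟨f.contDiff, f.hasCompactSupport, ?_⟩, fun y hy => ?_, ?_⟩
  · rw [f.tsupport_eq]
    exact (Metric.closedBall_subset_closedBall (by simp [f]; linarith)).trans hU
  · exact f.one_of_mem_closedBall (Metric.ball_subset_closedBall hy)
  · rw [f.tsupport_eq]

section

variable {X : E2 → E3} {U : Set E2} {h : E2 → ℝ} {G : E2 → E2} {f χ : E2 → ℝ} {x₀ : E2}
  {r m C : ℝ}

lemma IsCutoff.partialDeriv_eq_zero (hχ : IsCutoff U x₀ r χ) {y : E2}
    (hy : y ∈ Metric.ball x₀ (2 * r) ∨ y ∉ Metric.closedBall x₀ (3 * r)) (i : Fin 2) :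
    partialDeriv i χ y = 0 := by
  rcases hy with hy | hy
  · have : χ =ᶠ[𝓝 y] fun _ => 1 := by
      filter_upwards [Metric.isOpen_ball.mem_nhds hy] with z hz using hχ.eq_one z hz
    rw [partialDeriv, this.fderiv_eq]; simp
  · exact image_eq_zero_of_notMem_tsupport fun h => hy (hχ.tsupport_subset
      (IsTestFunction.tsupport_partialDeriv_subset χ i h))

lemma IsCutoff.eq_zero (hχ : IsCutoff U x₀ r χ) {y : E2}
    (hy : y ∉ Metric.closedBall x₀ (3 * r)) : χ y = 0 :=
  image_eq_zero_of_notMem_tsupport fun h => hy (hχ.tsupport_subset h)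

lemma dist_lower {y z : E2} (hy : y ∉ Metric.ball x₀ (2 * r)) (hz : z ∈ Metric.ball x₀ r) :
    r ≤ ‖y - z‖ := by
  rw [Metric.mem_ball] at hy hz
  have := dist_triangle y z x₀
  rw [← dist_eq_norm]
  linarith

/-- The four terms on the right of the representation formula. -/
def potential (X : E2 → E3) (h : E2 → ℝ) (G : E2 → E2) (f χ : E2 → ℝ) (p : ℝ × E2) : ℝ :=
  (∫ y, areaDensity X y * (∑ i, ∑ j, (firstForm X y)⁻¹ i j * (G y i * partialDeriv j χ y)) *
        logKernel X p.1 (X p.2) y) -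
      (∫ y, h y * (areaDensity X y * inner ℝ (kernelField X p.1 (X p.2) y) (chartGrad X χ y))) -
      (∫ y, f y * χ y * logKernel X p.1 (X p.2) y) -
      ∫ y, h y * (areaDensity X y * kernelError X p.1 (X p.2) y * χ y)

lemma IsGoodBall.ball_subset (hg : IsGoodBall X x₀ r m C) :
    Metric.ball x₀ r ⊆ Metric.closedBall x₀ (4 * r) :=
  Metric.ball_subset_closedBall.trans (Metric.closedBall_subset_closedBall (by
    have := hg.r_pos; linarith))

lemma IsGoodBall.closedBall_subset (hg : IsGoodBall X x₀ r m C) :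
    Metric.closedBall x₀ (3 * r) ⊆ Metric.closedBall x₀ (4 * r) :=
  Metric.closedBall_subset_closedBall (by have := hg.r_pos; linarith)

lemma IsGoodBall.ne_image (hg : IsGoodBall X x₀ r m C) {y z : E2}
    (hy : y ∈ Metric.closedBall x₀ (4 * r)) (hz : z ∈ Metric.closedBall x₀ (4 * r))
    (hyz : y ≠ z) : X y ≠ X z := by
  intro h
  have := hg.lower y hy z hz
  rw [h, sub_self, norm_zero] at this
  exact absurd this (not_le.mpr (mul_pos hg.m_pos (norm_pos_iff.mpr (sub_ne_zero.mpr hyz))))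

lemma IsGoodBall.aemeasurable (hg : IsGoodBall X x₀ r m C) {F : Type*} [TopologicalSpace F]
    [TopologicalSpace.PseudoMetrizableSpace F]
    [MeasurableSpace F] [BorelSpace F] {k : E2 → F}
    (hk : ∀ y, IsRegularAt X y → ContinuousAt k y) :
    AEMeasurable k (volume.restrict (Metric.closedBall x₀ (3 * r))) :=
  ContinuousOn.aemeasurable (fun y hy =>
    (hk y (hg.regular y (hg.closedBall_subset hy))).continuousWithinAt)
    Metric.isClosed_closedBall.measurableSet

lemma integrable_grad_term (H : IsWeakSolution X U h G f) (hχ : IsTestFunction U χ) :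
    Integrable (fun y => areaDensity X y *
      (∑ i, ∑ j, (firstForm X y)⁻¹ i j * (G y i * partialDeriv j χ y))) := by
  have : ∀ i j, Integrable (fun y => G y i * ((areaDensity X y * (firstForm X y)⁻¹ i j) *
      partialDeriv j χ y)) := fun i j =>
    ((hχ.partialDeriv j).mul fun y hy => ((H.regular y hy).contDiffAt_areaDensity.mul
      ((H.regular y hy).contDiffAt_inv_firstForm i j))).integrable_mul (H.integrable_grad i)
  refine (integrable_finsetSum Finset.univ fun i _ =>
    integrable_finsetSum Finset.univ fun j _ => this i j).congr (.of_forall fun y => ?_)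
  simp only [Fin.sum_univ_two]; ring

lemma setIntegral_closedBall {k : E2 → ℝ} {R : ℝ} (hk : ∀ y ∉ Metric.closedBall x₀ R, k y = 0) :
    ∫ y, k y = ∫ y in Metric.closedBall x₀ R, k y :=
  (setIntegral_eq_integral_of_forall_compl_eq_zero hk).symm

/-- The derivatives of the cut-off function vanish near the pole, where `G`, which is only
integrable, would meet the singularity of the kernel. -/
lemma isGoodPotential_gradTerm (H : IsWeakSolution X U h G f) (hg : IsGoodBall X x₀ r m C)
    (hχ : IsCutoff U x₀ r χ) :
    IsGoodPotential x₀ r (fun p => ∫ y, areaDensity X y *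
      (∑ i, ∑ j, (firstForm X y)⁻¹ i j * (G y i * partialDeriv j χ y)) *
        logKernel X p.1 (X p.2) y) := by
  have hr := hg.r_pos
  have hm := hg.m_pos
  set q : E2 → ℝ := fun y => areaDensity X y *
      (∑ i, ∑ j, (firstForm X y)⁻¹ i j * (G y i * partialDeriv j χ y)) with hq
  have hq0 : ∀ y, (y ∈ Metric.ball x₀ (2 * r) ∨ y ∉ Metric.closedBall x₀ (3 * r)) → q y = 0 := by
    intro y hy
    simp [hq, hχ.partialDeriv_eq_zero hy]
  have hqi : Integrable q := integrable_grad_term H hχ.test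
  have hX := hg.aemeasurable (k := X) fun y hy => hy.smooth.continuousAt
  have e : (fun p : ℝ × E2 => ∫ y, q y * logKernel X p.1 (X p.2) y) = fun p =>
      ∫ y in Metric.closedBall x₀ (3 * r), q y * logKernel X p.1 (X p.2) y := by
    funext p
    exact setIntegral_closedBall fun y hy => by simp [hq0 y (Or.inr hy)]
  rw [e]
  refine isGoodPotential_of_dominated
    (bound := fun y => ‖q y‖ * (((C * (8 * r)) ^ 2 + 1) + m⁻¹ * r⁻¹))
    (hqi.norm.mul_const _).integrableOn (fun ε z hε hz => ?_) (fun ε z hε hz => ?_)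
    (fun z hz => ?_)
  · exact hqi.aestronglyMeasurable.restrict.mul
      (aemeasurable_logKernel ε (X z) hX).aestronglyMeasurable
  · filter_upwards [ae_restrict_mem Metric.isClosed_closedBall.measurableSet] with y hy
    by_cases hy2 : y ∈ Metric.ball x₀ (2 * r)
    · simp [hq0 y (Or.inl hy2)]
    have hd := dist_lower hy2 hz
    have hyz : y ≠ z := by
      rintro rfl
      simp at hd; linarith
    rw [norm_mul]
    refine mul_le_mul_of_nonneg_left ((hg.abs_logKernel_le hε (hg.closedBall_subset hy)
      (hg.ball_subset hz) hyz).trans ?_) (norm_nonneg _)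
    gcongr
  · filter_upwards [ae_restrict_mem Metric.isClosed_closedBall.measurableSet,
      ae_restrict_ne _ z] with y hy hyz
    exact continuousAt_const.mul (continuousAt_logKernel
      (hg.regular z (hg.ball_subset hz)).smooth.continuousAt
      (hg.ne_image (hg.closedBall_subset hy) (hg.ball_subset hz) hyz))

/-- As for `isGoodPotential_gradTerm`, the integrand vanishes near the pole. -/
lemma isGoodPotential_kernelField (H : IsWeakSolution X U h G f) (hg : IsGoodBall X x₀ r m C)
    (hU : Metric.closedBall x₀ (4 * r) ⊆ U) (hχ : IsCutoff U x₀ r χ) :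
    IsGoodPotential x₀ r (fun p => ∫ y, h y * (areaDensity X y *
      inner ℝ (kernelField X p.1 (X p.2) y) (chartGrad X χ y))) := by
  have hr := hg.r_pos
  have hm := hg.m_pos
  have hg0 : ∀ y, (y ∈ Metric.ball x₀ (2 * r) ∨ y ∉ Metric.closedBall x₀ (3 * r)) →
      chartGrad X χ y = 0 := by
    intro y hy
    simp [chartGrad, hχ.partialDeriv_eq_zero hy]
  have hhi : IntegrableOn h (Metric.closedBall x₀ (3 * r)) :=
    H.integrable _ (hg.closedBall_subset.trans hU) (isCompact_closedBall _ _)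
  have hX := hg.aemeasurable (k := X) fun y hy => hy.smooth.continuousAt
  have hA := hg.aemeasurable (k := areaDensity X) fun y hy => hy.contDiffAt_areaDensity.continuousAt
  have hG := hg.aemeasurable (k := chartGrad X χ) fun y hy =>
    (hy.contDiffAt_chartGrad hχ.test.1.contDiffAt).continuousAt
  obtain ⟨A, hAb⟩ := (isCompact_closedBall x₀ (3 * r)).exists_bound_of_continuousOn
    (f := fun y => areaDensity X y * ‖chartGrad X χ y‖) (fun y hy =>
      ((hg.regular y (hg.closedBall_subset hy)).contDiffAt_areaDensity.continuousAt.mul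
        ((hg.regular y (hg.closedBall_subset hy)).contDiffAt_chartGrad
          hχ.test.1.contDiffAt).continuousAt.norm).continuousWithinAt)
  have e : (fun p : ℝ × E2 => ∫ y, h y * (areaDensity X y *
      inner ℝ (kernelField X p.1 (X p.2) y) (chartGrad X χ y))) = fun p =>
      ∫ y in Metric.closedBall x₀ (3 * r), h y * (areaDensity X y *
      inner ℝ (kernelField X p.1 (X p.2) y) (chartGrad X χ y)) := by
    funext p
    exact setIntegral_closedBall fun y hy => by simp [hg0 y (Or.inr hy)]
  rw [e]
  refine isGoodPotential_of_dominated
    (bound := fun y => ‖h y‖ * (m⁻¹ * r⁻¹ * A))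
    (hhi.norm.mul_const _) (fun ε z hε hz => ?_) (fun ε z hε hz => ?_)
    (fun z hz => ?_)
  · exact hhi.aestronglyMeasurable.mul (hA.mul
      ((aemeasurable_kernelField ε (X z) hX).inner hG)).aestronglyMeasurable
  · filter_upwards [ae_restrict_mem Metric.isClosed_closedBall.measurableSet] with y hy
    have hAy : areaDensity X y * ‖chartGrad X χ y‖ ≤ A := (le_abs_self _).trans (hAb y hy)
    have hA0 : 0 ≤ areaDensity X y := Real.sqrt_nonneg _
    have hAA : 0 ≤ A := (mul_nonneg hA0 (norm_nonneg _)).trans hAy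
    rw [norm_mul]
    refine mul_le_mul_of_nonneg_left ?_ (norm_nonneg _)
    by_cases hy2 : y ∈ Metric.ball x₀ (2 * r)
    · simp only [hg0 y (Or.inl hy2), inner_zero_right, mul_zero, norm_zero]
      positivity
    have hd := dist_lower hy2 hz
    have h1 := hg.norm_kernelField_le ε (hg.closedBall_subset hy) (hg.ball_subset hz)
    have h2 : m⁻¹ * ‖y - z‖⁻¹ ≤ m⁻¹ * r⁻¹ := by gcongr
    rw [norm_mul, Real.norm_of_nonneg hA0]
    calc _ ≤ areaDensity X y * (‖kernelField X ε (X z) y‖ * ‖chartGrad X χ y‖) := by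
          gcongr; exact norm_inner_le_norm _ _
      _ = ‖kernelField X ε (X z) y‖ * (areaDensity X y * ‖chartGrad X χ y‖) := by ring
      _ ≤ _ := mul_le_mul (h1.trans h2) hAy (by positivity) (by positivity)
  · filter_upwards [ae_restrict_mem Metric.isClosed_closedBall.measurableSet,
      ae_restrict_ne _ z] with y hy hyz
    exact continuousAt_const.mul (continuousAt_const.mul ((continuousAt_kernelField
      (hg.regular z (hg.ball_subset hz)).smooth.continuousAt
      (hg.ne_image (hg.closedBall_subset hy) (hg.ball_subset hz) hyz)).inner continuousAt_const))

/-- The potential of the bounded error term. -/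
lemma isGoodPotential_kernelError (H : IsWeakSolution X U h G f) (hg : IsGoodBall X x₀ r m C)
    (hU : Metric.closedBall x₀ (4 * r) ⊆ U) (hχ : IsCutoff U x₀ r χ) :
    IsGoodPotential x₀ r (fun p => ∫ y, h y * (areaDensity X y *
      kernelError X p.1 (X p.2) y * χ y)) := by
  have hr := hg.r_pos
  have hm := hg.m_pos
  have hC := hg.C_pos
  have hhi : IntegrableOn h (Metric.closedBall x₀ (3 * r)) :=
    H.integrable _ (hg.closedBall_subset.trans hU) (isCompact_closedBall _ _)
  have hX := hg.aemeasurable (k := X) fun y hy => hy.smooth.continuousAt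
  have hA := hg.aemeasurable (k := areaDensity X) fun y hy => hy.contDiffAt_areaDensity.continuousAt
  have hn := hg.aemeasurable (k := chartNormal X) fun y hy =>
    (contDiffAt_chartNormal hy.smooth).continuousAt
  have hD := hg.aemeasurable (k := fun y => (firstForm X y).det) fun y hy =>
    (contDiffAt_det_firstForm hy.smooth).continuousAt
  have hH : AEMeasurable (meanCurvature X) (volume.restrict (Metric.closedBall x₀ (3 * r))) := by
    refine AEMeasurable.congr ((hg.aemeasurable fun y hy =>
      hy.continuousAt_curvatureFactor).smul hn) ?_
    filter_upwards [ae_restrict_mem Metric.isClosed_closedBall.measurableSet] with y hy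
    exact (meanCurvature_eq_smul (hg.regular y (hg.closedBall_subset hy)).det_pos).symm
  have hχm : AEMeasurable χ (volume.restrict (Metric.closedBall x₀ (3 * r))) :=
    hχ.test.1.continuous.measurable.aemeasurable
  obtain ⟨A, hAb⟩ := (isCompact_closedBall x₀ (3 * r)).exists_bound_of_continuousOn
    (f := fun y => areaDensity X y * χ y) (fun y hy =>
      ((hg.regular y (hg.closedBall_subset hy)).contDiffAt_areaDensity.continuousAt.mul
        hχ.test.1.continuous.continuousAt).continuousWithinAt)
  have e : (fun p : ℝ × E2 => ∫ y, h y * (areaDensity X y *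
      kernelError X p.1 (X p.2) y * χ y)) = fun p =>
      ∫ y in Metric.closedBall x₀ (3 * r), h y * (areaDensity X y *
      kernelError X p.1 (X p.2) y * χ y) := by
    funext p
    exact setIntegral_closedBall fun y hy => by simp [hχ.eq_zero hy]
  rw [e]
  refine isGoodPotential_of_dominated
    (bound := fun y => ‖h y‖ * (A * (2 * C ^ 2 / m ^ 5 + C / m ^ 2)))
    (hhi.norm.mul_const _) (fun ε z hε hz => ?_) (fun ε z hε hz => ?_)
    (fun z hz => ?_)
  · exact hhi.aestronglyMeasurable.mul ((hA.mul
      (aemeasurable_kernelError ε (X z) hX hn hH hD)).mul hχm).aestronglyMeasurable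
  · filter_upwards [ae_restrict_mem Metric.isClosed_closedBall.measurableSet] with y hy
    have hAy := hAb y hy
    have hE := hg.abs_kernelError_le ε (hg.closedBall_subset hy) (hg.ball_subset hz)
    rw [norm_mul]
    refine mul_le_mul_of_nonneg_left ?_ (norm_nonneg _)
    have : areaDensity X y * kernelError X ε (X z) y * χ y =
      (areaDensity X y * χ y) * kernelError X ε (X z) y := by ring
    rw [this, norm_mul]
    exact mul_le_mul hAy hE (norm_nonneg _) ((norm_nonneg _).trans hAy)
  · filter_upwards [ae_restrict_mem Metric.isClosed_closedBall.measurableSet,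
      ae_restrict_ne _ z] with y hy hyz
    exact continuousAt_const.mul ((continuousAt_const.mul (continuousAt_kernelError
      (hg.regular z (hg.ball_subset hz)).smooth.continuousAt
      (hg.ne_image (hg.closedBall_subset hy) (hg.ball_subset hz) hyz)
      (hg.regular y (hg.closedBall_subset hy)).det_pos.ne')).mul continuousAt_const)

end

section

variable {X : E2 → E3} {U : Set E2} {h : E2 → ℝ} {G : E2 → E2} {f χ : E2 → ℝ} {x₀ : E2}
  {r m C : ℝ}

lemma continuous_mul_test (hf : ContinuousOn f U) (hU : IsOpen U) (hχ : IsTestFunction U χ) :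
    Continuous (fun y => f y * χ y) := by
  rw [continuous_iff_continuousAt]
  intro y
  by_cases hy : y ∈ U
  · exact (hf.continuousAt (hU.mem_nhds hy)).mul hχ.1.continuous.continuousAt
  · have : (fun y => f y * χ y) =ᶠ[𝓝 y] fun _ => 0 := by
      filter_upwards [(isClosed_tsupport χ).isOpen_compl.mem_nhds fun h => hy (hχ.2.2 h)] with z hz
      simp [image_eq_zero_of_notMem_tsupport hz]
    exact continuousAt_const.congr this.symm

/-- The logarithmic potential of a continuous function is continuous; moving the pole to the
origin makes the singularity independent of the parameters. -/
lemma isGoodPotential_logKernel (H : IsWeakSolution X U h G f) (hg : IsGoodBall X x₀ r m C)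
    (hχ : IsCutoff U x₀ r χ) :
    IsGoodPotential x₀ r (fun p => ∫ y, f y * χ y * logKernel X p.1 (X p.2) y) := by
  have hr := hg.r_pos
  have hm := hg.m_pos
  set q : E2 → ℝ := fun y => f y * χ y with hq
  have hqc : Continuous q := continuous_mul_test H.continuousOn H.isOpen hχ.test
  have hq0 : ∀ y ∉ Metric.closedBall x₀ (3 * r), q y = 0 := fun y hy => by simp [hq, hχ.eq_zero hy]
  obtain ⟨A, hA⟩ := (isCompact_closedBall x₀ (3 * r)).exists_bound_of_continuousOn hqc.continuousOn
  have hX := hg.aemeasurable (k := X) fun y hy => hy.smooth.continuousAt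
  have hmeas : ∀ ε a, AEStronglyMeasurable (fun y => q y * logKernel X ε a y) volume := by
    intro ε a
    have h1 : AEStronglyMeasurable (fun y => q y * logKernel X ε a y)
        (volume.restrict (Metric.closedBall x₀ (3 * r))) :=
      hqc.aestronglyMeasurable.mul (aemeasurable_logKernel ε a hX).aestronglyMeasurable
    rw [← aestronglyMeasurable_indicator_iff Metric.isClosed_closedBall.measurableSet] at h1
    refine h1.congr (.of_forall fun y => ?_)
    by_cases hy : y ∈ Metric.closedBall x₀ (3 * r)
    · simp [Set.indicator_of_mem hy]
    · simp [Set.indicator_of_notMem hy, hq0 y hy]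
  set K : Set E2 := Metric.ball 0 (5 * r) with hK
  -- the statement after translation; the integrand is cut off outside `K`
  have key : IsGoodPotential x₀ r (fun p => ∫ w in K,
      q (p.2 + w) * logKernel X p.1 (X p.2) (p.2 + w)) := by
    refine isGoodPotential_of_dominated
      (bound := fun w => A * (((C * (8 * r)) ^ 2 + 1) + m⁻¹ * ‖w‖⁻¹)) ?_
      (fun ε z hε hz => ?_) (fun ε z hε hz => ?_) (fun z hz => ?_)
    · exact (Integrable.add (integrable_const_iff.mpr (Or.inr (by
        rw [isFiniteMeasure_restrict]; exact measure_ball_lt_top.ne)))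
        ((integrableOn_inv_norm (5 * r)).const_mul m⁻¹)).const_mul A
    · exact ((hmeas ε (X z)).comp_measurePreserving
        (measurePreserving_add_left volume z)).restrict
    · filter_upwards [ae_restrict_ne _ 0] with w hw
      by_cases hy : z + w ∈ Metric.closedBall x₀ (3 * r)
      · have hAy := hA _ hy
        have hne : z + w ≠ z := by simpa using hw
        have h1 := hg.abs_logKernel_le hε (hg.closedBall_subset hy) (hg.ball_subset hz) hne
        rw [add_sub_cancel_left] at h1
        rw [norm_mul]
        exact mul_le_mul hAy h1 (norm_nonneg _) ((norm_nonneg _).trans hAy)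
      · have hA0 : 0 ≤ A := (norm_nonneg _).trans (hA x₀ (Metric.mem_closedBall_self (by positivity)))
        rw [hq0 _ hy]
        simp only [zero_mul, norm_zero]
        positivity
    · filter_upwards [ae_restrict_ne _ 0] with w hw
      have hne : z + w ≠ z := by simpa using hw
      by_cases hy : z + w ∈ Metric.closedBall x₀ (3 * r)
      · have hz4 := hg.ball_subset hz
        have hy4 := hg.closedBall_subset hy
        have hs : ‖X (z + w) - X z‖ ^ 2 + (0 : ℝ) ^ 2 ≠ 0 :=
          (hg.kernel_sq_pos_of_ne 0 hy4 hz4 hne).ne'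
        have h2 : ContinuousAt (fun p : ℝ × E2 => p.2) (0, z) := continuousAt_snd
        have h3 : ContinuousAt (fun p : ℝ × E2 => p.2 + w) (0, z) := h2.add continuousAt_const
        have h4 : ContinuousAt (fun p : ℝ × E2 => X (p.2 + w)) (0, z) :=
          ContinuousAt.comp (x := ((0 : ℝ), z)) (f := fun p : ℝ × E2 => p.2 + w)
            (hg.regular _ hy4).smooth.continuousAt h3
        have h5 : ContinuousAt (fun p : ℝ × E2 => X p.2) (0, z) :=
          ContinuousAt.comp (x := ((0 : ℝ), z)) (f := Prod.snd)
            (hg.regular _ hz4).smooth.continuousAt h2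
        refine ContinuousAt.mul (hqc.continuousAt.comp h3) (ContinuousAt.div_const ?_ 2)
        exact ((h4.sub h5).norm.pow 2 |>.add (continuousAt_fst.pow 2)).log hs
      · have h1 : ∀ᶠ p : ℝ × E2 in 𝓝 (0, z), p.2 + w ∉ Metric.closedBall x₀ (3 * r) := by
          have h3 : Continuous (fun p : ℝ × E2 => p.2 + w) := by fun_prop
          exact (h3.tendsto (0, z)).eventually
            (Metric.isClosed_closedBall.isOpen_compl.mem_nhds hy)
        refine (continuousAt_const (y := (0 : ℝ))).congr ?_
        filter_upwards [h1] with p hp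
        rw [hq0 _ hp, zero_mul]
  have e : ∀ ε, ∀ z ∈ Metric.ball x₀ r, ∫ y, q y * logKernel X ε (X z) y =
      ∫ w in K, q (z + w) * logKernel X ε (X z) (z + w) := by
    intro ε z hz
    rw [← integral_add_left_eq_self _ z]
    refine (setIntegral_eq_integral_of_forall_compl_eq_zero fun w hw => ?_).symm
    rw [hq0, zero_mul]
    intro hy
    apply hw
    rw [Metric.mem_closedBall, dist_eq_norm] at hy
    rw [Metric.mem_ball, dist_eq_norm] at hz
    rw [hK, mem_ball_zero_iff]
    have h1 : w = (z + w - x₀) - (z - x₀) := by abel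
    have := norm_sub_le (z + w - x₀) (z - x₀)
    rw [← h1] at this
    linarith
  obtain ⟨B, hB⟩ := key.2
  refine ⟨fun z hz => (key.1 z hz).congr ?_, B, fun ε z hε hz => ?_⟩
  · have : ∀ᶠ p : ℝ × E2 in 𝓝 (0, z), p.2 ∈ Metric.ball x₀ r :=
      continuousAt_snd.eventually (Metric.isOpen_ball.mem_nhds hz)
    filter_upwards [this] with p hp
    exact (e p.1 p.2 hp).symm
  · have := hB ε z hε hz
    dsimp only at this ⊢
    rwa [e ε z hz]

lemma isGoodPotential_potential (H : IsWeakSolution X U h G f) (hg : IsGoodBall X x₀ r m C)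
    (hU : Metric.closedBall x₀ (4 * r) ⊆ U) (hχ : IsCutoff U x₀ r χ) :
    IsGoodPotential x₀ r (potential X h G f χ) :=
  (((isGoodPotential_gradTerm H hg hχ).sub (isGoodPotential_kernelField H hg hU hχ)).sub
    (isGoodPotential_logKernel H hg hχ)).sub (isGoodPotential_kernelError H hg hU hχ)

/-- The mass of the limit of the approximate identity. -/
def kernelMass (X : E2 → E3) (y : E2) : ℝ := ∫ w, 2 / (‖fderiv ℝ X y w‖ ^ 2 + 1) ^ 2

lemma integrable_kernel_bound {m : ℝ} (hm : 0 < m) :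
    Integrable (fun w : E2 => 2 / ((m * ‖w‖) ^ 2 + 1) ^ 2) := by
  have h1 : Integrable (fun w : E2 => ((1 : ℝ) + ‖w‖ ^ 2) ^ (-(4 : ℝ) / 2)) :=
    integrable_rpow_neg_one_add_norm_sq (by simp; norm_num)
  have h2 := (h1.comp_smul hm.ne').const_mul 2
  refine h2.congr (.of_forall fun w => ?_)
  dsimp only
  rw [norm_smul, Real.norm_of_nonneg hm.le, show (-(4 : ℝ) / 2) = -((2 : ℕ) : ℝ) by norm_num,
    Real.rpow_neg (by positivity), Real.rpow_natCast, add_comm, div_eq_mul_inv]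

lemma IsGoodBall.kernel_le (hg : IsGoodBall X x₀ r m C) {y : E2}
    (hy : y ∈ Metric.closedBall x₀ (4 * r)) (w : E2) :
    2 / (‖fderiv ℝ X y w‖ ^ 2 + 1) ^ 2 ≤ 2 / ((m * ‖w‖) ^ 2 + 1) ^ 2 := by
  have := hg.fderiv_lower y hy w
  have := mul_nonneg hg.m_pos.le (norm_nonneg w)
  gcongr

lemma IsGoodBall.kernelMass_pos (hg : IsGoodBall X x₀ r m C) {y : E2}
    (hy : y ∈ Metric.closedBall x₀ (4 * r)) : 0 < kernelMass X y := by
  have hc : Continuous (fun w => 2 / (‖fderiv ℝ X y w‖ ^ 2 + 1) ^ 2) :=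
    continuous_const.div (by fun_prop) fun w => by positivity
  have hi : Integrable (fun w => 2 / (‖fderiv ℝ X y w‖ ^ 2 + 1) ^ 2) := by
    refine (integrable_kernel_bound hg.m_pos).mono' hc.aestronglyMeasurable (.of_forall fun w => ?_)
    rw [Real.norm_of_nonneg (by positivity)]
    exact hg.kernel_le hy w
  rw [kernelMass, integral_pos_iff_support_of_nonneg (fun w => by positivity) hi]
  have : Function.support (fun w => 2 / (‖fderiv ℝ X y w‖ ^ 2 + 1) ^ 2) = Set.univ := by
    ext w; simp only [Function.mem_support, Set.mem_univ, iff_true]; positivity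
  rw [this]
  simp

lemma IsGoodBall.continuousOn_kernelMass (hg : IsGoodBall X x₀ r m C) :
    ContinuousOn (kernelMass X) (Metric.ball x₀ r) := by
  intro y hy
  refine ContinuousAt.continuousWithinAt (continuousAt_of_dominated
    (bound := fun w => 2 / ((m * ‖w‖) ^ 2 + 1) ^ 2) ?_ ?_ (integrable_kernel_bound hg.m_pos) ?_)
  · refine .of_forall fun z => Continuous.aestronglyMeasurable ?_
    exact continuous_const.div (by fun_prop) fun w => by positivity
  · filter_upwards [Metric.isOpen_ball.mem_nhds hy] with z hz
    refine .of_forall fun w => ?_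
    rw [Real.norm_of_nonneg (by positivity)]
    exact hg.kernel_le (hg.ball_subset hz) w
  · refine .of_forall fun w => ?_
    have h1 : ContinuousAt (fderiv ℝ X) y :=
      ((hg.regular y (hg.ball_subset hy)).smooth.fderiv_right (m := ∞) le_rfl).continuousAt
    exact continuousAt_const.div ((((h1.clm_apply continuousAt_const).norm.pow 2).add
      continuousAt_const).pow 2) (by positivity)

end

section

variable {X : E2 → E3} {U : Set E2} {h : E2 → ℝ} {G : E2 → E2} {f χ η : E2 → ℝ} {x₀ : E2}
  {r m C : ℝ}

/-- The approximate identity given by the Laplacian of the kernel, applied to `η`. -/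
def smoothing (X : E2 → E3) (η : E2 → ℝ) (ε : ℝ) (y : E2) : ℝ :=
  ∫ z, η z * (2 * ε ^ 2 / (‖X y - X z‖ ^ 2 + ε ^ 2) ^ 2)

lemma smoothing_eq (X : E2 → E3) (η : E2 → ℝ) {ε : ℝ} (hε : 0 < ε) (y : E2) :
    smoothing X η ε y = ∫ w, η (y + ε • w) *
      (2 / (‖ε⁻¹ • (X (y + ε • w) - X y)‖ ^ 2 + 1) ^ 2) := by
  rw [smoothing, ← integral_add_left_eq_self _ y]
  have h1 := Measure.integral_comp_smul volume (fun u : E2 => η (y + u) *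
    (2 * ε ^ 2 / (‖X y - X (y + u)‖ ^ 2 + ε ^ 2) ^ 2)) ε
  have h2 : |(ε ^ Module.finrank ℝ E2)⁻¹| = (ε ^ 2)⁻¹ := by
    rw [finrank_euclideanSpace_fin, abs_of_pos (by positivity)]
  rw [h2, smul_eq_mul, eq_comm, inv_mul_eq_iff_eq_mul₀ (by positivity), ← integral_const_mul] at h1
  rw [h1]
  refine integral_congr_ae (.of_forall fun w => ?_)
  dsimp only
  rw [norm_smul, norm_inv, Real.norm_of_nonneg hε.le, norm_sub_rev (X y)]
  have : 0 < ‖X (y + ε • w) - X y‖ ^ 2 + ε ^ 2 := by positivity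
  field_simp

lemma IsGoodBall.smoothing_integrand_le (hg : IsGoodBall X x₀ r m C)
    (hη : IsTestFunction (Metric.ball x₀ r) η) {N : ℝ} (hN : ∀ z, ‖η z‖ ≤ N) {ε : ℝ} (hε : 0 < ε)
    {y : E2} (hy : y ∈ Metric.closedBall x₀ (4 * r)) (w : E2) :
    ‖η (y + ε • w) * (2 / (‖ε⁻¹ • (X (y + ε • w) - X y)‖ ^ 2 + 1) ^ 2)‖ ≤
      N * (2 / ((m * ‖w‖) ^ 2 + 1) ^ 2) := by
  have hm := hg.m_pos
  have hN0 : 0 ≤ N := (norm_nonneg _).trans (hN y)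
  by_cases hz : y + ε • w ∈ Metric.ball x₀ r
  · have h1 := hg.lower _ (hg.ball_subset hz) y hy
    rw [add_sub_cancel_left, norm_smul, Real.norm_of_nonneg hε.le] at h1
    have h2 : m * ‖w‖ ≤ ‖ε⁻¹ • (X (y + ε • w) - X y)‖ := by
      rw [norm_smul, norm_inv, Real.norm_of_nonneg hε.le, le_inv_mul_iff₀ hε]
      linarith
    rw [norm_mul]
    refine mul_le_mul (hN _) ?_ (norm_nonneg _) hN0
    rw [Real.norm_of_nonneg (by positivity)]
    gcongr
  · rw [hη.eq_zero hz, zero_mul, norm_zero]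
    positivity

/-- The leading parts of the Laplacians of the kernels form an approximate identity: rescaled by
`ε`, they converge to the density `2 / (‖dX w‖² + 1)²` on the tangent plane. -/
lemma tendsto_smoothing (hg : IsGoodBall X x₀ r m C) (hη : IsTestFunction (Metric.ball x₀ r) η)
    {y : E2} (hy : y ∈ Metric.closedBall x₀ (4 * r)) :
    Filter.Tendsto (fun ε => smoothing X η ε y) (𝓝[>] 0) (𝓝 (η y * kernelMass X y)) := by
  have hm := hg.m_pos
  obtain ⟨N, hN⟩ := hη.2.1.exists_bound_of_continuous hη.1.continuous
  have e : (fun ε => ∫ w, η (y + ε • w) * (2 / (‖ε⁻¹ • (X (y + ε • w) - X y)‖ ^ 2 + 1) ^ 2))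
      =ᶠ[𝓝[>] 0] fun ε => smoothing X η ε y := by
    filter_upwards [self_mem_nhdsWithin] with ε hε
    exact (smoothing_eq X η hε y).symm
  refine Filter.Tendsto.congr' e ?_
  rw [kernelMass, ← integral_const_mul]
  refine tendsto_integral_filter_of_dominated_convergence
    (fun w => N * (2 / ((m * ‖w‖) ^ 2 + 1) ^ 2)) ?_ ?_
    ((integrable_kernel_bound hm).const_mul N) ?_
  · filter_upwards [self_mem_nhdsWithin] with ε hε
    have hε' : (0 : ℝ) < ε := hε
    have hreg : ∀ z ∈ Metric.ball x₀ r, ContDiffAt ℝ ∞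
        (fun z => 2 / (‖ε⁻¹ • (X z - X y)‖ ^ 2 + 1) ^ 2) z := by
      intro z hz
      have h1 := (hg.regular z (hg.ball_subset hz)).smooth
      refine contDiffAt_const.div (((((h1.sub contDiffAt_const).const_smul _).norm_sq ℝ).add
        contDiffAt_const).pow 2) ?_
      positivity
    have hc := (hη.mul hreg).1.continuous.comp
      (show Continuous fun w : E2 => y + ε • w by fun_prop)
    refine Continuous.aestronglyMeasurable (hc.congr fun w => ?_)
    simp only [Function.comp]
    ring
  · filter_upwards [self_mem_nhdsWithin] with ε hε
    exact .of_forall fun w => hg.smoothing_integrand_le hη hN hε hy w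
  · refine .of_forall fun w => ?_
    have h1 : Filter.Tendsto (fun ε : ℝ => η (y + ε • w)) (𝓝[>] 0) (𝓝 (η y)) := by
      have : Continuous fun ε : ℝ => η (y + ε • w) := hη.1.continuous.comp (by fun_prop)
      have h := this.tendsto 0
      simp only [zero_smul, add_zero] at h
      exact h.mono_left nhdsWithin_le_nhds
    have h2 : HasDerivAt (fun t : ℝ => X (y + t • w)) (fderiv ℝ X y w) 0 := by
      have h3 : HasDerivAt (fun t : ℝ => y + t • w) w 0 := by
        simpa using ((hasDerivAt_id (0 : ℝ)).smul_const w).const_add y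
      have h4 : HasFDerivAt X (fderiv ℝ X y) (y + (0 : ℝ) • w) := by
        simpa using ((hg.regular y hy).smooth.differentiableAt (by simp)).hasFDerivAt
      exact h4.comp_hasDerivAt _ h3
    have h5 := h2.tendsto_slope_zero_right
    simp only [zero_add, zero_smul, add_zero] at h5
    exact h1.mul (tendsto_const_nhds.div (((h5.norm.pow 2).add_const 1).pow 2) (by positivity))

lemma IsGoodBall.abs_smoothing_le (hg : IsGoodBall X x₀ r m C)
    (hη : IsTestFunction (Metric.ball x₀ r) η) {N : ℝ} (hN : ∀ z, ‖η z‖ ≤ N) {ε : ℝ} (hε : 0 < ε)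
    {y : E2} (hy : y ∈ Metric.closedBall x₀ (4 * r)) :
    ‖smoothing X η ε y‖ ≤ ∫ w : E2, N * (2 / ((m * ‖w‖) ^ 2 + 1) ^ 2) := by
  rw [smoothing_eq X η hε]
  exact norm_integral_le_of_norm_le ((integrable_kernel_bound hg.m_pos).const_mul N)
    (.of_forall fun w => hg.smoothing_integrand_le hη hN hε hy w)

/-- The representation formula, paired with a test function. -/
lemma integral_mul_potential (H : IsWeakSolution X U h G f) (hg : IsGoodBall X x₀ r m C)
    (hU : Metric.closedBall x₀ (4 * r) ⊆ U) (hχ : IsCutoff U x₀ r χ)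
    (hη : IsTestFunction (Metric.ball x₀ r) η) {ε : ℝ} (hε : 0 < ε) :
    Integrable (fun z => η z * potential X h G f χ (ε, z))
      (volume.restrict (Metric.closedBall x₀ (3 * r))) ∧
    ∫ z, η z * potential X h G f χ (ε, z) =
      ∫ y in Metric.closedBall x₀ (3 * r), (h y * areaDensity X y * χ y) * smoothing X η ε y ∧
    AEStronglyMeasurable (fun y => (h y * areaDensity X y * χ y) * smoothing X η ε y)
      (volume.restrict (Metric.closedBall x₀ (3 * r))) := by
  set K := Metric.closedBall x₀ (3 * r) with hK
  set ν := volume.restrict K with hν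
  have hη0 : ∀ z ∉ K, η z = 0 := fun z hz => hη.eq_zero fun h => hz
    (Metric.ball_subset_closedBall.trans (Metric.closedBall_subset_closedBall
      (by have := hg.r_pos; linarith)) h)
  have hX := hg.aemeasurable (k := X) fun y hy => hy.smooth.continuousAt
  have hq : Integrable (fun y => h y * areaDensity X y * χ y) ν := by
    have h1 := H.integrable K (hg.closedBall_subset.trans hU) (isCompact_closedBall _ _)
    have h2 : ContinuousOn (fun y => areaDensity X y * χ y) K := fun y hy =>
      ((hg.regular y (hg.closedBall_subset hy)).contDiffAt_areaDensity.continuousAt.mul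
        hχ.test.1.continuous.continuousAt).continuousWithinAt
    refine (h1.mul_continuousOn h2 (isCompact_closedBall _ _)).congr (.of_forall fun y => ?_)
    dsimp only
    ring
  have hD : AEStronglyMeasurable (fun p : E2 × E2 =>
      2 * ε ^ 2 / (‖X p.2 - X p.1‖ ^ 2 + ε ^ 2) ^ 2) (ν.prod ν) := by
    have h1 := (hX.comp_snd (μ := ν)).sub (hX.comp_fst (ν := ν))
    exact (((h1.norm.pow_const 2).add_const (ε ^ 2)).pow_const 2 |>.const_div
      (2 * ε ^ 2)).aestronglyMeasurable
  have hint : Integrable (fun p : E2 × E2 => (2 * ε ^ 2 / (‖X p.2 - X p.1‖ ^ 2 + ε ^ 2) ^ 2) *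
      (η p.1 * (h p.2 * areaDensity X p.2 * χ p.2))) (ν.prod ν) := by
    refine (hη.integrable.restrict.mul_prod hq).bdd_mul (c := 2 / ε ^ 2) hD
      (.of_forall fun p => ?_)
    rw [Real.norm_of_nonneg (by positivity)]
    calc _ ≤ 2 * ε ^ 2 / (ε ^ 2) ^ 2 := by gcongr; nlinarith [sq_nonneg ‖X p.2 - X p.1‖]
      _ = 2 / ε ^ 2 := by field_simp
  have hpot : ∀ z, potential X h G f χ (ε, z) = ∫ y in K, (h y * areaDensity X y * χ y) *
      (2 * ε ^ 2 / (‖X y - X z‖ ^ 2 + ε ^ 2) ^ 2) := by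
    intro z
    rw [potential, ← H.representation hχ.test hε (X z),
      setIntegral_closedBall (R := 3 * r) fun y hy => by simp [hχ.eq_zero hy]]
    exact integral_congr_ae (.of_forall fun y => by ring)
  have e1 : ∀ z, η z * potential X h G f χ (ε, z) = ∫ y, (2 * ε ^ 2 /
      (‖X y - X z‖ ^ 2 + ε ^ 2) ^ 2) * (η z * (h y * areaDensity X y * χ y)) ∂ν := by
    intro z
    rw [hpot, ← integral_const_mul]
    exact integral_congr_ae (.of_forall fun y => by ring)
  have e2 : ∀ y, (h y * areaDensity X y * χ y) * smoothing X η ε y = ∫ z, (2 * ε ^ 2 /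
      (‖X y - X z‖ ^ 2 + ε ^ 2) ^ 2) * (η z * (h y * areaDensity X y * χ y)) ∂ν := by
    intro y
    rw [smoothing, setIntegral_closedBall (x₀ := x₀) (R := 3 * r)
      fun z hz => by rw [hη0 z hz, zero_mul], ← integral_const_mul]
    exact integral_congr_ae (.of_forall fun y => by ring)
  refine ⟨?_, ?_, ?_⟩
  · simp only [e1]
    exact hint.integral_prod_left
  · rw [setIntegral_closedBall (x₀ := x₀) (R := 3 * r) fun z hz => by rw [hη0 z hz, zero_mul]]
    simp only [e1, e2]
    exact integral_integral_swap hint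
  · simp only [e2]
    exact hint.integral_prod_right.aestronglyMeasurable

/-- The representation formula in the limit `ε → 0`: up to a positive continuous factor, `h` is
the potential with parameter `0`. -/
lemma integral_mul_potential_zero (H : IsWeakSolution X U h G f) (hg : IsGoodBall X x₀ r m C)
    (hU : Metric.closedBall x₀ (4 * r) ⊆ U) (hχ : IsCutoff U x₀ r χ)
    (hη : IsTestFunction (Metric.ball x₀ r) η) :
    ∫ z, η z * potential X h G f χ (0, z) =
      ∫ y, (h y * areaDensity X y * χ y) * (η y * kernelMass X y) := by
  obtain ⟨N, hN⟩ := hη.2.1.exists_bound_of_continuous hη.1.continuous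
  have hJ := isGoodPotential_potential H hg hU hχ
  obtain ⟨B, hB⟩ := hJ.2
  have hr := hg.r_pos
  set K := Metric.closedBall x₀ (3 * r) with hK
  have hη0 : ∀ z ∉ K, η z = 0 := fun z hz => hη.eq_zero fun h => hz
    (Metric.ball_subset_closedBall.trans (Metric.closedBall_subset_closedBall (by linarith)) h)
  have h1 : Filter.Tendsto (fun ε => ∫ z in K, η z * potential X h G f χ (ε, z)) (𝓝[>] 0)
      (𝓝 (∫ z in K, η z * potential X h G f χ (0, z))) := by
    refine tendsto_integral_filter_of_dominated_convergence (fun z => ‖η z‖ * B) ?_ ?_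
      (hη.integrable.norm.mul_const B).integrableOn ?_
    · filter_upwards [self_mem_nhdsWithin] with ε hε
      exact (integral_mul_potential H hg hU hχ hη hε).1.aestronglyMeasurable
    · have : Set.Ioc (0 : ℝ) 1 ∈ 𝓝[>] (0 : ℝ) := Ioc_mem_nhdsGT one_pos
      filter_upwards [this] with ε hε
      refine .of_forall fun z => ?_
      rw [norm_mul]
      by_cases hz : z ∈ Metric.ball x₀ r
      · refine mul_le_mul_of_nonneg_left (hB ε z ?_ hz) (norm_nonneg _)
        rw [abs_of_pos hε.1]; exact hε.2
      · simp [hη.eq_zero hz]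
    · refine .of_forall fun z => ?_
      by_cases hz : z ∈ Metric.ball x₀ r
      · have h2 : Filter.Tendsto (fun ε : ℝ => (ε, z)) (𝓝[>] 0) (𝓝 (0, z)) :=
          ((Continuous.prodMk continuous_id continuous_const).tendsto 0).mono_left
            nhdsWithin_le_nhds
        exact tendsto_const_nhds.mul ((hJ.1 z hz).tendsto.comp h2)
      · simp [hη.eq_zero hz]
  have hq : Integrable (fun y => h y * areaDensity X y * χ y) (volume.restrict K) := by
    have h1 := H.integrable K (hg.closedBall_subset.trans hU) (isCompact_closedBall _ _)
    have h2 : ContinuousOn (fun y => areaDensity X y * χ y) K := fun y hy =>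
      ((hg.regular y (hg.closedBall_subset hy)).contDiffAt_areaDensity.continuousAt.mul
        hχ.test.1.continuous.continuousAt).continuousWithinAt
    refine (h1.mul_continuousOn h2 (isCompact_closedBall _ _)).congr (.of_forall fun y => ?_)
    dsimp only
    ring
  have h2 : Filter.Tendsto (fun ε => ∫ y in K, (h y * areaDensity X y * χ y) * smoothing X η ε y)
      (𝓝[>] 0) (𝓝 (∫ y in K, (h y * areaDensity X y * χ y) * (η y * kernelMass X y))) := by
    refine tendsto_integral_filter_of_dominated_convergence
      (fun y => ‖h y * areaDensity X y * χ y‖ * ∫ w : E2, N * (2 / ((m * ‖w‖) ^ 2 + 1) ^ 2)) ?_ ?_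
      (hq.norm.mul_const _) ?_
    · filter_upwards [self_mem_nhdsWithin] with ε hε
      exact (integral_mul_potential H hg hU hχ hη hε).2.2
    · filter_upwards [self_mem_nhdsWithin] with ε hε
      filter_upwards [ae_restrict_mem Metric.isClosed_closedBall.measurableSet] with y hy
      rw [norm_mul]
      exact mul_le_mul_of_nonneg_left (hg.abs_smoothing_le hη hN hε (hg.closedBall_subset hy))
        (norm_nonneg _)
    · filter_upwards [ae_restrict_mem Metric.isClosed_closedBall.measurableSet] with y hy
      exact tendsto_const_nhds.mul (tendsto_smoothing hg hη (hg.closedBall_subset hy))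
  rw [setIntegral_closedBall (x₀ := x₀) (R := 3 * r) fun z hz => by rw [hη0 z hz, zero_mul],
    setIntegral_closedBall (x₀ := x₀) (R := 3 * r) fun z hz => by rw [hη0 z hz]; simp]
  refine tendsto_nhds_unique h1 (h2.congr' ?_)
  filter_upwards [self_mem_nhdsWithin] with ε hε
  rw [← (integral_mul_potential H hg hU hχ hη hε).2.1]
  exact setIntegral_closedBall fun z hz => by rw [hη0 z hz, zero_mul]

/-- Interior regularity: a weak solution agrees almost everywhere with a continuous function. -/
theorem IsWeakSolution.exists_continuousOn (H : IsWeakSolution X U h G f) (hx₀ : x₀ ∈ U) :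
    ∃ r, 0 < r ∧ Metric.ball x₀ r ⊆ U ∧ ∃ c : E2 → ℝ, ContinuousOn c (Metric.ball x₀ r) ∧
      ∀ᵐ y, y ∈ Metric.ball x₀ r → h y = c y := by
  obtain ⟨r, m, C, hU, hg⟩ := exists_isGoodBall H.isOpen H.regular hx₀
  obtain ⟨χ, hχ⟩ := exists_isCutoff hg.r_pos hU
  have hJ := isGoodPotential_potential H hg hU hχ
  have hJc : ContinuousOn (fun z => potential X h G f χ (0, z)) (Metric.ball x₀ r) := by
    intro z hz
    have h2 : ContinuousAt (fun z : E2 => ((0 : ℝ), z)) z := by fun_prop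
    exact (ContinuousAt.comp (f := fun z : E2 => ((0 : ℝ), z)) (hJ.1 z hz) h2).continuousWithinAt
  have hAc : ContinuousOn (areaDensity X) (Metric.ball x₀ r) := fun z hz =>
    (hg.regular z (hg.ball_subset hz)).contDiffAt_areaDensity.continuousAt.continuousWithinAt
  have hMc := hg.continuousOn_kernelMass
  refine ⟨r, hg.r_pos, hg.ball_subset.trans hU,
    fun z => potential X h G f χ (0, z) / (areaDensity X z * kernelMass X z), ?_, ?_⟩
  · refine hJc.div (hAc.mul hMc) fun z hz => ?_
    exact (mul_pos (hg.regular z (hg.ball_subset hz)).areaDensity_pos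
      (hg.kernelMass_pos (hg.ball_subset hz))).ne'
  have hloc : LocallyIntegrableOn (fun z => potential X h G f χ (0, z) -
      h z * (areaDensity X z * χ z * kernelMass X z)) (Metric.ball x₀ r) := by
    have hh : LocallyIntegrableOn h (Metric.ball x₀ r) := by
      have : IntegrableOn h (Metric.ball x₀ r) := (H.integrable _ hU (isCompact_closedBall _ _)).mono_set
        hg.ball_subset
      exact this.locallyIntegrableOn
    refine (hJc.locallyIntegrableOn Metric.isOpen_ball.measurableSet).sub ?_
    exact hh.mul_continuousOn ((hAc.mul hχ.test.1.continuous.continuousOn).mul hMc)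
      Metric.isOpen_ball.isLocallyClosed
  have hae := Metric.isOpen_ball.ae_eq_zero_of_integral_contDiff_smul_eq_zero hloc
    fun η h1 h2 h3 => by
      have hη : IsTestFunction (Metric.ball x₀ r) η := ⟨h1, h2, h3⟩
      have i1 := hη.integrable_mul fun K hK hKc =>
        (hJc.mono hK).integrableOn_compact (μ := volume) hKc
      have i2 : Integrable (fun z => h z * (areaDensity X z * χ z * kernelMass X z) * η z) :=
        hη.integrable_mul fun K hK hKc => ((H.integrable K (hK.trans (hg.ball_subset.trans hU)) hKc).mul_continuousOn
          (((hAc.mul hχ.test.1.continuous.continuousOn).mul hMc).mono hK) hKc)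
      have e := integral_mul_potential_zero H hg hU hχ hη
      calc ∫ z, η z • (potential X h G f χ (0, z) -
            h z * (areaDensity X z * χ z * kernelMass X z))
          = ∫ z, (potential X h G f χ (0, z) * η z -
            h z * (areaDensity X z * χ z * kernelMass X z) * η z) :=
            integral_congr_ae (.of_forall fun z => by simp only [smul_eq_mul]; ring)
        _ = (∫ z, η z * potential X h G f χ (0, z)) -
            ∫ y, (h y * areaDensity X y * χ y) * (η y * kernelMass X y) := by
          rw [integral_sub i1 i2]
          congr 1 <;> exact integral_congr_ae (.of_forall fun z => by simp only; ring)
        _ = 0 := by rw [e, sub_self]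
  filter_upwards [hae] with z hz hzb
  have h1 := hz hzb
  have h2 : χ z = 1 := hχ.eq_one z (Metric.ball_subset_ball (by have := hg.r_pos; linarith) hzb)
  have h3 := (mul_pos (hg.regular z (hg.ball_subset hzb)).areaDensity_pos
      (hg.kernelMass_pos (hg.ball_subset hzb))).ne'
  rw [eq_div_iff h3]
  rw [h2] at h1
  linarith

end

/-! ### Change of parametrization -/

section

variable {X X' : E2 → E3} {y : E2} {τ : E2 → E2}

lemma fderiv_of_eventuallyEq_comp (hX' : DifferentiableAt ℝ X' (τ y))
    (hτ : DifferentiableAt ℝ τ y) (h : X =ᶠ[𝓝 y] X' ∘ τ) :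
    fderiv ℝ X y = (fderiv ℝ X' (τ y)).comp (fderiv ℝ τ y) := by
  rw [h.fderiv_eq, fderiv_comp y hX' hτ]

/-- The gradient does not depend on the parametrization. -/
lemma chartGrad_of_eventuallyEq_comp (hX : 0 < (firstForm X y).det)
    (hX' : 0 < (firstForm X' (τ y)).det) (hd : DifferentiableAt ℝ X' (τ y))
    (hτ : DifferentiableAt ℝ τ y) (h : X =ᶠ[𝓝 y] X' ∘ τ) {f f' : E2 → ℝ}
    (hf' : DifferentiableAt ℝ f' (τ y)) (hf : f =ᶠ[𝓝 y] f' ∘ τ) :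
    chartGrad X f y = chartGrad X' f' (τ y) := by
  have hfd := fderiv_of_eventuallyEq_comp hd hτ h
  have hinj : Function.Injective (fderiv ℝ τ y : E2 →ₗ[ℝ] E2) := by
    have := injective_of_det_firstForm_pos hX
    rw [hfd] at this
    exact Function.Injective.of_comp (f := fderiv ℝ X' (τ y)) this
  have hsurj := LinearMap.injective_iff_surjective.mp hinj
  refine eq_chartGrad hX' ?_ fun v => ?_
  · obtain ⟨v, hv⟩ := chartGrad_mem_range X f y
    refine ⟨fderiv ℝ τ y v, ?_⟩
    rw [← hv, hfd]; rfl
  · obtain ⟨u, rfl⟩ := hsurj v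
    have h1 := inner_chartGrad_fderiv hX f u
    rw [hfd, hf.fderiv_eq, fderiv_comp y hf' hτ] at h1
    exact h1

lemma areaDensity_of_eventuallyEq_comp (hd : DifferentiableAt ℝ X' (τ y))
    (hτ : DifferentiableAt ℝ τ y) (h : X =ᶠ[𝓝 y] X' ∘ τ) :
    areaDensity X y = |(fderiv ℝ τ y).det| * areaDensity X' (τ y) := by
  have hdet : (fderiv ℝ τ y).det = partialDeriv 0 τ y 0 * partialDeriv 1 τ y 1 -
      partialDeriv 1 τ y 0 * partialDeriv 0 τ y 1 := by
    rw [ContinuousLinearMap.det, ← LinearMap.det_toMatrix (EuclideanSpace.basisFun (Fin 2) ℝ).toBasis,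
      Matrix.det_fin_two]
    simp [LinearMap.toMatrix_apply, partialDeriv]
  have hp : ∀ i, partialDeriv i X y = partialDeriv i τ y 0 • partialDeriv 0 X' (τ y) +
      partialDeriv i τ y 1 • partialDeriv 1 X' (τ y) := by
    intro i
    rw [partialDeriv, fderiv_of_eventuallyEq_comp hd hτ h, ContinuousLinearMap.comp_apply,
      fderiv_apply_eq_sum]; rfl
  have hn : chartNormal X y = (fderiv ℝ τ y).det • chartNormal X' (τ y) := by
    rw [chartNormal, hp 0, hp 1, hdet, chartNormal]
    ext k
    fin_cases k <;> simp [cross] <;> ring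
  rw [areaDensity, areaDensity, det_firstForm, det_firstForm, hn, real_inner_self_eq_norm_sq,
    real_inner_self_eq_norm_sq, norm_smul, mul_pow, Real.sqrt_mul (by positivity),
    Real.sqrt_sq (norm_nonneg _), Real.norm_eq_abs]

end

/-! ### Immersed surfaces and their charts -/

lemma eventuallyEq_comp_transition {M : Type*} [TopologicalSpace M]
    {e e' : OpenPartialHomeomorph M E2} {V : Type*} (f : M → V) {y : E2} (hy : y ∈ e.target)
    (hy' : e.symm y ∈ e'.source) : f ∘ e.symm =ᶠ[𝓝 y] (f ∘ e'.symm) ∘ (e' ∘ e.symm) := by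
  have h : e.symm ⁻¹' e'.source ∈ 𝓝 y :=
    (e.continuousAt_symm hy).preimage_mem_nhds (e'.open_source.mem_nhds hy')
  filter_upwards [h] with z hz
  simp only [Function.comp, e'.left_inv hz]

section

variable {M : Type*} [TopologicalSpace M] [ChartedSpace E2 M]

/-- A smooth immersion of a surface. -/
structure IsSmoothImmersion (F : M → E3) : Prop where
  smooth : ContMDiff (𝓡 2) 𝓘(ℝ, E3) ∞ F
  immersion : ∀ p, Function.Injective (mfderiv (𝓡 2) 𝓘(ℝ, E3) F p)

variable {F : M → E3} {e e' : OpenPartialHomeomorph M E2}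

lemma contDiffAt_comp_symm {V : Type*} [NormedAddCommGroup V] [NormedSpace ℝ V] {f : M → V}
    (hf : ContMDiff (𝓡 2) 𝓘(ℝ, V) ∞ f) (he : e ∈ IsManifold.maximalAtlas (𝓡 2) ∞ M) {y : E2}
    (hy : y ∈ e.target) : ContDiffAt ℝ ∞ (f ∘ e.symm) y :=
  (hf.contMDiffAt.comp y (contMDiffAt_symm_of_mem_maximalAtlas he hy)).contDiffAt

lemma IsSmoothImmersion.isRegularAt (hF : IsSmoothImmersion F)
    (he : e ∈ IsManifold.maximalAtlas (𝓡 2) ∞ M) {y : E2} (hy : y ∈ e.target) :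
    IsRegularAt (F ∘ e.symm) y := by
  refine ⟨?_, det_firstForm_pos ?_⟩
  · filter_upwards [e.open_target.mem_nhds hy] with z hz
    exact contDiffAt_comp_symm hF.smooth he hz
  have h1 : MDifferentiableAt (𝓡 2) (𝓡 2) e.symm y :=
    (contMDiffAt_symm_of_mem_maximalAtlas he hy).mdifferentiableAt (by simp)
  have h2 : MDifferentiableAt (𝓡 2) (𝓡 2) e (e.symm y) :=
    (contMDiffAt_of_mem_maximalAtlas he (e.map_target hy)).mdifferentiableAt (by simp)
  have h3 : MDifferentiableAt (𝓡 2) 𝓘(ℝ, E3) F (e.symm y) :=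
    hF.smooth.contMDiffAt.mdifferentiableAt (by simp)
  have h4 : Function.Injective (mfderiv (𝓡 2) (𝓡 2) e.symm y) := by
    have h5 : mfderiv (𝓡 2) (𝓡 2) (e ∘ e.symm) y =
        (mfderiv (𝓡 2) (𝓡 2) e (e.symm y)).comp (mfderiv (𝓡 2) (𝓡 2) e.symm y) :=
      mfderiv_comp y h2 h1
    have h6 : e ∘ e.symm =ᶠ[𝓝 y] id := by
      filter_upwards [e.open_target.mem_nhds hy] with z hz
      exact e.right_inv hz
    rw [h6.mfderiv_eq, mfderiv_id] at h5
    intro u v huv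
    have h7 := congrArg (fun L => L u) h5
    have h8 := congrArg (fun L => L v) h5
    simp only [ContinuousLinearMap.comp_apply, huv] at h7 h8
    exact h7.trans h8.symm
  have h9 : mfderiv (𝓡 2) 𝓘(ℝ, E3) (F ∘ e.symm) y =
      (mfderiv (𝓡 2) 𝓘(ℝ, E3) F (e.symm y)).comp (mfderiv (𝓡 2) (𝓡 2) e.symm y) :=
    mfderiv_comp y h3 h1
  rw [← mfderiv_eq_fderiv]
  have h10 : Function.Injective ((mfderiv (𝓡 2) 𝓘(ℝ, E3) F (e.symm y)).comp
      (mfderiv (𝓡 2) (𝓡 2) e.symm y)) := (hF.immersion _).comp h4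
  rw [← h9] at h10
  exact h10

/-- The transition map between two charts. -/
lemma contDiffAt_transition (he : e ∈ IsManifold.maximalAtlas (𝓡 2) ∞ M)
    (he' : e' ∈ IsManifold.maximalAtlas (𝓡 2) ∞ M) {y : E2} (hy : y ∈ e.target)
    (hy' : e.symm y ∈ e'.source) : ContDiffAt ℝ ∞ (e' ∘ e.symm) y :=
  ((contMDiffAt_of_mem_maximalAtlas he' hy').comp y
    (contMDiffAt_symm_of_mem_maximalAtlas he hy)).contDiffAt

/-- The gradient, for the induced metric, of a function on an immersed surface, as a vector
of `ℝ³`. -/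
def surfaceGrad (F : M → E3) (φ : M → ℝ) (p : M) : E3 :=
  chartGrad (F ∘ (chartAt E2 p).symm) (φ ∘ (chartAt E2 p).symm) (chartAt E2 p p)

variable [IsManifold (𝓡 2) ∞ M]

lemma surfaceGrad_eq (hF : IsSmoothImmersion F) (he : e ∈ IsManifold.maximalAtlas (𝓡 2) ∞ M)
    {φ : M → ℝ} (hφ : ContMDiff (𝓡 2) 𝓘(ℝ, ℝ) ∞ φ) {y : E2} (hy : y ∈ e.target) :
    surfaceGrad F φ (e.symm y) = chartGrad (F ∘ e.symm) (φ ∘ e.symm) y := by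
  set p := e.symm y
  have hc := IsManifold.chart_mem_maximalAtlas (I := 𝓡 2) (n := ∞) p
  have hp : p ∈ (chartAt E2 p).source := mem_chart_source E2 p
  have ht : chartAt E2 p p ∈ (chartAt E2 p).target := mem_chart_target E2 p
  refine (chartGrad_of_eventuallyEq_comp (τ := (chartAt E2 p) ∘ e.symm)
    (hF.isRegularAt he hy).det_pos (hF.isRegularAt hc ht).det_pos
    ((hF.isRegularAt hc ht).smooth.differentiableAt (by simp))
    ((contDiffAt_transition he hc hy hp).differentiableAt (by simp))
    (eventuallyEq_comp_transition F hy hp)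
    ((contDiffAt_comp_symm hφ hc ht).differentiableAt (by simp))
    (eventuallyEq_comp_transition φ hy hp)).symm

end

/-! ### The area measure -/

section

variable {M : Type*} [TopologicalSpace M] [MeasurableSpace M] [BorelSpace M]

/-- The area measure of a surface in the domain of a chart. -/
def chartMeasure (F : M → E3) (e : OpenPartialHomeomorph M E2) : Measure M :=
  ((volume.restrict e.target).withDensity
    fun y => ENNReal.ofReal (areaDensity (F ∘ e.symm) y)).map e.symm

lemma aemeasurable_symm (e : OpenPartialHomeomorph M E2) :
    AEMeasurable e.symm (volume.restrict e.target) :=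
  e.continuousOn_symm.aemeasurable e.open_target.measurableSet

lemma measurableSet_target_inter_preimage (e : OpenPartialHomeomorph M E2) {A : Set M}
    (hA : MeasurableSet A) : MeasurableSet (e.target ∩ e.symm ⁻¹' A) := by
  have h : Measurable (e.target.domRestrict e.symm) := e.continuousOn_symm.domRestrict.measurable
  have h1 := (MeasurableEmbedding.subtype_coe e.open_target.measurableSet).measurableSet_image.mpr
    (h hA)
  convert h1 using 1
  ext y
  simp [Set.domRestrict, and_comm]

lemma chartMeasure_apply (F : M → E3) (e : OpenPartialHomeomorph M E2) {A : Set M}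
    (hA : MeasurableSet A) : chartMeasure F e A =
      ∫⁻ y in e.target ∩ e.symm ⁻¹' A, ENNReal.ofReal (areaDensity (F ∘ e.symm) y) := by
  have h2 := measurableSet_target_inter_preimage e hA
  rw [chartMeasure, Measure.map_apply_of_aemeasurable
    ((aemeasurable_symm e).mono_ac (withDensity_absolutelyContinuous _ _)) hA,
    withDensity_apply', Measure.restrict_restrict', Set.inter_comm]
  exact e.open_target.measurableSet

end

lemma aemeasurable_areaDensity {M : Type*} [TopologicalSpace M] [ChartedSpace E2 M] {F : M → E3}
    {e : OpenPartialHomeomorph M E2} (hF : IsSmoothImmersion F)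
    (he : e ∈ IsManifold.maximalAtlas (𝓡 2) ∞ M) :
    AEMeasurable (areaDensity (F ∘ e.symm)) (volume.restrict e.target) :=
  ContinuousOn.aemeasurable (fun _ hy =>
    (hF.isRegularAt he hy).contDiffAt_areaDensity.continuousAt.continuousWithinAt)
    e.open_target.measurableSet

section

variable {M : Type*} [TopologicalSpace M] [ChartedSpace E2 M] [MeasurableSpace M] [BorelSpace M]
  {F : M → E3} {e e' : OpenPartialHomeomorph M E2}

/-- The measures given by two charts agree on the common domain, by the change of variables
formula. -/
lemma chartMeasure_eq (hF : IsSmoothImmersion F) (he : e ∈ IsManifold.maximalAtlas (𝓡 2) ∞ M)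
    (he' : e' ∈ IsManifold.maximalAtlas (𝓡 2) ∞ M) {A : Set M} (hA : MeasurableSet A)
    (h : A ⊆ e.source) (h' : A ⊆ e'.source) : chartMeasure F e A = chartMeasure F e' A := by
  have hm := measurableSet_target_inter_preimage e hA
  have him : e'.target ∩ e'.symm ⁻¹' A = (e' ∘ e.symm) '' (e.target ∩ e.symm ⁻¹' A) := by
    ext z
    constructor
    · rintro ⟨hz, hzA⟩
      refine ⟨e (e'.symm z), ⟨e.map_source (h hzA), ?_⟩, ?_⟩
      · rwa [Set.mem_preimage, e.left_inv (h hzA)]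
      · simp only [Function.comp, e.left_inv (h hzA), e'.right_inv hz]
    · rintro ⟨y, ⟨hy, hyA⟩, rfl⟩
      refine ⟨e'.map_source (h' hyA), ?_⟩
      simpa only [Function.comp, Set.mem_preimage, e'.left_inv (h' hyA)] using hyA
  have hd : ∀ y ∈ e.target ∩ e.symm ⁻¹' A, DifferentiableAt ℝ (e' ∘ e.symm) y := fun y hy =>
    (contDiffAt_transition he he' hy.1 (h' hy.2)).differentiableAt (by simp)
  have hinj : Set.InjOn (e' ∘ e.symm) (e.target ∩ e.symm ⁻¹' A) :=
    fun y hy z hz hyz => e.symm.injOn hy.1 hz.1 (e'.injOn (h' hy.2) (h' hz.2) hyz)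
  rw [chartMeasure_apply F e hA, chartMeasure_apply F e' hA, him,
    lintegral_image_eq_lintegral_abs_det_fderiv_mul _ hm
      (fun y hy => (hd y hy).hasFDerivAt.hasFDerivWithinAt) hinj]
  refine setLIntegral_congr_fun hm fun y hy => ?_
  have ht := e'.map_source (h' hy.2)
  rw [areaDensity_of_eventuallyEq_comp (X' := F ∘ e'.symm) (τ := e' ∘ e.symm)
    ((hF.isRegularAt he' ht).smooth.differentiableAt (by simp)) (hd y hy)
    (eventuallyEq_comp_transition F hy.1 (h' hy.2)), ENNReal.ofReal_mul (abs_nonneg _)]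

/-- The measure `μ` is the area measure of the immersed surface. -/
def IsSurfaceMeasure (F : M → E3) (μ : Measure M) : Prop :=
  ∀ e ∈ IsManifold.maximalAtlas (𝓡 2) ∞ M, μ.restrict e.source = chartMeasure F e

/-- The area measure is glued from the measures in countably many charts, each of them restricted
to the part of its domain not covered by the previous ones. -/
lemma exists_isSurfaceMeasure [SecondCountableTopology M] [IsManifold (𝓡 2) ∞ M] [Nonempty M]
    (hF : IsSmoothImmersion F) : ∃ μ : Measure M, IsSurfaceMeasure F μ := by
  obtain ⟨s, hs, hsu⟩ := TopologicalSpace.countable_cover_nhds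
    fun p : M => (chartAt E2 p).open_source.mem_nhds (mem_chart_source E2 p)
  have hne : s.Nonempty := by
    by_contra h0
    rw [Set.not_nonempty_iff_eq_empty] at h0
    simp only [h0, Set.mem_empty_iff_false, Set.iUnion_of_empty, Set.iUnion_empty] at hsu
    exact Set.empty_ne_univ hsu
  obtain ⟨x, rfl⟩ := hs.exists_eq_range hne
  set S : ℕ → Set M := fun n => (chartAt E2 (x n)).source
  have hS : ⋃ n, S n = Set.univ := by simpa [S] using hsu
  have hD : ∀ n, MeasurableSet (disjointed S n) :=
    MeasurableSet.disjointed fun n => (chartAt E2 (x n)).open_source.measurableSet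
  refine ⟨Measure.sum fun n => (chartMeasure F (chartAt E2 (x n))).restrict (disjointed S n),
    fun e he => ?_⟩
  ext A hA
  have hAe := hA.inter e.open_source.measurableSet
  rw [Measure.restrict_apply hA, Measure.sum_apply _ hAe]
  have h1 : ∀ n, (chartMeasure F (chartAt E2 (x n))).restrict (disjointed S n) (A ∩ e.source) =
      chartMeasure F e (A ∩ e.source ∩ disjointed S n) := by
    intro n
    rw [Measure.restrict_apply hAe]
    exact chartMeasure_eq hF (IsManifold.chart_mem_maximalAtlas _) he (hAe.inter (hD n))
      (fun p hp => disjointed_subset S n hp.2) fun p hp => hp.1.2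
  simp only [h1]
  rw [← measure_iUnion (fun i j hij => (disjoint_disjointed S hij).mono Set.inter_subset_right
    Set.inter_subset_right) fun n => hAe.inter (hD n), ← Set.inter_iUnion, iUnion_disjointed, hS,
    Set.inter_univ, chartMeasure_apply F e hAe, chartMeasure_apply F e hA]
  congr 2
  ext y
  simp only [Set.mem_inter_iff, Set.mem_preimage]
  exact ⟨fun h => ⟨h.1, h.2.1⟩, fun h => ⟨h.1, h.2, e.map_target h.1⟩⟩

namespace IsSurfaceMeasure

variable {μ : Measure M}

lemma setIntegral_source (hμ : IsSurfaceMeasure F μ) (hF : IsSmoothImmersion F)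
    (he : e ∈ IsManifold.maximalAtlas (𝓡 2) ∞ M) {g : M → ℝ} (hg : AEStronglyMeasurable g μ) :
    ∫ p in e.source, g p ∂μ =
      ∫ y in e.target, areaDensity (F ∘ e.symm) y * g (e.symm y) := by
  have h1 : AEStronglyMeasurable g (chartMeasure F e) := hμ e he ▸ hg.restrict
  have hm := (aemeasurable_symm e).mono_ac (withDensity_absolutelyContinuous (volume.restrict e.target)
    fun y => ENNReal.ofReal (areaDensity (F ∘ e.symm) y))
  rw [hμ e he, chartMeasure, integral_map hm h1, integral_withDensity_eq_integral_toReal_smul₀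
    (aemeasurable_areaDensity hF he).ennreal_ofReal (by simp)]
  refine setIntegral_congr_fun e.open_target.measurableSet fun y hy => ?_
  rw [ENNReal.toReal_ofReal (hF.isRegularAt he hy).areaDensity_pos.le, smul_eq_mul]

end IsSurfaceMeasure

end

section

variable {M : Type*} [TopologicalSpace M] [ChartedSpace E2 M] [MeasurableSpace M] [BorelSpace M]
  {F : M → E3} {e : OpenPartialHomeomorph M E2} {μ : Measure M}

namespace IsSurfaceMeasure

lemma measure_eq (hμ : IsSurfaceMeasure F μ) (he : e ∈ IsManifold.maximalAtlas (𝓡 2) ∞ M)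
    {A : Set M} (hA : MeasurableSet A) (h : A ⊆ e.source) : μ A =
      ∫⁻ y in e.target ∩ e.symm ⁻¹' A, ENNReal.ofReal (areaDensity (F ∘ e.symm) y) := by
  rw [← chartMeasure_apply F e hA, ← hμ e he, Measure.restrict_apply hA,
    Set.inter_eq_self_of_subset_left h]

lemma isLocallyFiniteMeasure [IsManifold (𝓡 2) ∞ M] (hμ : IsSurfaceMeasure F μ)
    (hF : IsSmoothImmersion F) : IsLocallyFiniteMeasure μ := by
  refine ⟨fun p => ?_⟩
  set e := chartAt E2 p
  have he : e ∈ IsManifold.maximalAtlas (𝓡 2) ∞ M := IsManifold.chart_mem_maximalAtlas p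
  have hp := mem_chart_source E2 p
  obtain ⟨r, hr, hrt⟩ := Metric.nhds_basis_closedBall.mem_iff.mp
    (e.open_target.mem_nhds (mem_chart_target E2 p))
  have hU : IsOpen (e.source ∩ e ⁻¹' Metric.ball (e p) r) :=
    e.isOpen_inter_preimage Metric.isOpen_ball
  refine ⟨_, hU.mem_nhds ⟨hp, Metric.mem_ball_self hr⟩, ?_⟩
  rw [hμ.measure_eq he hU.measurableSet Set.inter_subset_left]
  have hc : ContinuousOn (areaDensity (F ∘ e.symm)) (Metric.closedBall (e p) r) := fun y hy =>
    (hF.isRegularAt he (hrt hy)).contDiffAt_areaDensity.continuousAt.continuousWithinAt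
  obtain ⟨B, hB⟩ := (isCompact_closedBall (e p) r).exists_bound_of_continuousOn hc
  have hsub : e.target ∩ e.symm ⁻¹' (e.source ∩ e ⁻¹' Metric.ball (e p) r) ⊆
      Metric.closedBall (e p) r := by
    rintro y ⟨hy, -, hy2⟩
    rw [Set.mem_preimage, e.right_inv hy] at hy2
    exact Metric.ball_subset_closedBall hy2
  calc _ ≤ ∫⁻ y in Metric.closedBall (e p) r, ENNReal.ofReal (areaDensity (F ∘ e.symm) y) :=
        lintegral_mono_set hsub
    _ ≤ ∫⁻ _ in Metric.closedBall (e p) r, ENNReal.ofReal B := by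
        refine setLIntegral_mono' Metric.isClosed_closedBall.measurableSet fun y hy => ?_
        exact ENNReal.ofReal_le_ofReal ((le_abs_self _).trans (hB y hy))
    _ < ⊤ := by
        rw [setLIntegral_const]
        exact ENNReal.mul_lt_top ENNReal.ofReal_lt_top (isCompact_closedBall _ _).measure_lt_top

lemma isOpenPosMeasure [IsManifold (𝓡 2) ∞ M] (hμ : IsSurfaceMeasure F μ)
    (hF : IsSmoothImmersion F) : μ.IsOpenPosMeasure := by
  refine ⟨fun U hU hne => ?_⟩
  obtain ⟨p, hpU⟩ := hne
  set e := chartAt E2 p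
  have he : e ∈ IsManifold.maximalAtlas (𝓡 2) ∞ M := IsManifold.chart_mem_maximalAtlas p
  have hp := mem_chart_source E2 p
  have hV := hU.inter e.open_source
  intro h0
  have h1 : μ (U ∩ e.source) = 0 := measure_mono_null Set.inter_subset_left h0
  have hO : IsOpen (e.target ∩ e.symm ⁻¹' (U ∩ e.source)) := e.isOpen_inter_preimage_symm hV
  rw [hμ.measure_eq he hV.measurableSet Set.inter_subset_right,
    setLIntegral_eq_zero_iff' hO.measurableSet] at h1
  · have hmem : e p ∈ e.target ∩ e.symm ⁻¹' (U ∩ e.source) := by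
      refine ⟨mem_chart_target E2 p, ?_⟩
      rw [Set.mem_preimage, e.left_inv hp]
      exact ⟨hpU, hp⟩
    have h2 : volume (e.target ∩ e.symm ⁻¹' (U ∩ e.source)) = 0 := by
      refine measure_mono_null (fun y hy => ?_) (ae_iff.mp h1)
      simp only [Set.mem_ofPred_eq, not_forall]
      refine ⟨hy, ?_⟩
      simpa using (hF.isRegularAt he hy.1).areaDensity_pos
    exact (hO.measure_pos volume ⟨_, hmem⟩).ne' h2
  · exact ((aemeasurable_areaDensity hF he).mono_measure
      (Measure.restrict_mono Set.inter_subset_left le_rfl)).ennreal_ofReal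

end IsSurfaceMeasure

end

/-! ### Test functions on a surface -/

section

variable {M : Type*} [TopologicalSpace M] {e : OpenPartialHomeomorph M E2}

/-- The extension by zero of a function given in a chart. -/
def chartExtend (e : OpenPartialHomeomorph M E2) (ψ : E2 → ℝ) : M → ℝ :=
  e.source.indicator (ψ ∘ e)

lemma chartExtend_symm (e : OpenPartialHomeomorph M E2) (ψ : E2 → ℝ) {y : E2} (hy : y ∈ e.target) :
    chartExtend e ψ (e.symm y) = ψ y := by
  rw [chartExtend, Set.indicator_of_mem (e.map_target hy), Function.comp, e.right_inv hy]

lemma tsupport_chartExtend [T2Space M] {ψ : E2 → ℝ} (hψ : IsTestFunction e.target ψ) :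
    IsCompact (e.symm '' tsupport ψ) ∧ e.symm '' tsupport ψ ⊆ e.source ∧
      tsupport (chartExtend e ψ) ⊆ e.symm '' tsupport ψ := by
  have hK : IsCompact (e.symm '' tsupport ψ) :=
    hψ.2.1.isCompact.image_of_continuousOn (e.continuousOn_symm.mono hψ.2.2)
  refine ⟨hK, ?_, closure_minimal ?_ hK.isClosed⟩
  · rintro _ ⟨y, hy, rfl⟩
    exact e.map_target (hψ.2.2 hy)
  · intro p hp
    by_cases hps : p ∈ e.source
    · refine ⟨e p, subset_tsupport _ ?_, e.left_inv hps⟩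
      rw [Function.mem_support, chartExtend, Set.indicator_of_mem hps] at hp
      exact hp
    · exact absurd (Set.indicator_of_notMem hps _) hp

end

section

variable {M : Type*} [TopologicalSpace M] [ChartedSpace E2 M]
  {F : M → E3} {e : OpenPartialHomeomorph M E2}

/-- The smooth, compactly supported functions on a surface. -/
structure IsSurfaceTest (φ : M → ℝ) : Prop where
  smooth : ContMDiff (𝓡 2) 𝓘(ℝ, ℝ) ∞ φ
  compact : HasCompactSupport φ

lemma IsTestFunction.chartExtend [T2Space M] (he : e ∈ IsManifold.maximalAtlas (𝓡 2) ∞ M)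
    {ψ : E2 → ℝ} (hψ : IsTestFunction e.target ψ) : IsSurfaceTest (chartExtend e ψ) := by
  obtain ⟨hK, hKs, hs⟩ := tsupport_chartExtend hψ
  refine ⟨fun p => ?_, hK.of_isClosed_subset (isClosed_tsupport _) hs⟩
  by_cases hp : p ∈ e.source
  · have h1 : ContMDiffAt (𝓡 2) 𝓘(ℝ, ℝ) ∞ (ψ ∘ e) p :=
      hψ.1.contMDiff.contMDiffAt.comp p (contMDiffAt_of_mem_maximalAtlas he hp)
    refine h1.congr_of_eventuallyEq ?_
    filter_upwards [e.open_source.mem_nhds hp] with q hq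
    exact Set.indicator_of_mem hq _
  · refine (contMDiffAt_const (c := (0 : ℝ))).congr_of_eventuallyEq ?_
    filter_upwards [hK.isClosed.isOpen_compl.mem_nhds fun h => hp (hKs h)] with q hq
    exact image_eq_zero_of_notMem_tsupport fun h => hq (hs h)

/-- A test function with support in the domain of a chart, seen in the chart. -/
lemma IsSurfaceTest.exists_eq_chartExtend (he : e ∈ IsManifold.maximalAtlas (𝓡 2) ∞ M) {φ : M → ℝ}
    (hφ : IsSurfaceTest φ) (hs : tsupport φ ⊆ e.source) :
    ∃ ψ, IsTestFunction e.target ψ ∧ φ = Translator.chartExtend e ψ ∧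
      ∀ y ∈ e.target, ψ y = φ (e.symm y) := by
  classical
  have hK : IsCompact (e '' tsupport φ) :=
    hφ.compact.isCompact.image_of_continuousOn (e.continuousOn.mono hs)
  have hsub : e '' tsupport φ ⊆ e.target := by
    rintro _ ⟨p, hp, rfl⟩
    exact e.map_source (hs hp)
  set ψ : E2 → ℝ := e.target.indicator (φ ∘ e.symm) with hψd
  have h0 : Function.support ψ ⊆ e '' tsupport φ := by
    intro y hy
    by_cases hyt : y ∈ e.target
    · rw [Function.mem_support, hψd, Set.indicator_of_mem hyt] at hy
      exact ⟨e.symm y, subset_tsupport _ hy, e.right_inv hyt⟩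
    · exact absurd (Set.indicator_of_notMem hyt _) hy
  have h1 : tsupport ψ ⊆ e '' tsupport φ := closure_minimal h0 hK.isClosed
  refine ⟨ψ, ⟨?_, hK.of_isClosed_subset (isClosed_tsupport _) h1, h1.trans hsub⟩, ?_, ?_⟩
  · rw [contDiff_iff_contDiffAt]
    intro y
    by_cases hy : y ∈ e.target
    · refine (contDiffAt_comp_symm hφ.smooth he hy).congr_of_eventuallyEq ?_
      filter_upwards [e.open_target.mem_nhds hy] with z hz
      exact Set.indicator_of_mem hz _
    · refine (contDiffAt_const (c := (0 : ℝ))).congr_of_eventuallyEq ?_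
      filter_upwards [hK.isClosed.isOpen_compl.mem_nhds fun h => hy (hsub h)] with z hz
      exact image_eq_zero_of_notMem_tsupport fun h => hz (h1 h)
  · ext p
    by_cases hp : p ∈ e.source
    · rw [Translator.chartExtend, Set.indicator_of_mem hp, Function.comp, hψd,
        Set.indicator_of_mem (e.map_source hp), Function.comp, e.left_inv hp]
    · rw [Translator.chartExtend, Set.indicator_of_notMem hp]
      exact image_eq_zero_of_notMem_tsupport fun h => hp (hs h)
  · intro y hy
    exact Set.indicator_of_mem hy _

end

/-! ### Calculus of gradients on a surface -/

section

variable {M : Type*} [TopologicalSpace M] [ChartedSpace E2 M]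
  {F : M → E3} {φ φ₁ φ₂ : M → ℝ}

lemma surfaceGrad_of_fderiv {p : M} {a b : ℝ}
    (h : fderiv ℝ (φ ∘ (chartAt E2 p).symm) (chartAt E2 p p) =
      a • fderiv ℝ (φ₁ ∘ (chartAt E2 p).symm) (chartAt E2 p p) +
      b • fderiv ℝ (φ₂ ∘ (chartAt E2 p).symm) (chartAt E2 p p)) :
    surfaceGrad F φ p = a • surfaceGrad F φ₁ p + b • surfaceGrad F φ₂ p := by
  simp only [surfaceGrad, chartGrad, partialDeriv, h, Fin.sum_univ_two]
  simp only [add_apply, smul_apply, smul_eq_mul]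
  module

lemma surfaceGrad_eq_zero {p : M} (h : φ =ᶠ[𝓝 p] 0) : surfaceGrad F φ p = 0 := by
  have hp : p ∈ (chartAt E2 p).source := mem_chart_source E2 p
  have hc : Filter.Tendsto (chartAt E2 p).symm (𝓝 (chartAt E2 p p)) (𝓝 p) := by
    have := (chartAt E2 p).continuousAt_symm (mem_chart_target E2 p)
    rwa [ContinuousAt, (chartAt E2 p).left_inv hp] at this
  have h1 : φ ∘ (chartAt E2 p).symm =ᶠ[𝓝 (chartAt E2 p p)] fun _ => 0 := hc.eventually h
  simp [surfaceGrad, chartGrad, partialDeriv, h1.fderiv_eq]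

lemma IsSurfaceTest.hasCompactSupport_surfaceGrad (h : IsSurfaceTest φ) :
    HasCompactSupport (surfaceGrad F φ) := by
  refine h.compact.mono' fun p hp => ?_
  by_contra h0
  exact hp (surfaceGrad_eq_zero (notMem_tsupport_iff_eventuallyEq.mp h0))

variable [IsManifold (𝓡 2) ∞ M]

lemma differentiableAt_comp_chartAt_symm (h : ContMDiff (𝓡 2) 𝓘(ℝ, ℝ) ∞ φ) (p : M) :
    DifferentiableAt ℝ (φ ∘ (chartAt E2 p).symm) (chartAt E2 p p) :=
  (contDiffAt_comp_symm h (IsManifold.chart_mem_maximalAtlas p)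
    (mem_chart_target E2 p)).differentiableAt (by simp)

lemma surfaceGrad_add (h₁ : ContMDiff (𝓡 2) 𝓘(ℝ, ℝ) ∞ φ₁) (h₂ : ContMDiff (𝓡 2) 𝓘(ℝ, ℝ) ∞ φ₂)
    (p : M) : surfaceGrad F (φ₁ + φ₂) p = surfaceGrad F φ₁ p + surfaceGrad F φ₂ p := by
  have := surfaceGrad_of_fderiv (F := F) (φ := φ₁ + φ₂) (φ₁ := φ₁) (φ₂ := φ₂) (p := p)
    (a := 1) (b := 1) (by
      rw [one_smul, one_smul]
      exact fderiv_add (differentiableAt_comp_chartAt_symm h₁ p)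
        (differentiableAt_comp_chartAt_symm h₂ p))
  simpa using this

lemma surfaceGrad_mul (h₁ : ContMDiff (𝓡 2) 𝓘(ℝ, ℝ) ∞ φ₁) (h₂ : ContMDiff (𝓡 2) 𝓘(ℝ, ℝ) ∞ φ₂)
    (p : M) : surfaceGrad F (φ₁ * φ₂) p =
      φ₂ p • surfaceGrad F φ₁ p + φ₁ p • surfaceGrad F φ₂ p := by
  refine surfaceGrad_of_fderiv ?_
  have h := fderiv_mul (differentiableAt_comp_chartAt_symm h₁ p)
    (differentiableAt_comp_chartAt_symm h₂ p)
  simp only [Function.comp_apply, (chartAt E2 p).left_inv (mem_chart_source E2 p)] at h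
  rw [add_comm]
  exact h

lemma surfaceGrad_comp (h : ContMDiff (𝓡 2) 𝓘(ℝ, ℝ) ∞ φ) {g : ℝ → ℝ} {g' : ℝ} {p : M}
    (hg : HasDerivAt g g' (φ p)) :
    surfaceGrad F (fun q => g (φ q)) p = g' • surfaceGrad F φ p := by
  have h1 := surfaceGrad_of_fderiv (F := F) (φ := fun q => g (φ q)) (φ₁ := φ) (φ₂ := φ) (p := p)
    (a := g') (b := 0) (by
      have h2 : HasDerivAt g g' ((φ ∘ (chartAt E2 p).symm) (chartAt E2 p p)) := by
        simpa only [Function.comp_apply, (chartAt E2 p).left_inv (mem_chart_source E2 p)] using hg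
      rw [zero_smul, add_zero]
      exact (h2.comp_hasFDerivAt _ (differentiableAt_comp_chartAt_symm h p).hasFDerivAt).fderiv)
  simpa using h1

lemma surfaceGrad_smul (h : ContMDiff (𝓡 2) 𝓘(ℝ, ℝ) ∞ φ) (c : ℝ) (p : M) :
    surfaceGrad F (c • φ) p = c • surfaceGrad F φ p :=
  surfaceGrad_comp h (g := fun t => c * t) (by simpa using (hasDerivAt_id (φ p)).const_mul c)

lemma continuous_surfaceGrad (hF : IsSmoothImmersion F) (h : ContMDiff (𝓡 2) 𝓘(ℝ, ℝ) ∞ φ) :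
    Continuous (surfaceGrad F φ) := by
  rw [continuous_iff_continuousAt]
  intro p
  set e := chartAt E2 p
  have he : e ∈ IsManifold.maximalAtlas (𝓡 2) ∞ M := IsManifold.chart_mem_maximalAtlas p
  have hp : p ∈ e.source := mem_chart_source E2 p
  have h1 : ContinuousAt (chartGrad (F ∘ e.symm) (φ ∘ e.symm)) (e p) :=
    ((hF.isRegularAt he (e.map_source hp)).contDiffAt_chartGrad
      (contDiffAt_comp_symm h he (e.map_source hp))).continuousAt
  refine (ContinuousAt.comp (f := e) h1 (e.continuousAt hp)).congr ?_
  filter_upwards [e.open_source.mem_nhds hp] with q hq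
  rw [Function.comp, ← surfaceGrad_eq hF he h (e.map_source hq), e.left_inv hq]

end

/-! ### Propagation of Hardy inequalities -/

lemma sq_intervalIntegral_le {k : ℝ → ℝ} (hk : ContinuousOn k (Set.Icc 0 1)) :
    (∫ t in (0 : ℝ)..1, k t) ^ 2 ≤ ∫ t in (0 : ℝ)..1, k t ^ 2 := by
  have hk' : ContinuousOn k (Set.uIcc 0 1) := by rwa [Set.uIcc_of_le zero_le_one]
  set m := ∫ t in (0 : ℝ)..1, k t with hm
  have i1 : IntervalIntegrable k volume 0 1 := hk'.intervalIntegrable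
  have i2 : IntervalIntegrable (fun t => k t ^ 2) volume 0 1 := (hk'.pow 2).intervalIntegrable
  have h0 : 0 ≤ ∫ t in (0 : ℝ)..1, (k t - m) ^ 2 :=
    intervalIntegral.integral_nonneg zero_le_one fun t _ => sq_nonneg _
  have h1 : ∫ t in (0 : ℝ)..1, (k t - m) ^ 2 =
      (∫ t in (0 : ℝ)..1, k t ^ 2) - ∫ t in (0 : ℝ)..1, (2 * m * k t - m ^ 2) := by
    rw [← intervalIntegral.integral_sub i2 ((i1.const_mul (2 * m)).sub intervalIntegrable_const)]
    congr 1; ext t; ring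
  rw [h1, intervalIntegral.integral_sub (i1.const_mul (2 * m)) intervalIntegrable_const,
    intervalIntegral.integral_const_mul, ← hm] at h0
  simp at h0
  nlinarith

/-- The mass of `f²` on a small disc is controlled by that on a nearby disc and by the energy. -/
lemma setIntegral_closedBall_sq_le {f : E2 → ℝ} {y₀ y₁ : E2} {r s : ℝ} (hs : s ≤ r)
    (hy : dist y₁ y₀ ≤ r) (hf : ∀ y ∈ Metric.closedBall y₀ (2 * r), ContDiffAt ℝ ∞ f y) :
    ∫ y in Metric.closedBall y₀ s, f y ^ 2 ≤ 2 * (∫ y in Metric.closedBall y₁ s, f y ^ 2) +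
      2 * r ^ 2 * ∫ y in Metric.closedBall y₀ (2 * r), ‖fderiv ℝ f y‖ ^ 2 := by
  set v := y₀ - y₁ with hv
  have hvr : ‖v‖ ≤ r := by rwa [hv, ← dist_eq_norm, dist_comm]
  have hr : 0 ≤ r := (norm_nonneg _).trans hvr
  set K := Metric.closedBall y₁ s with hK
  have hKc : IsCompact K := isCompact_closedBall _ _
  have hmem : ∀ z ∈ K, ∀ t ∈ Set.Icc (0 : ℝ) 1, z + t • v ∈ Metric.closedBall y₀ (2 * r) := by
    intro z hz t ht
    rw [hK, Metric.mem_closedBall, dist_eq_norm] at hz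
    rw [Metric.mem_closedBall, dist_eq_norm]
    have e : z + t • v - y₀ = (z - y₁) - (1 - t) • v := by rw [hv]; module
    rw [e]
    refine (norm_sub_le _ _).trans ?_
    rw [norm_smul, Real.norm_of_nonneg (by linarith [ht.2])]
    nlinarith [ht.1, ht.2, norm_nonneg v]
  have hfc : ContinuousOn f (Metric.closedBall y₀ (2 * r)) := fun y hy =>
    (hf y hy).continuousAt.continuousWithinAt
  have hdc : ContinuousOn (fderiv ℝ f) (Metric.closedBall y₀ (2 * r)) := fun y hy =>
    ((hf y hy).fderiv_right (m := ∞) le_rfl).continuousAt.continuousWithinAt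
  have hHc : ContinuousOn (fun q : E2 × ℝ => ‖fderiv ℝ f (q.1 + q.2 • v)‖ ^ 2)
      (K ×ˢ Set.Icc (0 : ℝ) 1) := by
    refine (ContinuousOn.norm (hdc.comp (by fun_prop) ?_)).pow 2
    rintro ⟨z, t⟩ ⟨hz, ht⟩
    exact hmem z hz t ht
  have hH : Integrable (fun q : E2 × ℝ => ‖fderiv ℝ f (q.1 + q.2 • v)‖ ^ 2)
      ((volume.restrict K).prod (volume.restrict (Set.Icc (0 : ℝ) 1))) := by
    rw [Measure.prod_restrict]
    exact hHc.integrableOn_compact (hKc.prod isCompact_Icc)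
  -- translate the disc
  have e1 : ∫ y in Metric.closedBall y₀ s, f y ^ 2 = ∫ z in K, f (z + v) ^ 2 := by
    have h := (measurePreserving_add_right (volume : Measure E2) v).setIntegral_preimage_emb
      (measurableEmbedding_addRight v) (fun y => f y ^ 2) (Metric.closedBall y₀ s)
    rw [← h]
    congr 2
    ext z
    simp only [Set.mem_preimage, Metric.mem_closedBall, dist_eq_norm, hK]
    rw [show z + v - y₀ = z - y₁ by rw [hv]; module]
  have hpt : ∀ z ∈ K, f (z + v) ^ 2 ≤ 2 * f z ^ 2 +
      2 * r ^ 2 * ∫ t in Set.Icc (0 : ℝ) 1, ‖fderiv ℝ f (z + t • v)‖ ^ 2 := by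
    intro z hz
    have hd : ∀ t ∈ Set.uIcc (0 : ℝ) 1, HasDerivAt (fun t : ℝ => f (z + t • v))
        (fderiv ℝ f (z + t • v) v) t := by
      intro t ht
      rw [Set.uIcc_of_le zero_le_one] at ht
      have h3 : HasDerivAt (fun t : ℝ => z + t • v) v t := by
        simpa using ((hasDerivAt_id t).smul_const v).const_add z
      exact ((hf _ (hmem z hz t ht)).differentiableAt (by simp)).hasFDerivAt.comp_hasDerivAt t h3
    have hcz : ContinuousOn (fun t : ℝ => fderiv ℝ f (z + t • v)) (Set.Icc 0 1) :=
      hdc.comp (by fun_prop) fun t ht => hmem z hz t ht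
    have hcz' : ContinuousOn (fun t : ℝ => fderiv ℝ f (z + t • v) v) (Set.Icc 0 1) :=
      hcz.clm_apply continuousOn_const
    have h1 := intervalIntegral.integral_eq_sub_of_hasDerivAt hd
      (by rw [← Set.uIcc_of_le (zero_le_one' ℝ)] at hcz'; exact hcz'.intervalIntegrable)
    simp only [one_smul, zero_smul, add_zero] at h1
    have h2 := sq_intervalIntegral_le hcz'
    have h3 : ∫ t in (0 : ℝ)..1, (fderiv ℝ f (z + t • v) v) ^ 2 ≤
        r ^ 2 * ∫ t in Set.Icc (0 : ℝ) 1, ‖fderiv ℝ f (z + t • v)‖ ^ 2 := by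
      rw [intervalIntegral.integral_of_le zero_le_one, ← integral_Icc_eq_integral_Ioc,
        ← integral_const_mul]
      refine setIntegral_mono_on ((hcz'.pow 2).integrableOn_compact isCompact_Icc)
        (((hcz.norm.pow 2).integrableOn_compact isCompact_Icc).const_mul _) measurableSet_Icc
        fun t _ => ?_
      have h4 := (fderiv ℝ f (z + t • v)).le_opNorm v
      rw [← sq_abs, ← Real.norm_eq_abs, ← mul_pow]
      refine pow_le_pow_left₀ (norm_nonneg _) (h4.trans ?_) 2
      rw [mul_comm]
      exact mul_le_mul_of_nonneg_right hvr (norm_nonneg _)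
    rw [h1] at h2
    nlinarith [sq_nonneg (f (z + v) - 2 * f z)]
  have hin : ∀ t ∈ Set.Icc (0 : ℝ) 1, ∫ z in K, ‖fderiv ℝ f (z + t • v)‖ ^ 2 ≤
      ∫ y in Metric.closedBall y₀ (2 * r), ‖fderiv ℝ f y‖ ^ 2 := by
    intro t ht
    have h := (measurePreserving_add_right (volume : Measure E2) (t • v)).setIntegral_preimage_emb
      (measurableEmbedding_addRight (t • v)) (fun y => ‖fderiv ℝ f y‖ ^ 2)
      ((fun z => z + t • v) '' K)
    rw [Set.preimage_image_eq _ (add_left_injective _)] at h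
    rw [h]
    refine setIntegral_mono_set ((hdc.norm.pow 2).integrableOn_compact (isCompact_closedBall _ _))
      (.of_forall fun _ => sq_nonneg _) (LE.le.eventuallyLE ?_)
    rintro _ ⟨z, hz, rfl⟩
    exact hmem z hz t ht
  have i3 : IntegrableOn (fun z => ∫ t in Set.Icc (0 : ℝ) 1, ‖fderiv ℝ f (z + t • v)‖ ^ 2) K :=
    hH.integral_prod_left
  have i1 : IntegrableOn (fun z => f (z + v) ^ 2) K := by
    refine ContinuousOn.integrableOn_compact hKc ((hfc.comp (by fun_prop) fun z hz => ?_).pow 2)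
    simpa using hmem z hz 1 ⟨zero_le_one, le_rfl⟩
  have i2 : IntegrableOn (fun z => f z ^ 2) K := by
    refine ContinuousOn.integrableOn_compact hKc ((hfc.mono fun z hz => ?_).pow 2)
    simpa using hmem z hz 0 ⟨le_rfl, zero_le_one⟩
  have i4 : IntegrableOn (fun z => 2 * f z ^ 2 +
      2 * r ^ 2 * ∫ t in Set.Icc (0 : ℝ) 1, ‖fderiv ℝ f (z + t • v)‖ ^ 2) K :=
    (i2.const_mul 2).add (i3.const_mul (2 * r ^ 2))
  rw [e1]
  calc ∫ z in K, f (z + v) ^ 2 ≤ ∫ z in K, (2 * f z ^ 2 +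
        2 * r ^ 2 * ∫ t in Set.Icc (0 : ℝ) 1, ‖fderiv ℝ f (z + t • v)‖ ^ 2) :=
        setIntegral_mono_on i1 i4 hKc.measurableSet hpt
    _ = 2 * (∫ z in K, f z ^ 2) + 2 * r ^ 2 *
          ∫ z in K, ∫ t in Set.Icc (0 : ℝ) 1, ‖fderiv ℝ f (z + t • v)‖ ^ 2 := by
        rw [integral_add (i2.const_mul 2) (i3.const_mul (2 * r ^ 2)), integral_const_mul,
          integral_const_mul]
    _ ≤ _ := by
        gcongr
        rw [integral_integral_swap hH]
        calc _ ≤ ∫ _ in Set.Icc (0 : ℝ) 1,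
              ∫ y in Metric.closedBall y₀ (2 * r), ‖fderiv ℝ f y‖ ^ 2 :=
              setIntegral_mono_on hH.integral_prod_right (by simp) measurableSet_Icc hin
          _ = _ := by simp

section

variable {M : Type*} [TopologicalSpace M] [ChartedSpace E2 M] [MeasurableSpace M]

/-- A set on which the mass of test functions is controlled by their energy, with a constant
that does not depend on the function. -/
def IsHardySet (F : M → E3) (μ : Measure M) (U : Set M) : Prop :=
  ∃ C, ∀ φ, IsSurfaceTest φ →
    ∫ p in U, φ p ^ 2 ∂μ ≤ C * ∫ p, ‖surfaceGrad F φ p‖ ^ 2 ∂μ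

variable {F : M → E3} {μ : Measure M}

lemma IsSurfaceTest.integrable_sq [BorelSpace M] [IsFiniteMeasureOnCompacts μ] {φ : M → ℝ}
    (h : IsSurfaceTest φ) : Integrable (fun p => φ p ^ 2) μ := by
  refine Continuous.integrable_of_hasCompactSupport (h.smooth.continuous.pow 2)
    (h.compact.mono fun p hp => ?_)
  rw [Function.mem_support] at hp ⊢
  exact fun h0 => hp (by rw [h0]; simp)

lemma IsSurfaceTest.integrable_norm_sq [BorelSpace M] [IsFiniteMeasureOnCompacts μ]
    [IsManifold (𝓡 2) ∞ M] (hF : IsSmoothImmersion F) {φ : M → ℝ}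
    (h : IsSurfaceTest φ) : Integrable (fun p => ‖surfaceGrad F φ p‖ ^ 2) μ := by
  refine Continuous.integrable_of_hasCompactSupport
    ((continuous_surfaceGrad hF h.smooth).norm.pow 2)
    ((h.hasCompactSupport_surfaceGrad (F := F)).mono fun p hp => ?_)
  rw [Function.mem_support] at hp ⊢
  exact fun h0 => hp (by rw [h0]; simp)

lemma IsHardySet.mono [BorelSpace M] [IsFiniteMeasureOnCompacts μ] {U V : Set M}
    (h : IsHardySet F μ U) (hVU : V ⊆ U) : IsHardySet F μ V := by
  obtain ⟨C, hC⟩ := h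
  refine ⟨C, fun φ hφ => (setIntegral_mono_set hφ.integrable_sq.integrableOn
    (.of_forall fun _ => sq_nonneg _) (LE.le.eventuallyLE hVU)).trans (hC φ hφ)⟩

lemma IsHardySet.union [BorelSpace M] [IsFiniteMeasureOnCompacts μ] {U V : Set M}
    (hU : IsHardySet F μ U) (hV : IsHardySet F μ V) : IsHardySet F μ (U ∪ V) := by
  obtain ⟨C, hC⟩ := hU
  obtain ⟨D, hD⟩ := hV
  refine ⟨C + D, fun φ hφ => ?_⟩
  rw [add_mul]
  refine le_trans ?_ (add_le_add (hC φ hφ) (hD φ hφ))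
  have h := integral_mono_measure (Measure.restrict_union_le (μ := μ) U V)
    (.of_forall fun p => sq_nonneg (φ p))
    (Integrable.add_measure hφ.integrable_sq.restrict hφ.integrable_sq.restrict)
  rwa [integral_add_measure hφ.integrable_sq.restrict hφ.integrable_sq.restrict] at h

end

section

variable {M : Type*} [TopologicalSpace M] [ChartedSpace E2 M] [MeasurableSpace M] [BorelSpace M]
  {F : M → E3} {e : OpenPartialHomeomorph M E2} {μ : Measure M}

lemma measurableSet_source_inter_preimage {M : Type*} [TopologicalSpace M] [MeasurableSpace M]
    [BorelSpace M] (e : OpenPartialHomeomorph M E2) {B : Set E2}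
    (hB : MeasurableSet B) : MeasurableSet (e.source ∩ e ⁻¹' B) := by
  have h : Measurable (e.source.domRestrict e) := e.continuousOn.domRestrict.measurable
  have h1 := (MeasurableEmbedding.subtype_coe e.open_source.measurableSet).measurableSet_image.mpr
    (h hB)
  convert h1 using 1
  ext y
  simp [Set.domRestrict, and_comm]

lemma IsSurfaceMeasure.setIntegral_preimage (hμ : IsSurfaceMeasure F μ) (hF : IsSmoothImmersion F)
    (he : e ∈ IsManifold.maximalAtlas (𝓡 2) ∞ M) {g : M → ℝ} (hg : AEStronglyMeasurable g μ)
    {B : Set E2} (hB : MeasurableSet B) (hBe : B ⊆ e.target) :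
    ∫ p in e.source ∩ e ⁻¹' B, g p ∂μ =
      ∫ y in B, areaDensity (F ∘ e.symm) y * g (e.symm y) := by
  have hm := measurableSet_source_inter_preimage e hB
  have h1 := hμ.setIntegral_source hF he (hg.indicator hm)
  rw [setIntegral_indicator hm, ← Set.inter_assoc, Set.inter_self] at h1
  rw [h1, setIntegral_eq_of_subset_of_forall_sdiff_eq_zero e.open_target.measurableSet hBe]
  · refine setIntegral_congr_fun hB fun y hy => ?_
    have : e.symm y ∈ e.source ∩ e ⁻¹' B := by
      refine ⟨e.map_target (hBe hy), ?_⟩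
      rwa [Set.mem_preimage, e.right_inv (hBe hy)]
    simp only [Set.indicator_of_mem this]
  · rintro y ⟨hy, hyB⟩
    have : e.symm y ∉ e.source ∩ e ⁻¹' B := fun h => hyB (by
      have := h.2
      rwa [Set.mem_preimage, e.right_inv hy] at this)
    simp only [Set.indicator_of_notMem this, mul_zero]

lemma abs_fderiv_le {X : E2 → E3} {y : E2} (h : 0 < (firstForm X y).det) (f : E2 → ℝ) :
    ‖fderiv ℝ f y‖ ≤ ‖chartGrad X f y‖ * ‖fderiv ℝ X y‖ := by
  refine ContinuousLinearMap.opNorm_le_bound _ (by positivity) fun v => ?_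
  rw [← inner_chartGrad_fderiv h, mul_assoc]
  exact (norm_inner_le_norm _ _).trans
    (mul_le_mul_of_nonneg_left (ContinuousLinearMap.le_opNorm _ _) (norm_nonneg _))

variable [IsManifold (𝓡 2) ∞ M]

/-- The points near which the mass of test functions is controlled by their energy form a
closed set: a disc around a nearby such point can be translated in a chart. -/
lemma exists_isHardySet_of_mem_closure [IsFiniteMeasureOnCompacts μ] (hμ : IsSurfaceMeasure F μ)
    (hF : IsSmoothImmersion F) {p : M} (hp : p ∈ closure {p | ∃ V ∈ 𝓝 p, IsHardySet F μ V}) :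
    ∃ V ∈ 𝓝 p, IsHardySet F μ V := by
  set e := chartAt E2 p
  have he : e ∈ IsManifold.maximalAtlas (𝓡 2) ∞ M := IsManifold.chart_mem_maximalAtlas p
  have hps : p ∈ e.source := mem_chart_source E2 p
  set y₀ := e p
  obtain ⟨R, hR, hRt⟩ := Metric.nhds_basis_closedBall.mem_iff.mp
    (e.open_target.mem_nhds (mem_chart_target E2 p))
  set r := R / 2 with hr
  have hr0 : 0 < r := by positivity
  set X := F ∘ e.symm
  set K := Metric.closedBall y₀ (2 * r) with hK
  have hKt : K ⊆ e.target := by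
    rw [hK, show 2 * r = R by rw [hr]; ring]; exact hRt
  have hKc : IsCompact K := isCompact_closedBall _ _
  have hreg : ∀ y ∈ K, IsRegularAt X y := fun y hy => hF.isRegularAt he (hKt hy)
  have hAc : ContinuousOn (areaDensity X) K := fun y hy =>
    (hreg y hy).contDiffAt_areaDensity.continuousAt.continuousWithinAt
  have hXc : ContinuousOn (fderiv ℝ X) K := fun y hy =>
    ((hreg y hy).smooth.fderiv_right (m := ∞) le_rfl).continuousAt.continuousWithinAt
  have hKne : K.Nonempty := ⟨y₀, Metric.mem_closedBall_self (by positivity)⟩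
  obtain ⟨z₁, hz₁, hmin⟩ := hKc.exists_isMinOn hKne hAc
  set a₁ := areaDensity X z₁
  have ha₁ : 0 < a₁ := (hreg z₁ hz₁).areaDensity_pos
  obtain ⟨a₂, ha₂⟩ := hKc.exists_bound_of_continuousOn hAc
  obtain ⟨L, hL⟩ := hKc.exists_bound_of_continuousOn hXc
  have ha₂0 : 0 ≤ a₂ := (norm_nonneg _).trans (ha₂ z₁ hz₁)
  have hN : e.source ∩ e ⁻¹' Metric.ball y₀ r ∈ 𝓝 p :=
    (e.isOpen_inter_preimage Metric.isOpen_ball).mem_nhds ⟨hps, Metric.mem_ball_self hr0⟩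
  obtain ⟨q, ⟨hqs, hqb⟩, V, hV, C, hC⟩ := mem_closure_iff_nhds.mp hp _ hN
  set y₁ := e q
  have hqt : y₁ ∈ e.target := e.map_source hqs
  have hV1 : e.symm ⁻¹' V ∈ 𝓝 y₁ := by
    refine (e.continuousAt_symm hqt).preimage_mem_nhds ?_
    rwa [e.left_inv hqs]
  obtain ⟨s', hs', hs'V⟩ := Metric.nhds_basis_closedBall.mem_iff.mp hV1
  set s := min s' r with hs
  have hs0 : 0 < s := lt_min hs' hr0
  have hsr : s ≤ r := min_le_right _ _
  have hy₁ : dist y₁ y₀ ≤ r := (Metric.mem_ball.mp hqb).le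
  have hB1K : Metric.closedBall y₁ s ⊆ K :=
    Metric.closedBall_subset_closedBall' (by linarith)
  have hB0K : Metric.closedBall y₀ s ⊆ K := Metric.closedBall_subset_closedBall (by linarith)
  refine ⟨e.source ∩ e ⁻¹' Metric.closedBall y₀ s, ?_,
    a₂ * (2 * (a₁⁻¹ * C) + 2 * r ^ 2 * (L ^ 2 * a₁⁻¹)), fun φ hφ => ?_⟩
  · refine Filter.mem_of_superset ((e.isOpen_inter_preimage (Metric.isOpen_ball
      (x := y₀) (ε := s))).mem_nhds ⟨hps, Metric.mem_ball_self hs0⟩) ?_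
    exact Set.inter_subset_inter_right _ (Set.preimage_mono Metric.ball_subset_closedBall)
  set f := φ ∘ e.symm with hfd
  set E := ∫ p, ‖surfaceGrad F φ p‖ ^ 2 ∂μ with hE
  have hfs : ∀ y ∈ K, ContDiffAt ℝ ∞ f y := fun y hy => contDiffAt_comp_symm hφ.smooth he (hKt hy)
  have hfc : ContinuousOn f K := fun y hy => (hfs y hy).continuousAt.continuousWithinAt
  have hf2 : ContinuousOn (fun y => f y ^ 2) K := hfc.pow 2
  have haf2 : ContinuousOn (fun y => areaDensity X y * f y ^ 2) K := hAc.mul hf2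
  have hgc : ContinuousOn (chartGrad X f) K := fun y hy =>
    ((hreg y hy).contDiffAt_chartGrad (hfs y hy)).continuousAt.continuousWithinAt
  have hdc : ContinuousOn (fderiv ℝ f) K := fun y hy =>
    ((hfs y hy).fderiv_right (m := ∞) le_rfl).continuousAt.continuousWithinAt
  have hφm := hφ.integrable_sq (μ := μ)
  have hgm := hφ.integrable_norm_sq (μ := μ) hF
  have h1 : ∫ p in e.source ∩ e ⁻¹' Metric.closedBall y₀ s, φ p ^ 2 ∂μ ≤
      a₂ * ∫ y in Metric.closedBall y₀ s, f y ^ 2 := by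
    rw [hμ.setIntegral_preimage hF he hφm.aestronglyMeasurable Metric.isClosed_closedBall.measurableSet
      (hB0K.trans hKt), ← integral_const_mul]
    refine setIntegral_mono_on ((haf2.mono hB0K).integrableOn_compact (isCompact_closedBall _ _))
      (((hf2.mono hB0K).integrableOn_compact (isCompact_closedBall _ _)).const_mul _)
      Metric.isClosed_closedBall.measurableSet fun y hy => ?_
    exact mul_le_mul_of_nonneg_right ((le_abs_self _).trans (ha₂ y (hB0K hy))) (sq_nonneg _)
  have h2 : ∫ y in Metric.closedBall y₁ s, f y ^ 2 ≤ a₁⁻¹ * (C * E) := by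
    rw [le_inv_mul_iff₀ ha₁, ← integral_const_mul]
    refine le_trans (setIntegral_mono_on
      (((hf2.mono hB1K).integrableOn_compact (isCompact_closedBall _ _)).const_mul _)
      ((haf2.mono hB1K).integrableOn_compact (isCompact_closedBall _ _))
      Metric.isClosed_closedBall.measurableSet fun y hy =>
        mul_le_mul_of_nonneg_right (hmin (hB1K hy)) (sq_nonneg _)) ?_
    refine le_trans (le_of_eq_of_le (hμ.setIntegral_preimage hF he hφm.aestronglyMeasurable
      Metric.isClosed_closedBall.measurableSet (hB1K.trans hKt)).symm ?_) (hC φ hφ)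
    refine setIntegral_mono_set hφm.integrableOn (.of_forall fun _ => sq_nonneg _)
      (LE.le.eventuallyLE fun x hx => ?_)
    have h := hs'V (Metric.closedBall_subset_closedBall (min_le_left _ _) hx.2)
    rwa [Set.mem_preimage, e.left_inv hx.1] at h
  have h3 : ∫ y in K, ‖fderiv ℝ f y‖ ^ 2 ≤ L ^ 2 * a₁⁻¹ * E := by
    have hpt : ∀ y ∈ K, ‖fderiv ℝ f y‖ ^ 2 ≤
        L ^ 2 * a₁⁻¹ * (areaDensity X y * ‖surfaceGrad F φ (e.symm y)‖ ^ 2) := by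
      intro y hy
      rw [surfaceGrad_eq hF he hφ.smooth (hKt hy)]
      have h4 := abs_fderiv_le (hreg y hy).det_pos f
      have h5 := hL y hy
      have h6 : 1 ≤ a₁⁻¹ * areaDensity X y := by
        rw [← inv_mul_cancel₀ ha₁.ne']
        exact mul_le_mul_of_nonneg_left (hmin hy) (inv_pos.mpr ha₁).le
      calc ‖fderiv ℝ f y‖ ^ 2 ≤ (‖chartGrad X f y‖ * L) ^ 2 := by
            refine pow_le_pow_left₀ (norm_nonneg _) (h4.trans ?_) 2
            exact mul_le_mul_of_nonneg_left h5 (norm_nonneg _)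
        _ ≤ (‖chartGrad X f y‖ * L) ^ 2 * (a₁⁻¹ * areaDensity X y) :=
            le_mul_of_one_le_right (sq_nonneg _) h6
        _ = _ := by ring
    have hc : ContinuousOn (fun y => areaDensity X y * ‖surfaceGrad F φ (e.symm y)‖ ^ 2) K :=
      hAc.mul ((hgc.norm.pow 2).congr fun y hy => by
        simp only [surfaceGrad_eq hF he hφ.smooth (hKt hy)]; rfl)
    refine (setIntegral_mono_on ((hdc.norm.pow 2).integrableOn_compact hKc)
      ((hc.integrableOn_compact hKc).const_mul _) hKc.measurableSet hpt).trans ?_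
    rw [integral_const_mul, ← hμ.setIntegral_preimage hF he hgm.aestronglyMeasurable
      hKc.measurableSet hKt]
    refine mul_le_mul_of_nonneg_left ?_ (by positivity)
    exact setIntegral_le_integral hgm (.of_forall fun _ => sq_nonneg _)
  have h4 := setIntegral_closedBall_sq_le hsr hy₁ hfs
  calc _ ≤ _ := h1
    _ ≤ a₂ * (2 * (a₁⁻¹ * (C * E)) + 2 * r ^ 2 * (L ^ 2 * a₁⁻¹ * E)) := by
      gcongr
      exact h4.trans (by gcongr)
    _ = _ := by ring

/-- On a connected surface, the control of the mass by the energy spreads from one nonempty open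
set to all compact sets. -/
theorem isHardySet_of_isCompact [ConnectedSpace M] [IsFiniteMeasureOnCompacts μ]
    (hμ : IsSurfaceMeasure F μ) (hF : IsSmoothImmersion F) {U : Set M} (hU : IsOpen U)
    (hne : U.Nonempty) (hHU : IsHardySet F μ U) {K : Set M} (hK : IsCompact K) :
    IsHardySet F μ K := by
  have hopen : IsOpen {p | ∃ V ∈ 𝓝 p, IsHardySet F μ V} := by
    rw [isOpen_iff_mem_nhds]
    rintro p ⟨V, hV, hHV⟩
    filter_upwards [eventually_mem_nhds_iff.mpr hV] with q hq
    exact ⟨V, hq, hHV⟩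
  have hclosed : IsClosed {p | ∃ V ∈ 𝓝 p, IsHardySet F μ V} :=
    isClosed_of_closure_subset fun p hp => exists_isHardySet_of_mem_closure hμ hF hp
  obtain ⟨p, hp⟩ := hne
  have huniv := IsClopen.eq_univ ⟨hclosed, hopen⟩ ⟨p, U, hU.mem_nhds hp, hHU⟩
  refine hK.induction_on (p := IsHardySet F μ) ⟨0, fun φ _ => by simp⟩
    (fun s t hst ht => ht.mono hst) (fun s t hs ht => hs.union ht) fun q _ => ?_
  obtain ⟨V, hV, hHV⟩ : q ∈ {p | ∃ V ∈ 𝓝 p, IsHardySet F μ V} := huniv ▸ Set.mem_univ q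
  exact ⟨V, mem_nhdsWithin_of_mem_nhds hV, hHV⟩

end

/-! ### The variational solution -/

/-- A form of the Riesz representation theorem: a functional bounded by a seminorm `‖T v‖` is
represented by an element of the closure of the range of `T`. -/
lemma exists_inner_eq {V H : Type*} [AddCommGroup V] [Module ℝ V] [NormedAddCommGroup H]
    [InnerProductSpace ℝ H] [CompleteSpace H] (T : V →ₗ[ℝ] H) (l : V →ₗ[ℝ] ℝ) (C : ℝ)
    (h : ∀ v, |l v| ≤ C * ‖T v‖) :
    ∃ Z ∈ closure (Set.range T), ∀ v, inner ℝ Z (T v) = l v := by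
  have hker : LinearMap.ker T ≤ LinearMap.ker l := by
    intro v hv
    rw [LinearMap.mem_ker] at hv ⊢
    have := h v
    rw [hv, norm_zero, mul_zero] at this
    exact abs_nonpos_iff.mp this
  set W := LinearMap.range T
  let l' : W →ₗ[ℝ] ℝ := ((LinearMap.ker T).liftQ l hker).comp T.quotKerEquivRange.symm.toLinearMap
  have hl' : ∀ v, l' ⟨T v, v, rfl⟩ = l v := by
    intro v
    have : T.quotKerEquivRange.symm ⟨T v, v, rfl⟩ = Submodule.Quotient.mk v := by
      rw [LinearEquiv.symm_apply_eq]; rfl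
    simp [l', this]
  obtain ⟨g, hg, -⟩ := exists_extension_norm_eq (𝕜 := ℝ) W (l'.mkContinuous C (by
    rintro ⟨_, v, rfl⟩
    rw [hl']
    exact h v))
  set Z₀ := (InnerProductSpace.toDual ℝ H).symm g with hZ₀
  have : CompleteSpace W.topologicalClosure :=
    (Submodule.isClosed_topologicalClosure W).completeSpace_coe
  refine ⟨W.topologicalClosure.starProjection Z₀, ?_, fun v => ?_⟩
  · have h1 : W.topologicalClosure.starProjection Z₀ ∈ W.topologicalClosure :=
      Submodule.starProjection_apply_mem _ _
    have h2 : (W.topologicalClosure : Set H) = closure (Set.range T) := by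
      rw [Submodule.topologicalClosure_coe]; rfl
    rw [← h2]; exact h1
  · have hv : T v ∈ W.topologicalClosure := W.le_topologicalClosure ⟨v, rfl⟩
    rw [Submodule.inner_starProjection_left_eq_right,
      Submodule.starProjection_eq_self_iff.mpr hv, hZ₀, InnerProductSpace.toDual_symm_apply,
      ← hl' v]
    exact hg ⟨T v, v, rfl⟩

lemma inner_toLp {α H : Type*} [MeasurableSpace α] {μ : Measure α} [NormedAddCommGroup H]
    [InnerProductSpace ℝ H] {f : α → H} (hf : MemLp f 2 μ) (Z : Lp H 2 μ) :
    inner ℝ Z (hf.toLp f) = ∫ p, inner ℝ (Z p) (f p) ∂μ := by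
  rw [L2.inner_def]
  refine integral_congr_ae ?_
  filter_upwards [hf.coeFn_toLp] with p hp
  rw [hp]

lemma inner_toLp_toLp {α H : Type*} [MeasurableSpace α] {μ : Measure α} [NormedAddCommGroup H]
    [InnerProductSpace ℝ H] {f g : α → H} (hf : MemLp f 2 μ) (hg : MemLp g 2 μ) :
    inner ℝ (hf.toLp f) (hg.toLp g) = ∫ p, inner ℝ (f p) (g p) ∂μ := by
  rw [inner_toLp]
  refine integral_congr_ae ?_
  filter_upwards [hf.coeFn_toLp] with p hp
  rw [hp]

lemma norm_sq_toLp {α H : Type*} [MeasurableSpace α] {μ : Measure α} [NormedAddCommGroup H]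
    [InnerProductSpace ℝ H] {f : α → H} (hf : MemLp f 2 μ) :
    ‖hf.toLp f‖ ^ 2 = ∫ p, ‖f p‖ ^ 2 ∂μ := by
  rw [← real_inner_self_eq_norm_sq, inner_toLp_toLp]
  simp only [real_inner_self_eq_norm_sq]

section

variable {M : Type*} [TopologicalSpace M] [ChartedSpace E2 M]

lemma IsSurfaceTest.add {φ ψ : M → ℝ} (hφ : IsSurfaceTest φ) (hψ : IsSurfaceTest ψ) :
    IsSurfaceTest (φ + ψ) := ⟨hφ.smooth.add hψ.smooth, hφ.compact.add hψ.compact⟩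

lemma IsSurfaceTest.comp {φ : M → ℝ} (hφ : IsSurfaceTest φ) {g : ℝ → ℝ} (hg : ContDiff ℝ ∞ g)
    (h0 : g 0 = 0) : IsSurfaceTest fun p => g (φ p) :=
  ⟨hg.contMDiff.comp hφ.smooth, hφ.compact.comp_left (g := g) h0⟩

lemma IsSurfaceTest.smul {φ : M → ℝ} (hφ : IsSurfaceTest φ) (c : ℝ) : IsSurfaceTest (c • φ) :=
  hφ.comp (g := fun t => c * t) (contDiff_const.mul contDiff_id) (mul_zero c)

variable (M) in
/-- The space of test functions on a surface. -/
def testSpace : Submodule ℝ (M → ℝ) where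
  carrier := {φ | IsSurfaceTest φ}
  add_mem' h₁ h₂ := IsSurfaceTest.add h₁ h₂
  zero_mem' := ⟨contMDiff_const, HasCompactSupport.zero⟩
  smul_mem' c _ h := IsSurfaceTest.smul h c

variable [MeasurableSpace M] [BorelSpace M] {F : M → E3} {μ : Measure M}
  [IsFiniteMeasureOnCompacts μ]

lemma IsSurfaceTest.memLp {φ : M → ℝ} (hφ : IsSurfaceTest φ) : MemLp φ 2 μ :=
  Continuous.memLp_of_hasCompactSupport hφ.smooth.continuous hφ.compact

lemma IsSurfaceTest.integrable_mul {ρ φ : M → ℝ} (hρ : IsSurfaceTest ρ) (hφ : IsSurfaceTest φ) :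
    Integrable (fun p => ρ p * φ p) μ :=
  (hρ.memLp (μ := μ)).integrable_mul hφ.memLp

variable [IsManifold (𝓡 2) ∞ M]

lemma IsSurfaceTest.memLp_grad {φ : M → ℝ} (hφ : IsSurfaceTest φ) (hF : IsSmoothImmersion F) :
    MemLp (surfaceGrad F φ) 2 μ :=
  Continuous.memLp_of_hasCompactSupport (continuous_surfaceGrad hF hφ.smooth)
    hφ.hasCompactSupport_surfaceGrad

/-- The gradient of test functions, as a linear map to the Hilbert space of square integrable
vector fields. -/
def gradLp (μ : Measure M) [IsFiniteMeasureOnCompacts μ] (hF : IsSmoothImmersion F) :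
    testSpace M →ₗ[ℝ] Lp E3 2 μ where
  toFun φ := (IsSurfaceTest.memLp_grad φ.2 hF).toLp _
  map_add' φ ψ := by
    rw [← MemLp.toLp_add]
    refine MemLp.toLp_congr _ _ (.of_forall fun p => ?_)
    exact surfaceGrad_add φ.2.smooth ψ.2.smooth p
  map_smul' c φ := by
    rw [RingHom.id_apply, ← MemLp.toLp_const_smul]
    refine MemLp.toLp_congr _ _ (.of_forall fun p => ?_)
    exact surfaceGrad_smul φ.2.smooth c p

lemma norm_sq_gradLp (hF : IsSmoothImmersion F) (φ : testSpace M) :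
    ‖gradLp μ hF φ‖ ^ 2 = ∫ p, ‖surfaceGrad F φ p‖ ^ 2 ∂μ :=
  norm_sq_toLp (IsSurfaceTest.memLp_grad φ.2 hF)

/-- Integration against `ρ`, as a functional on test functions. -/
def massFunctional (μ : Measure M) [IsFiniteMeasureOnCompacts μ] {ρ : M → ℝ}
    (hρ : IsSurfaceTest ρ) : testSpace M →ₗ[ℝ] ℝ where
  toFun φ := ∫ p, ρ p * (φ : M → ℝ) p ∂μ
  map_add' φ ψ := by
    rw [← integral_add (hρ.integrable_mul φ.2) (hρ.integrable_mul ψ.2)]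
    refine integral_congr_ae (.of_forall fun p => ?_)
    simp [mul_add]
  map_smul' c φ := by
    rw [RingHom.id_apply, smul_eq_mul, ← integral_const_mul]
    refine integral_congr_ae (.of_forall fun p => ?_)
    simp only [Submodule.coe_smul, Pi.smul_apply, smul_eq_mul]; ring

lemma abs_massFunctional_le (hF : IsSmoothImmersion F) {ρ : M → ℝ} (hρ : IsSurfaceTest ρ)
    (hH : IsHardySet F μ (tsupport ρ)) :
    ∃ C, ∀ φ, |massFunctional μ hρ φ| ≤ C * ‖gradLp μ hF φ‖ := by
  obtain ⟨C, hC⟩ := hH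
  set K := tsupport ρ
  refine ⟨‖(hρ.memLp (μ := μ.restrict K)).toLp ρ‖ * √C, fun φ => ?_⟩
  have hφ : IsSurfaceTest (φ : M → ℝ) := φ.2
  have h1 : massFunctional μ hρ φ = inner ℝ ((hρ.memLp (μ := μ.restrict K)).toLp ρ)
      ((hφ.memLp (μ := μ.restrict K)).toLp φ) := by
    rw [inner_toLp_toLp]
    have : ∀ p ∉ K, inner ℝ (ρ p) ((φ : M → ℝ) p) = 0 := fun p hp => by
      rw [image_eq_zero_of_notMem_tsupport hp, inner_zero_left]
    rw [setIntegral_eq_integral_of_forall_compl_eq_zero this]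
    exact integral_congr_ae (.of_forall fun p => by simp [mul_comm])
  rw [h1, mul_assoc]
  refine (abs_real_inner_le_norm _ _).trans (mul_le_mul_of_nonneg_left ?_ (norm_nonneg _))
  have h2 := norm_sq_toLp (hφ.memLp (μ := μ.restrict K))
  have h3 := hC φ hφ
  simp only [Real.norm_eq_abs, sq_abs] at h2
  rw [← h2, ← norm_sq_gradLp hF φ] at h3
  rw [← Real.sqrt_sq (norm_nonneg (gradLp μ hF φ)), ← Real.sqrt_mul' _ (sq_nonneg _)]
  exact Real.le_sqrt_of_sq_le h3

/-- The smooth approximation `√(t² + δ²) - δ` of `|t|`. -/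
def softAbs (δ t : ℝ) : ℝ := √(t ^ 2 + δ ^ 2) - δ

lemma hasDerivAt_softAbs {δ : ℝ} (hδ : 0 < δ) (t : ℝ) :
    HasDerivAt (softAbs δ) (t / √(t ^ 2 + δ ^ 2)) t := by
  have h1 : HasDerivAt (fun t : ℝ => t ^ 2 + δ ^ 2) (2 * t) t := by
    simpa using (hasDerivAt_pow 2 t).add_const (δ ^ 2)
  have h2 := (h1.sqrt (by positivity)).sub_const δ
  rw [mul_div_mul_left _ _ two_ne_zero] at h2
  exact h2

lemma contDiff_softAbs {δ : ℝ} (hδ : 0 < δ) : ContDiff ℝ ∞ (softAbs δ) :=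
  (((contDiff_id.pow 2).add contDiff_const).sqrt fun t => by positivity).sub contDiff_const

lemma softAbs_nonneg {δ : ℝ} (t : ℝ) : 0 ≤ softAbs δ t := by
  have := Real.le_sqrt_of_sq_le (show δ ^ 2 ≤ t ^ 2 + δ ^ 2 by nlinarith [sq_nonneg t])
  rw [softAbs]; linarith

lemma le_softAbs {δ : ℝ} (t : ℝ) : t - δ ≤ softAbs δ t := by
  have := Real.le_sqrt_of_sq_le (show t ^ 2 ≤ t ^ 2 + δ ^ 2 by nlinarith [sq_nonneg δ])
  rw [softAbs]; linarith

lemma abs_deriv_softAbs_le {δ : ℝ} (hδ : 0 < δ) (t : ℝ) : |t / √(t ^ 2 + δ ^ 2)| ≤ 1 := by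
  rw [abs_div, abs_of_pos (show 0 < √(t ^ 2 + δ ^ 2) by positivity), div_le_one (by positivity)]
  exact Real.abs_le_sqrt (by nlinarith [sq_nonneg δ])

/-- The energy space contains a vector field `Z` which weakly solves `-div Z = ρ`, and `Z` is a
limit of gradients of nonnegative test functions. -/
theorem exists_variational_solution (hF : IsSmoothImmersion F) {ρ : M → ℝ} (hρ : IsSurfaceTest ρ)
    (hρ0 : ∀ p, 0 ≤ ρ p) (hH : IsHardySet F μ (tsupport ρ)) :
    ∃ Z : Lp E3 2 μ, (∀ ψ : testSpace M, inner ℝ Z (gradLp μ hF ψ) = ∫ p, ρ p * (ψ : M → ℝ) p ∂μ) ∧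
      ∃ φ : ℕ → testSpace M, (∀ n p, 0 ≤ (φ n : M → ℝ) p) ∧
        Filter.Tendsto (fun n => gradLp μ hF (φ n)) Filter.atTop (𝓝 Z) := by
  obtain ⟨C, hC⟩ := abs_massFunctional_le hF hρ hH
  obtain ⟨Z, hZ, hZl⟩ := exists_inner_eq (gradLp μ hF) (massFunctional μ hρ) C hC
  refine ⟨Z, hZl, ?_⟩
  set m := ∫ p, ρ p ∂μ with hm
  have hm0 : 0 ≤ m := integral_nonneg hρ0
  have hρi : Integrable ρ μ := hρ.smooth.continuous.integrable_of_hasCompactSupport hρ.compact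
  have key : ∀ ε > 0, ∃ ψ : testSpace M, (∀ p, 0 ≤ (ψ : M → ℝ) p) ∧ ‖gradLp μ hF ψ - Z‖ < ε := by
    intro ε hε
    obtain ⟨_, ⟨φ, rfl⟩, hφZ⟩ := Metric.mem_closure_iff.mp hZ (ε / 2) (by positivity)
    rw [dist_comm, dist_eq_norm] at hφZ
    have hφ : IsSurfaceTest (φ : M → ℝ) := φ.2
    -- The element `Z` minimizes half the energy minus the pairing with `ρ`. Replacing `φ` by
    -- `softAbs δ φ` does not increase the energy and lowers the pairing by at most `δ m`.
    set δ := ε ^ 2 / (4 * (m + 1)) with hδd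
    have hδ : 0 < δ := by positivity
    have hψ : IsSurfaceTest fun p => softAbs δ ((φ : M → ℝ) p) :=
      hφ.comp (contDiff_softAbs hδ) (by simp [softAbs, Real.sqrt_sq hδ.le])
    set ψ : testSpace M := ⟨_, hψ⟩ with hψd
    refine ⟨ψ, fun p => softAbs_nonneg _, ?_⟩
    have h1 : ‖gradLp μ hF ψ‖ ^ 2 ≤ ‖gradLp μ hF φ‖ ^ 2 := by
      rw [norm_sq_gradLp, norm_sq_gradLp]
      refine integral_mono (hψ.integrable_norm_sq hF) (hφ.integrable_norm_sq hF) fun p => ?_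
      refine pow_le_pow_left₀ (norm_nonneg _) ?_ 2
      rw [hψd]
      dsimp only
      rw [surfaceGrad_comp hφ.smooth (hasDerivAt_softAbs hδ _), norm_smul]
      exact mul_le_of_le_one_left (norm_nonneg _) (abs_deriv_softAbs_le hδ _)
    have h2 : massFunctional μ hρ φ - δ * m ≤ massFunctional μ hρ ψ := by
      have i1 : Integrable (fun p => ρ p * (φ : M → ℝ) p) μ := hρ.integrable_mul hφ
      have i2 : Integrable (fun p => ρ p * (ψ : M → ℝ) p) μ := hρ.integrable_mul hψ
      change (∫ p, ρ p * (φ : M → ℝ) p ∂μ) - δ * m ≤ ∫ p, ρ p * (ψ : M → ℝ) p ∂μ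
      rw [hm, ← integral_const_mul, ← integral_sub i1 (hρi.const_mul δ)]
      refine integral_mono (i1.sub (hρi.const_mul δ)) i2 fun p => ?_
      have := mul_le_mul_of_nonneg_left (le_softAbs (δ := δ) ((φ : M → ℝ) p)) (hρ0 p)
      dsimp only [hψd]
      linarith
    have h3 := norm_sub_sq_real (gradLp μ hF ψ) Z
    have h4 := norm_sub_sq_real (gradLp μ hF φ) Z
    rw [real_inner_comm, hZl] at h3 h4
    have h5 : δ * m ≤ ε ^ 2 / 4 := by
      rw [hδd, div_mul_eq_mul_div, div_le_div_iff₀ (by positivity) (by norm_num)]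
      nlinarith [sq_nonneg ε]
    refine lt_of_pow_lt_pow_left₀ 2 hε.le ?_
    nlinarith [norm_nonneg (gradLp μ hF φ - Z)]
  choose ψ hψ0 hψZ using fun n : ℕ => key (1 / (n + 1)) Nat.one_div_pos_of_nat
  refine ⟨ψ, hψ0, tendsto_iff_norm_sub_tendsto_zero.mpr ?_⟩
  exact squeeze_zero (fun _ => norm_nonneg _) (fun n => (hψZ n).le)
    tendsto_one_div_add_atTop_nhds_zero_nat

end

/-! ### Square integrable limits of test functions -/

section

variable {M : Type*} [MeasurableSpace M] {μ : Measure M} {φ : ℕ → M → ℝ} {h h' : M → ℝ}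
  {A B : Set M}

/-- The sequence `φ` converges to `h` in `L²(A)`. -/
structure IsL2Limit (μ : Measure M) (φ : ℕ → M → ℝ) (h : M → ℝ) (A : Set M) : Prop where
  integrable : IntegrableOn (fun p => h p ^ 2) A μ
  tendsto : Filter.Tendsto (fun n => ∫ p in A, (φ n p - h p) ^ 2 ∂μ) Filter.atTop (𝓝 0)

lemma IsL2Limit.memLp (H : IsL2Limit μ φ h A) (hm : AEStronglyMeasurable h μ) :
    MemLp h 2 (μ.restrict A) :=
  (memLp_two_iff_integrable_sq hm.restrict).mpr H.integrable

lemma IsL2Limit.integrable_sub (H : IsL2Limit μ φ h A) (hm : AEStronglyMeasurable h μ)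
    (hφ : ∀ n, MemLp (φ n) 2 μ) (n : ℕ) :
    IntegrableOn (fun p => (φ n p - h p) ^ 2) A μ :=
  (((hφ n).restrict A).sub (H.memLp hm)).integrable_sq

lemma IsL2Limit.mono (H : IsL2Limit μ φ h A) (hm : AEStronglyMeasurable h μ)
    (hφ : ∀ n, MemLp (φ n) 2 μ) (hBA : B ⊆ A) : IsL2Limit μ φ h B :=
  ⟨H.integrable.mono_set hBA, squeeze_zero (fun _ => integral_nonneg fun _ => sq_nonneg _)
    (fun n => setIntegral_mono_set (H.integrable_sub hm hφ n) (.of_forall fun _ => sq_nonneg _)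
      (LE.le.eventuallyLE hBA)) H.tendsto⟩

lemma IsL2Limit.congr (H : IsL2Limit μ φ h A) (hh : h =ᵐ[μ.restrict A] h') :
    IsL2Limit μ φ h' A := by
  refine ⟨H.integrable.congr ?_, H.tendsto.congr fun n => integral_congr_ae ?_⟩
  · filter_upwards [hh] with p hp
    rw [hp]
  · filter_upwards [hh] with p hp
    rw [hp]

lemma IsL2Limit.union (HA : IsL2Limit μ φ h A) (HB : IsL2Limit μ φ h B)
    (hm : AEStronglyMeasurable h μ) (hφ : ∀ n, MemLp (φ n) 2 μ) : IsL2Limit μ φ h (A ∪ B) := by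
  refine ⟨HA.integrable.union HB.integrable, ?_⟩
  have h0 := HA.tendsto.add HB.tendsto
  rw [add_zero] at h0
  refine squeeze_zero (fun _ => integral_nonneg fun _ => sq_nonneg _) (fun n => ?_) h0
  have h1 := HA.integrable_sub hm hφ n
  have h2 := HB.integrable_sub hm hφ n
  have h3 := integral_mono_measure (Measure.restrict_union_le (μ := μ) A B)
    (.of_forall fun p => sq_nonneg (φ n p - h p)) (Integrable.add_measure h1 h2)
  rwa [integral_add_measure h1 h2] at h3

lemma IsL2Limit.ae_eq (H : IsL2Limit μ φ h A) (H' : IsL2Limit μ φ h' A)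
    (hm : AEStronglyMeasurable h μ) (hm' : AEStronglyMeasurable h' μ)
    (hφ : ∀ n, MemLp (φ n) 2 μ) : h =ᵐ[μ.restrict A] h' := by
  have i0 : IntegrableOn (fun p => (h p - h' p) ^ 2) A μ :=
    ((H.memLp hm).sub (H'.memLp hm')).integrable_sq
  have h0 : ∫ p in A, (h p - h' p) ^ 2 ∂μ ≤ 0 := by
    have hl := (H.tendsto.const_mul 2).add (H'.tendsto.const_mul 2)
    rw [mul_zero, add_zero] at hl
    refine ge_of_tendsto' hl fun n => ?_
    have h1 := H.integrable_sub hm hφ n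
    have h2 := H'.integrable_sub hm' hφ n
    rw [← integral_const_mul, ← integral_const_mul,
      ← integral_add (h1.const_mul 2) (h2.const_mul 2)]
    refine integral_mono i0 ((h1.const_mul 2).add (h2.const_mul 2)) fun p => ?_
    dsimp only
    nlinarith [sq_nonneg ((φ n p - h p) + (φ n p - h' p))]
  have h1 := (integral_eq_zero_iff_of_nonneg (fun p => sq_nonneg (h p - h' p)) i0).mp
    (le_antisymm h0 (integral_nonneg fun _ => sq_nonneg _))
  filter_upwards [h1] with p hp
  have := pow_eq_zero_iff (two_ne_zero) |>.mp hp
  linarith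

lemma IsL2Limit.tendsto_integral_mul (H : IsL2Limit μ φ h A) (hm : AEStronglyMeasurable h μ)
    (hφ : ∀ n, MemLp (φ n) 2 μ) {θ : M → ℝ} (hθ : MemLp θ 2 μ) (h0 : ∀ p ∉ A, θ p = 0) :
    Filter.Tendsto (fun n => ∫ p, φ n p * θ p ∂μ) Filter.atTop (𝓝 (∫ p, h p * θ p ∂μ)) := by
  have e : ∀ g : M → ℝ, ∫ p, g p * θ p ∂μ = ∫ p in A, inner ℝ (g p) (θ p) ∂μ := by
    intro g
    have : ∀ p ∉ A, inner ℝ (g p) (θ p) = 0 := fun p hp => by rw [h0 p hp, inner_zero_right]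
    rw [setIntegral_eq_integral_of_forall_compl_eq_zero this]
    exact integral_congr_ae (.of_forall fun p => by simp [mul_comm])
  have hφA := fun n => (hφ n).restrict A
  have hhA := H.memLp hm
  have hθA := hθ.restrict A
  have h1 : Filter.Tendsto (fun n => (hφA n).toLp (φ n)) Filter.atTop (𝓝 (hhA.toLp h)) := by
    rw [tendsto_iff_norm_sub_tendsto_zero]
    have h2 : ∀ n, ‖(hφA n).toLp (φ n) - hhA.toLp h‖ = √(∫ p in A, (φ n p - h p) ^ 2 ∂μ) := by
      intro n
      rw [← MemLp.toLp_sub, ← Real.sqrt_sq (norm_nonneg _), norm_sq_toLp]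
      simp
    simp only [h2]
    have h4 := (Real.continuous_sqrt.tendsto 0).comp H.tendsto
    rw [Real.sqrt_zero] at h4
    exact h4
  simp only [e]
  have h3 := Filter.Tendsto.inner (𝕜 := ℝ) h1
    (tendsto_const_nhds (x := hθA.toLp θ) (f := Filter.atTop))
  simpa only [inner_toLp_toLp] using h3

end

/-! ### Transfer of integrals to charts -/

section

variable {M : Type*} [TopologicalSpace M] [ChartedSpace E2 M] [MeasurableSpace M] [BorelSpace M]
  {F : M → E3} {e : OpenPartialHomeomorph M E2} {μ : Measure M}

/-- Square integrable functions on the surface are square integrable in charts. -/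
lemma IsSurfaceMeasure.memLp_comp_symm (hμ : IsSurfaceMeasure F μ) (hF : IsSmoothImmersion F)
    (he : e ∈ IsManifold.maximalAtlas (𝓡 2) ∞ M) {V : Type*} [NormedAddCommGroup V] {g : M → V}
    {B K : Set E2} (hB : MeasurableSet B) (hg : MemLp g 2 (μ.restrict (e.source ∩ e ⁻¹' B)))
    (hK : IsCompact K) (hKe : K ⊆ e.target) (hKB : K ⊆ B) :
    MemLp (g ∘ e.symm) 2 (volume.restrict K) := by
  set A := e.source ∩ e ⁻¹' B
  have hA := measurableSet_source_inter_preimage e hB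
  have h1 : MemLp (A.indicator g) 2 (chartMeasure F e) := by
    rw [← hμ e he]
    exact ((memLp_indicator_iff_restrict hA).mpr hg).restrict _
  have hm := (aemeasurable_symm e).mono_ac (withDensity_absolutelyContinuous (volume.restrict e.target)
    fun y => ENNReal.ofReal (areaDensity (F ∘ e.symm) y))
  have h2 := (memLp_map_measure_iff h1.aestronglyMeasurable hm).mp h1
  have hAc : ContinuousOn (areaDensity (F ∘ e.symm)) K := fun y hy =>
    (hF.isRegularAt he (hKe hy)).contDiffAt_areaDensity.continuousAt.continuousWithinAt
  rcases K.eq_empty_or_nonempty with rfl | hne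
  · simp
  obtain ⟨z, hz, hmin⟩ := hK.exists_isMinOn hne hAc
  set a := areaDensity (F ∘ e.symm) z
  have ha : 0 < a := (hF.isRegularAt he (hKe hz)).areaDensity_pos
  have hle : volume.restrict K ≤ ENNReal.ofReal a⁻¹ • ((volume.restrict e.target).withDensity
      fun y => ENNReal.ofReal (areaDensity (F ∘ e.symm) y)) := by
    refine Measure.le_iff.mpr fun S hS => ?_
    rw [Measure.restrict_apply hS, Measure.smul_apply, withDensity_apply _ hS, smul_eq_mul,
      Measure.restrict_restrict hS]
    calc volume (S ∩ K) = ENNReal.ofReal a⁻¹ * ∫⁻ _ in S ∩ K, ENNReal.ofReal a := by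
          rw [setLIntegral_const, ← mul_assoc, ← ENNReal.ofReal_mul (by positivity),
            inv_mul_cancel₀ ha.ne', ENNReal.ofReal_one, one_mul]
      _ ≤ ENNReal.ofReal a⁻¹ * ∫⁻ y in S ∩ K, ENNReal.ofReal (areaDensity (F ∘ e.symm) y) := by
          gcongr 1
          exact setLIntegral_mono' (hS.inter hK.measurableSet) fun y hy =>
            ENNReal.ofReal_le_ofReal (hmin hy.2)
      _ ≤ _ := by
          gcongr 1
          exact lintegral_mono_set (Set.inter_subset_inter_right _ hKe)
  refine (h2.of_measure_le_smul (by simp) hle).ae_eq ?_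
  filter_upwards [ae_restrict_mem hK.measurableSet] with y hy
  have : e.symm y ∈ A := ⟨e.map_target (hKe hy), by
    rw [Set.mem_preimage, e.right_inv (hKe hy)]; exact hKB hy⟩
  simp only [Function.comp, Set.indicator_of_mem this]

/-- An integral in a chart, seen on the surface. -/
lemma IsSurfaceMeasure.integral_comp_symm_mul [T2Space M] (hμ : IsSurfaceMeasure F μ)
    (hF : IsSmoothImmersion F) (he : e ∈ IsManifold.maximalAtlas (𝓡 2) ∞ M) {g : M → ℝ}
    (hg : AEStronglyMeasurable g μ) {ψ : E2 → ℝ} (hψ : IsTestFunction e.target ψ) :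
    IsSurfaceTest (chartExtend e fun y => (areaDensity (F ∘ e.symm) y)⁻¹ * ψ y) ∧
    ∫ y, g (e.symm y) * ψ y =
      ∫ p, g p * chartExtend e (fun y => (areaDensity (F ∘ e.symm) y)⁻¹ * ψ y) p ∂μ := by
  have h1 : IsTestFunction e.target fun y => (areaDensity (F ∘ e.symm) y)⁻¹ * ψ y :=
    hψ.mul fun y hy => (hF.isRegularAt he hy).contDiffAt_areaDensity.inv
      (hF.isRegularAt he hy).areaDensity_pos.ne'
  have h2 := h1.chartExtend he
  refine ⟨h2, ?_⟩
  have h3 : ∀ p ∉ e.source, g p * chartExtend e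
      (fun y => (areaDensity (F ∘ e.symm) y)⁻¹ * ψ y) p = 0 := fun p hp => by
    rw [chartExtend, Set.indicator_of_notMem hp, mul_zero]
  rw [← setIntegral_eq_integral_of_forall_compl_eq_zero h3, hμ.setIntegral_source hF he
    (g := fun p => g p * chartExtend e (fun y => (areaDensity (F ∘ e.symm) y)⁻¹ * ψ y) p)
    (hg.mul h2.smooth.continuous.aestronglyMeasurable), ← hψ.setIntegral_mul]
  refine setIntegral_congr_fun e.open_target.measurableSet fun y hy => ?_
  have := (hF.isRegularAt he hy).areaDensity_pos.ne'
  simp only [chartExtend_symm e _ hy]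
  field_simp

end

/-! ### The variational solution in charts -/

lemma surfaceGrad_chartExtend {M : Type*} [TopologicalSpace M] [ChartedSpace E2 M]
    [IsManifold (𝓡 2) ∞ M] [T2Space M] {F : M → E3} {e : OpenPartialHomeomorph M E2} (hF : IsSmoothImmersion F)
    (he : e ∈ IsManifold.maximalAtlas (𝓡 2) ∞ M) {ψ : E2 → ℝ} (hψ : IsTestFunction e.target ψ)
    {y : E2} (hy : y ∈ e.target) :
    surfaceGrad F (chartExtend e ψ) (e.symm y) = chartGrad (F ∘ e.symm) ψ y := by
  rw [surfaceGrad_eq hF he (hψ.chartExtend he).smooth hy]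
  have h : chartExtend e ψ ∘ e.symm =ᶠ[𝓝 y] ψ := by
    filter_upwards [e.open_target.mem_nhds hy] with z hz
    exact chartExtend_symm e ψ hz
  simp only [chartGrad, partialDeriv, h.fderiv_eq]

section

variable {M : Type*} [TopologicalSpace M] [ChartedSpace E2 M] [MeasurableSpace M] [BorelSpace M]
  {F : M → E3} {e : OpenPartialHomeomorph M E2} {μ : Measure M}

/-- The covector field dual to the vector field `Z`, in the coordinates of a chart. -/
def chartField (F : M → E3) (e : OpenPartialHomeomorph M E2) (Z : M → E3) (y : E2) : E2 :=
  WithLp.toLp 2 fun i => inner ℝ (Z (e.symm y)) (partialDeriv i (F ∘ e.symm) y)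

lemma memLp_coord {α : Type*} [MeasurableSpace α] {ν : Measure α} {W : α → E3} (hW : MemLp W 2 ν)
    (k : Fin 3) : MemLp (fun p => W p k) 2 ν :=
  (EuclideanSpace.proj (𝕜 := ℝ) k : E3 →L[ℝ] ℝ).comp_memLp' hW

lemma inner_eq_sum_E3 (p q : E3) : inner ℝ p q = ∑ k, p k * q k := by
  rw [inner_E3, Fin.sum_univ_three]

lemma IsSurfaceMeasure.integrableOn_comp_symm (hμ : IsSurfaceMeasure F μ) (hF : IsSmoothImmersion F)
    (he : e ∈ IsManifold.maximalAtlas (𝓡 2) ∞ M) {W : M → E3} (hW : MemLp W 2 μ) (k : Fin 3)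
    {K : Set E2} (hKe : K ⊆ e.target) (hK : IsCompact K) :
    IntegrableOn (fun y => W (e.symm y) k) K := by
  have h := hμ.memLp_comp_symm hF he (B := Set.univ) MeasurableSet.univ
    ((memLp_coord hW k).restrict _) hK hKe (Set.subset_univ _)
  have : IsFiniteMeasure (volume.restrict K) := ⟨by simpa using hK.measure_lt_top⟩
  exact h.integrable one_le_two

variable [T2Space M] [IsFiniteMeasureOnCompacts μ]

/-- The pairing of a vector field with a coordinate vector field times a test function is a
continuous functional of the former. -/
lemma exists_integral_inner_partialDeriv_eq (hμ : IsSurfaceMeasure F μ) (hF : IsSmoothImmersion F)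
    (he : e ∈ IsManifold.maximalAtlas (𝓡 2) ∞ M) {ψ : E2 → ℝ} (hψ : IsTestFunction e.target ψ)
    (i : Fin 2) : ∃ Θ : Lp E3 2 μ, ∀ (W : M → E3) (hW : MemLp W 2 μ),
      ∫ y, chartField F e W y i * ψ y = inner ℝ (hW.toLp W) Θ := by
  have hb : ∀ k : Fin 3, IsTestFunction e.target
      fun y => partialDeriv i (F ∘ e.symm) y k * ψ y := fun k =>
    hψ.mul fun y hy => contDiffAt_coord
      (contDiffAt_partialDeriv (hF.isRegularAt he hy).smooth i) k
  set θ : Fin 3 → M → ℝ := fun k => chartExtend e fun y => (areaDensity (F ∘ e.symm) y)⁻¹ *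
    (partialDeriv i (F ∘ e.symm) y k * ψ y) with hθd
  have hθ : ∀ k, IsSurfaceTest (θ k) := fun k =>
    (hμ.integral_comp_symm_mul hF he aestronglyMeasurable_const (g := fun _ => (0 : ℝ)) (hb k)).1
  set Θ : M → E3 := fun p => ∑ k, θ k p • EuclideanSpace.single k (1 : ℝ) with hΘd
  have hΘ : MemLp Θ 2 μ := memLp_finsetSum _ fun k _ =>
    ((ContinuousLinearMap.id ℝ ℝ).smulRight (EuclideanSpace.single k (1 : ℝ)) :
      ℝ →L[ℝ] E3).comp_memLp' (hθ k).memLp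
  refine ⟨hΘ.toLp Θ, fun W hW => ?_⟩
  have hΘk : ∀ p k, Θ p k = θ k p := by
    intro p k
    fin_cases k <;> simp [hΘd, Fin.sum_univ_three]
  rw [inner_toLp_toLp]
  simp only [inner_eq_sum_E3, hΘk]
  have hint : ∀ k, Integrable (fun p => W p k * θ k p) μ := fun k =>
    (memLp_coord hW k).integrable_mul (hθ k).memLp
  rw [integral_finsetSum _ fun k _ => hint k]
  have h1 : ∀ y, chartField F e W y i * ψ y =
      ∑ k, W (e.symm y) k * (partialDeriv i (F ∘ e.symm) y k * ψ y) := by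
    intro y
    simp only [chartField, inner_eq_sum_E3, Finset.sum_mul, mul_assoc]
  simp only [h1]
  rw [integral_finsetSum _ fun k _ => (hb k).integrable_mul
    fun K hK hKc => hμ.integrableOn_comp_symm hF he hW k hK hKc]
  exact Finset.sum_congr rfl fun k _ => (hμ.integral_comp_symm_mul hF he
    (memLp_coord hW k).aestronglyMeasurable (hb k)).2

variable [IsManifold (𝓡 2) ∞ M]

/-- The weak equation `-div Z = ρ`, written in a chart. -/
lemma chart_equation (hμ : IsSurfaceMeasure F μ) (hF : IsSmoothImmersion F)
    (he : e ∈ IsManifold.maximalAtlas (𝓡 2) ∞ M) {Z : Lp E3 2 μ} {ρ : M → ℝ} (hρ : Continuous ρ)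
    (hZ : ∀ ψ : testSpace M, inner ℝ Z (gradLp μ hF ψ) = ∫ p, ρ p * (ψ : M → ℝ) p ∂μ)
    {ψ : E2 → ℝ} (hψ : IsTestFunction e.target ψ) :
    ∫ y, areaDensity (F ∘ e.symm) y * ∑ i, ∑ j, (firstForm (F ∘ e.symm) y)⁻¹ i j *
      (chartField F e Z y i * partialDeriv j ψ y) =
      ∫ y, areaDensity (F ∘ e.symm) y * ρ (e.symm y) * ψ y := by
  have hT := hψ.chartExtend he
  have h1 := hZ ⟨_, hT⟩
  have h2 : inner ℝ Z (gradLp μ hF ⟨_, hT⟩) =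
      ∫ p, inner ℝ (Z p) (surfaceGrad F (chartExtend e ψ) p) ∂μ :=
    inner_toLp (hT.memLp_grad hF) Z
  have hs : ∀ p ∉ e.source, p ∉ tsupport (chartExtend e ψ) := fun p hp h =>
    hp ((tsupport_chartExtend hψ).2.1 ((tsupport_chartExtend hψ).2.2 h))
  have h3 : ∀ p ∉ e.source, inner ℝ (Z p) (surfaceGrad F (chartExtend e ψ) p) = 0 := by
    intro p hp
    rw [surfaceGrad_eq_zero (notMem_tsupport_iff_eventuallyEq.mp (hs p hp)), inner_zero_right]
  have h4 : ∀ p ∉ e.source, ρ p * chartExtend e ψ p = 0 := by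
    intro p hp
    rw [image_eq_zero_of_notMem_tsupport (hs p hp), mul_zero]
  rw [h2, ← setIntegral_eq_integral_of_forall_compl_eq_zero h3, hμ.setIntegral_source hF he
    (g := fun p => inner ℝ (Z p) (surfaceGrad F (chartExtend e ψ) p))
    ((Lp.aestronglyMeasurable Z).inner (hT.memLp_grad hF).aestronglyMeasurable)] at h1
  change _ = ∫ p, ρ p * chartExtend e ψ p ∂μ at h1
  rw [← setIntegral_eq_integral_of_forall_compl_eq_zero h4, hμ.setIntegral_source hF he
    (g := fun p => ρ p * chartExtend e ψ p)
    (hρ.mul hT.smooth.continuous).aestronglyMeasurable] at h1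
  rw [← hψ.setIntegral_mul, ← setIntegral_eq_integral_of_forall_compl_eq_zero (s := e.target)]
  · refine Eq.trans (setIntegral_congr_fun e.open_target.measurableSet fun y hy => ?_) (h1.trans
      (setIntegral_congr_fun e.open_target.measurableSet fun y hy => ?_))
    · dsimp only
      rw [surfaceGrad_chartExtend hF he hψ hy, inner_chartGrad_left]
      simp only [chartField, Fin.sum_univ_two, inv_firstForm_comm (F ∘ e.symm) y 1 0]
      ring
    · rw [chartExtend_symm e ψ hy]; ring
  · intro y hy
    simp [(hψ.partialDeriv _).eq_zero hy]

/-- The weak gradient of a limit of test functions. -/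
lemma chart_weak_grad (hμ : IsSurfaceMeasure F μ) (hF : IsSmoothImmersion F)
    (he : e ∈ IsManifold.maximalAtlas (𝓡 2) ∞ M) {Z : Lp E3 2 μ} {φ : ℕ → testSpace M}
    (hφ : Filter.Tendsto (fun n => gradLp μ hF (φ n)) Filter.atTop (𝓝 Z)) {h : M → ℝ}
    {A : Set M} (hm : AEStronglyMeasurable h μ) (hh : IsL2Limit μ (fun n => (φ n : M → ℝ)) h A)
    {ψ : E2 → ℝ} (hψ : IsTestFunction e.target ψ) (hA : e.symm '' tsupport ψ ⊆ A) (i : Fin 2) :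
    ∫ y, h (e.symm y) * partialDeriv i ψ y = -∫ y, chartField F e Z y i * ψ y := by
  obtain ⟨Θ, hΘ⟩ := exists_integral_inner_partialDeriv_eq hμ hF he hψ i
  have hφt : ∀ n, IsSurfaceTest (φ n : M → ℝ) := fun n => (φ n).2
  have h1 : Filter.Tendsto (fun n => ∫ y, chartField F e (surfaceGrad F (φ n)) y i * ψ y)
      Filter.atTop (𝓝 (∫ y, chartField F e Z y i * ψ y)) := by
    rw [hΘ Z (Lp.memLp Z), Lp.toLp_coeFn]
    have h2 := Filter.Tendsto.inner (𝕜 := ℝ) hφ (tendsto_const_nhds (x := Θ) (f := Filter.atTop))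
    refine h2.congr fun n => ?_
    rw [hΘ _ ((hφt n).memLp_grad hF)]; rfl
  have hi := hψ.partialDeriv i
  obtain ⟨hT, -⟩ := hμ.integral_comp_symm_mul hF he hm hi
  have h0 : ∀ p ∉ A, chartExtend e
      (fun y => (areaDensity (F ∘ e.symm) y)⁻¹ * partialDeriv i ψ y) p = 0 := by
    intro p hp
    by_cases hps : p ∈ e.source
    · rw [chartExtend, Set.indicator_of_mem hps, Function.comp]
      rw [image_eq_zero_of_notMem_tsupport (f := partialDeriv i ψ), mul_zero]
      exact fun h => hp (hA ⟨e p, IsTestFunction.tsupport_partialDeriv_subset ψ i h, e.left_inv hps⟩)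
    · exact Set.indicator_of_notMem hps _
  have h3 := hh.tendsto_integral_mul hm (fun n => (hφt n).memLp) hT.memLp h0
  rw [← (hμ.integral_comp_symm_mul hF he hm hi).2] at h3
  refine tendsto_nhds_unique h3 (h1.neg.congr fun n => ?_)
  rw [← (hμ.integral_comp_symm_mul hF he (hφt n).smooth.continuous.aestronglyMeasurable hi).2]
  have hs : ∀ y ∈ e.target, ContDiffAt ℝ ∞ ((φ n : M → ℝ) ∘ e.symm) y := fun y hy =>
    contDiffAt_comp_symm (hφt n).smooth he hy
  refine Eq.trans ?_ (hψ.integral_mul_partialDeriv hs i).symm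
  congr 1
  rw [← hψ.setIntegral_mul, ← hψ.setIntegral_mul]
  refine setIntegral_congr_fun e.open_target.measurableSet fun y hy => ?_
  simp only [chartField]
  rw [surfaceGrad_eq hF he (hφt n).smooth hy,
    inner_chartGrad_partialDeriv (hF.isRegularAt he hy).det_pos]

end

section

variable {M : Type*} [TopologicalSpace M] [ChartedSpace E2 M] [MeasurableSpace M] [BorelSpace M]
  [IsManifold (𝓡 2) ∞ M]
  {F : M → E3} {e : OpenPartialHomeomorph M E2} {μ : Measure M} [IsFiniteMeasureOnCompacts μ]

/-- On a set where the mass is controlled by the energy, a sequence converging in energy converges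
in the square mean. -/
lemma exists_isL2Limit {hF : IsSmoothImmersion F} {Z : Lp E3 2 μ}
    {φ : ℕ → testSpace M} (hφ : Filter.Tendsto (fun n => gradLp μ hF (φ n)) Filter.atTop (𝓝 Z))
    {A : Set M} (hA : IsHardySet F μ A) :
    ∃ h : M → ℝ, StronglyMeasurable h ∧ IsL2Limit μ (fun n => (φ n : M → ℝ)) h A := by
  obtain ⟨C, hC⟩ := hA
  have hm : ∀ n, MemLp (φ n : M → ℝ) 2 (μ.restrict A) := fun n => IsSurfaceTest.memLp (φ n).2
  set f : ℕ → Lp ℝ 2 (μ.restrict A) := fun n => (hm n).toLp _ with hf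
  have hdist : ∀ m n, dist (f m) (f n) ≤ √C * dist (gradLp μ hF (φ m)) (gradLp μ hF (φ n)) := by
    intro m n
    rw [dist_eq_norm, dist_eq_norm, ← map_sub, hf]
    dsimp only
    rw [← MemLp.toLp_sub, ← Real.sqrt_sq (norm_nonneg (gradLp μ hF _)),
      ← Real.sqrt_mul' _ (sq_nonneg _)]
    refine Real.le_sqrt_of_sq_le ?_
    rw [norm_sq_toLp, norm_sq_gradLp]
    have := hC _ (φ m - φ n).2
    simpa using this
  have hcau : CauchySeq f := by
    rw [Metric.cauchySeq_iff]
    intro ε hε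
    obtain ⟨N, hN⟩ := Metric.cauchySeq_iff.mp hφ.cauchySeq (ε / (√C + 1)) (by positivity)
    refine ⟨N, fun m hm n hn => (hdist m n).trans_lt ?_⟩
    have h1 := hN m hm n hn
    rw [lt_div_iff₀ (by positivity)] at h1
    nlinarith [dist_nonneg (x := gradLp μ hF (φ m)) (y := gradLp μ hF (φ n)), Real.sqrt_nonneg C]
  obtain ⟨h, hh⟩ := cauchySeq_tendsto_of_complete hcau
  refine ⟨h, Lp.stronglyMeasurable h, (Lp.memLp h).integrable_sq, ?_⟩
  have h1 := (tendsto_iff_norm_sub_tendsto_zero.mp hh).pow 2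
  rw [zero_pow two_ne_zero] at h1
  refine h1.congr fun n => ?_
  have h2 : f n - h = ((hm n).sub (Lp.memLp h)).toLp _ := by
    rw [MemLp.toLp_sub (hm n) (Lp.memLp h), Lp.toLp_coeFn]
  rw [h2, norm_sq_toLp]
  simp

variable [T2Space M]

/-- The variational solution has continuous representatives locally. -/
lemma exists_continuous_isL2Limit (hμ : IsSurfaceMeasure F μ) (hF : IsSmoothImmersion F)
    {Z : Lp E3 2 μ} {ρ : M → ℝ} (hρ : Continuous ρ)
    (hZ : ∀ ψ : testSpace M, inner ℝ Z (gradLp μ hF ψ) = ∫ p, ρ p * (ψ : M → ℝ) p ∂μ)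
    {φ : ℕ → testSpace M} (hφ : Filter.Tendsto (fun n => gradLp μ hF (φ n)) Filter.atTop (𝓝 Z))
    (hH : ∀ K : Set M, IsCompact K → IsHardySet F μ K) (p : M) :
    ∃ U, IsOpen U ∧ p ∈ U ∧ ∃ c : M → ℝ, ContinuousOn c U ∧ Measurable c ∧
      IsL2Limit μ (fun n => (φ n : M → ℝ)) c U := by
  set e := chartAt E2 p
  have he : e ∈ IsManifold.maximalAtlas (𝓡 2) ∞ M := IsManifold.chart_mem_maximalAtlas p
  have hps : p ∈ e.source := mem_chart_source E2 p
  obtain ⟨R, hR, hRt⟩ := Metric.nhds_basis_closedBall.mem_iff.mp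
    (e.open_target.mem_nhds (mem_chart_target E2 p))
  set B := Metric.ball (e p) R
  have hBm : MeasurableSet B := Metric.isOpen_ball.measurableSet
  have hBt : B ⊆ e.target := Metric.ball_subset_closedBall.trans hRt
  set A := e.source ∩ e ⁻¹' B with hAd
  have hK : IsCompact (e.symm '' Metric.closedBall (e p) R) :=
    (isCompact_closedBall _ _).image_of_continuousOn (e.continuousOn_symm.mono hRt)
  have hAK : A ⊆ e.symm '' Metric.closedBall (e p) R := fun q hq =>
    ⟨e q, Metric.ball_subset_closedBall hq.2, e.left_inv hq.1⟩
  obtain ⟨h, hhm, hh⟩ := exists_isL2Limit hφ ((hH _ hK).mono hAK)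
  have hm : AEStronglyMeasurable h μ := hhm.aestronglyMeasurable
  have hfin : ∀ K : Set E2, IsCompact K → IsFiniteMeasure (volume.restrict K) := fun K hK =>
    ⟨by simpa using hK.measure_lt_top⟩
  have hsol : IsWeakSolution (F ∘ e.symm) B (h ∘ e.symm) (chartField F e Z)
      (fun y => areaDensity (F ∘ e.symm) y * ρ (e.symm y)) :=
    { isOpen := Metric.isOpen_ball
      regular := fun y hy => hF.isRegularAt he (hBt hy)
      integrable := fun K hKB hKc => by
        have := hfin K hKc
        exact (hμ.memLp_comp_symm hF he hBm (hh.memLp hm) hKc (hKB.trans hBt) hKB).integrable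
          one_le_two
      integrable_grad := fun i K hKB hKc => by
        have hd : ∀ k, ContinuousOn (fun y => partialDeriv i (F ∘ e.symm) y k) K := fun k y hy =>
          (contDiffAt_coord (contDiffAt_partialDeriv
            (hF.isRegularAt he (hBt (hKB hy))).smooth i) k).continuousAt.continuousWithinAt
        have h1 := fun k => (hμ.integrableOn_comp_symm hF he (Lp.memLp Z) k (hKB.trans hBt)
          hKc).mul_continuousOn (hd k) hKc
        refine ((h1 0).add (h1 1)).add (h1 2) |>.congr (.of_forall fun y => ?_)
        simp [chartField, inner_E3]
      weak_grad := fun ψ hψ i => chart_weak_grad hμ hF he hφ hm hh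
        ⟨hψ.1, hψ.2.1, hψ.2.2.trans hBt⟩ (by
          rintro _ ⟨y, hy, rfl⟩
          refine ⟨e.map_target (hBt (hψ.2.2 hy)), ?_⟩
          rw [Set.mem_preimage, e.right_inv (hBt (hψ.2.2 hy))]
          exact hψ.2.2 hy) i
      continuousOn := fun y hy =>
        ((hF.isRegularAt he (hBt hy)).contDiffAt_areaDensity.continuousAt.mul
          (hρ.continuousAt.comp (e.continuousAt_symm (hBt hy)))).continuousWithinAt
      equation := fun ψ hψ => chart_equation hμ hF he hρ hZ ⟨hψ.1, hψ.2.1, hψ.2.2.trans hBt⟩ }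
  obtain ⟨r, hr, hrB, c, hc, hae⟩ := hsol.exists_continuousOn (Metric.mem_ball_self hR)
  set U := e.source ∩ e ⁻¹' Metric.ball (e p) r
  have hU : IsOpen U := e.isOpen_inter_preimage Metric.isOpen_ball
  have hcU : ContinuousOn (c ∘ e) U :=
    hc.comp (e.continuousOn.mono Set.inter_subset_left) fun q hq => hq.2
  have hcU' : ContinuousOn (U.indicator (c ∘ e)) U :=
    hcU.congr fun q hq => Set.indicator_of_mem hq _
  have hcm : Measurable (U.indicator (c ∘ e)) := by
    classical
    have := hcU.measurable_piecewise (continuousOn_const (c := (0 : ℝ))) hU.measurableSet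
    exact (Set.piecewise_eq_indicator (s := U) (f := c ∘ e)) ▸ this
  refine ⟨U, hU, ⟨hps, Metric.mem_ball_self hr⟩, _, hcU', hcm, ?_⟩
  refine (hh.mono hm (fun n => IsSurfaceTest.memLp (φ n).2)
    (Set.inter_subset_inter_right _ (Set.preimage_mono hrB))).congr ?_
  -- the exceptional set is null, as it is null in the chart
  have hS : MeasurableSet {q | h q = U.indicator (c ∘ e) q} :=
    measurableSet_eq_fun hhm.measurable hcm
  rw [Filter.EventuallyEq, ae_restrict_iff' hU.measurableSet]
  have h0 : μ (U ∩ {q | h q = U.indicator (c ∘ e) q}ᶜ) = 0 := by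
    rw [hμ.measure_eq he (hU.measurableSet.inter hS.compl) fun q hq => hq.1.1]
    refine setLIntegral_measure_zero _ _ (measure_mono_null (fun y hy => ?_) (ae_iff.mp hae))
    obtain ⟨hyt, hyU, hy2⟩ := hy
    have hyr : y ∈ Metric.ball (e p) r := by
      have := hyU.2
      rwa [Set.mem_preimage, e.right_inv hyt] at this
    simp only [Set.mem_ofPred_eq, Classical.not_imp]
    refine ⟨hyr, fun h1 => hy2 ?_⟩
    simp only [Set.mem_ofPred_eq]
    rw [Set.indicator_of_mem hyU, Function.comp, e.right_inv hyt]
    exact h1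
  refine measure_mono_null (fun q hq => ?_) h0
  simpa using hq

/-- The variational solution has a continuous representative. -/
lemma exists_continuous_limit [μ.IsOpenPosMeasure] (hμ : IsSurfaceMeasure F μ)
    (hF : IsSmoothImmersion F)
    {Z : Lp E3 2 μ} {ρ : M → ℝ} (hρ : Continuous ρ)
    (hZ : ∀ ψ : testSpace M, inner ℝ Z (gradLp μ hF ψ) = ∫ p, ρ p * (ψ : M → ℝ) p ∂μ)
    {φ : ℕ → testSpace M} (hφ : Filter.Tendsto (fun n => gradLp μ hF (φ n)) Filter.atTop (𝓝 Z))
    (hφ0 : ∀ n p, 0 ≤ (φ n : M → ℝ) p)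
    (hH : ∀ K : Set M, IsCompact K → IsHardySet F μ K) :
    ∃ u : M → ℝ, Continuous u ∧ (∀ p, 0 ≤ u p) ∧
      ∀ K, IsCompact K → IsL2Limit μ (fun n => (φ n : M → ℝ)) u K := by
  have hm2 : ∀ n, MemLp (φ n : M → ℝ) 2 μ := fun n => IsSurfaceTest.memLp (φ n).2
  choose U hU hpU c hc hcm hlim using exists_continuous_isL2Limit hμ hF hρ hZ hφ hH
  have hagree : ∀ p q, Set.EqOn (c p) (c q) (U p ∩ U q) := by
    intro p q
    have h1 := (hlim p).mono (hcm p).aestronglyMeasurable hm2 (Set.inter_subset_left (t := U q))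
    have h2 := (hlim q).mono (hcm q).aestronglyMeasurable hm2 (Set.inter_subset_right (s := U p))
    exact Measure.eqOn_open_of_ae_eq (h1.ae_eq h2 (hcm p).aestronglyMeasurable
      (hcm q).aestronglyMeasurable hm2) ((hU p).inter (hU q))
      ((hc p).mono Set.inter_subset_left) ((hc q).mono Set.inter_subset_right)
  set u : M → ℝ := fun p => c p p with hu
  have huU : ∀ p, ∀ q ∈ U p, u q = c p q := fun p q hq => hagree q p ⟨hpU q, hq⟩
  have huc : Continuous u := by
    rw [continuous_iff_continuousAt]
    intro p
    refine ((hc p).continuousAt ((hU p).mem_nhds (hpU p))).congr ?_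
    filter_upwards [(hU p).mem_nhds (hpU p)] with q hq
    exact (huU p q hq).symm
  have hum : AEStronglyMeasurable u μ := huc.aestronglyMeasurable
  have hulim : ∀ p, IsL2Limit μ (fun n => (φ n : M → ℝ)) u (U p) := fun p =>
    (hlim p).congr (ae_restrict_of_forall_mem (hU p).measurableSet
      fun q hq => (huU p q hq).symm)
  refine ⟨u, huc, fun p => ?_, fun K hK => ?_⟩
  · -- Where `u < 0`, it is no closer to the functions `φ n ≥ 0` than to `0`.
    by_contra! hneg
    set N := U p ∩ u ⁻¹' Set.Iio 0
    have hN : IsOpen N := (hU p).inter (isOpen_Iio.preimage huc)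
    have h1 := (hulim p).mono hum hm2 (Set.inter_subset_left (t := u ⁻¹' Set.Iio 0))
    have h2 : ∫ q in N, (0 - u q) ^ 2 ∂μ ≤ 0 := by
      refine ge_of_tendsto' h1.tendsto fun n => ?_
      refine setIntegral_mono_on ?_ (h1.integrable_sub hum hm2 n) hN.measurableSet fun q hq => ?_
      · simpa [IntegrableOn] using h1.integrable
      · have : u q < 0 := hq.2
        have := hφ0 n q
        nlinarith
    have h3 := (integral_eq_zero_iff_of_nonneg (fun q => sq_nonneg (0 - u q))
      (by simpa [IntegrableOn] using h1.integrable)).mp (le_antisymm h2 (integral_nonneg fun _ => sq_nonneg _))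
    have h4 := Measure.eqOn_open_of_ae_eq h3 hN (by fun_prop) (by fun_prop)
    have h5 := h4 (show p ∈ N from ⟨hpU p, hneg⟩)
    simp at h5
    exact hneg.ne h5
  · refine hK.induction_on (p := fun s => IsL2Limit μ (fun n => (φ n : M → ℝ)) u s)
      ⟨by simp, by simp⟩ (fun s t hst ht => ht.mono hum hm2 hst)
      (fun s t hs ht => hs.union ht hum hm2) fun q _ => ?_
    exact ⟨U q, mem_nhdsWithin_of_mem_nhds ((hU q).mem_nhds (hpU q)), hulim q⟩

end

/-! ### Parabolic surfaces carry no Hardy inequality -/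

section

variable {M : Type*} [TopologicalSpace M] [ChartedSpace E2 M] [MeasurableSpace M] [BorelSpace M]
  {F : M → E3} {e : OpenPartialHomeomorph M E2} {μ : Measure M}

lemma memLp_chartField (hμ : IsSurfaceMeasure F μ) (hF : IsSmoothImmersion F)
    (he : e ∈ IsManifold.maximalAtlas (𝓡 2) ∞ M) {Z : M → E3} (hZ : MemLp Z 2 μ)
    {K : Set E2} (hKe : K ⊆ e.target) (hK : IsCompact K) :
    MemLp (chartField F e Z) 2 (volume.restrict K) := by
  have h1 : MemLp (Z ∘ e.symm) 2 (volume.restrict K) := hμ.memLp_comp_symm hF he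
    (B := Set.univ) MeasurableSet.univ (hZ.restrict _) hK hKe (Set.subset_univ _)
  have h2 : ∀ i, MemLp (fun y => chartField F e Z y i) 2 (volume.restrict K) := by
    intro i
    have hc : ContinuousOn (partialDeriv i (F ∘ e.symm)) K := fun y hy =>
      (contDiffAt_partialDeriv (hF.isRegularAt he (hKe hy)).smooth i).continuousAt.continuousWithinAt
    obtain ⟨L, hL⟩ := hK.exists_bound_of_continuousOn hc
    refine h1.of_le_mul (c := L)
      (h1.aestronglyMeasurable.inner (hc.aestronglyMeasurable hK.measurableSet)) ?_
    filter_upwards [ae_restrict_mem hK.measurableSet] with y hy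
    refine (norm_inner_le_norm _ _).trans ?_
    rw [mul_comm]
    exact mul_le_mul_of_nonneg_right (hL y hy) (norm_nonneg _)
  have h3 : chartField F e Z = fun y =>
      ∑ i, chartField F e Z y i • EuclideanSpace.single i (1 : ℝ) := by
    ext y k
    fin_cases k <;> simp
  rw [h3]
  exact memLp_finsetSum _ fun i _ =>
    ((ContinuousLinearMap.id ℝ ℝ).smulRight (EuclideanSpace.single i (1 : ℝ)) :
      ℝ →L[ℝ] E2).comp_memLp' (h2 i)

variable [IsManifold (𝓡 2) ∞ M] [IsFiniteMeasureOnCompacts μ] [T2Space M]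

/-- The negative of the variational solution is weakly subharmonic. -/
lemma isWeaklySubharmonic_neg (hμ : IsSurfaceMeasure F μ) (hF : IsSmoothImmersion F)
    {Z : Lp E3 2 μ} {ρ : M → ℝ} (hρ : Continuous ρ) (hρ0 : ∀ p, 0 ≤ ρ p)
    (hZ : ∀ ψ : testSpace M, inner ℝ Z (gradLp μ hF ψ) = ∫ p, ρ p * (ψ : M → ℝ) p ∂μ)
    {φ : ℕ → testSpace M} (hφ : Filter.Tendsto (fun n => gradLp μ hF (φ n)) Filter.atTop (𝓝 Z))
    {u : M → ℝ} (hu : Continuous u)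
    (hlim : ∀ K, IsCompact K → IsL2Limit μ (fun n => (φ n : M → ℝ)) u K) :
    IsWeaklySubharmonic F fun p => -u p := by
  refine ⟨hu.neg, fun e he => ⟨fun y => -chartField F e Z y, ⟨?_, ?_⟩, ?_⟩⟩
  · exact fun K hKe hK => (memLp_chartField hμ hF he (Lp.memLp Z) hKe hK).neg
  · intro ψ hψ i
    have hK := (tsupport_chartExtend hψ).1
    have h1 := chart_weak_grad hμ hF he hφ hu.aestronglyMeasurable (hlim _ hK) hψ subset_rfl i
    rw [(hψ.partialDeriv i).setIntegral_mul, hψ.setIntegral_mul]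
    simp only [Function.comp_apply, PiLp.neg_apply, neg_mul, integral_neg, h1]
  · intro ψ hψ hψ0
    have h1 := chart_equation hμ hF he hρ hZ hψ
    have h2 : ∀ y ∉ e.target, (∑ i, ∑ j, (firstForm (F ∘ e.symm) y)⁻¹ i j *
        (-chartField F e Z y) i * partialDeriv j ψ y) * √(firstForm (F ∘ e.symm) y).det = 0 := by
      intro y hy
      simp [(hψ.partialDeriv _).eq_zero hy]
    rw [setIntegral_eq_integral_of_forall_compl_eq_zero h2]
    have h3 : ∀ y, (∑ i, ∑ j, (firstForm (F ∘ e.symm) y)⁻¹ i j *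
        (-chartField F e Z y) i * partialDeriv j ψ y) * √(firstForm (F ∘ e.symm) y).det =
        -(areaDensity (F ∘ e.symm) y * ∑ i, ∑ j, (firstForm (F ∘ e.symm) y)⁻¹ i j *
          (chartField F e Z y i * partialDeriv j ψ y)) := by
      intro y
      rw [areaDensity]
      simp only [Fin.sum_univ_two, PiLp.neg_apply]
      ring
    simp only [h3, integral_neg, h1, Left.neg_nonpos_iff]
    refine integral_nonneg fun y => mul_nonneg (mul_nonneg (Real.sqrt_nonneg _) (hρ0 _)) (hψ0 y)

/-- If the variational solution is constant, its equation has vanishing right hand side. -/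
lemma integral_eq_zero_of_const (hμ : IsSurfaceMeasure F μ) (hF : IsSmoothImmersion F)
    {Z : Lp E3 2 μ} {ρ : M → ℝ} (hρ : Continuous ρ)
    (hZ : ∀ ψ : testSpace M, inner ℝ Z (gradLp μ hF ψ) = ∫ p, ρ p * (ψ : M → ℝ) p ∂μ)
    {φ : ℕ → testSpace M} (hφ : Filter.Tendsto (fun n => gradLp μ hF (φ n)) Filter.atTop (𝓝 Z))
    {k : ℝ} (hlim : ∀ K, IsCompact K → IsL2Limit μ (fun n => (φ n : M → ℝ)) (fun _ => k) K)
    (he : e ∈ IsManifold.maximalAtlas (𝓡 2) ∞ M) {ψ : E2 → ℝ} (hψ : IsTestFunction e.target ψ) :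
    ∫ y, areaDensity (F ∘ e.symm) y * ρ (e.symm y) * ψ y = 0 := by
  rw [← chart_equation hμ hF he hρ hZ hψ]
  have hθ : ∀ i j, IsTestFunction e.target fun y => (areaDensity (F ∘ e.symm) y *
      (firstForm (F ∘ e.symm) y)⁻¹ i j) * partialDeriv j ψ y := fun i j =>
    (hψ.partialDeriv j).mul fun y hy => (hF.isRegularAt he hy).contDiffAt_areaDensity.mul
      ((hF.isRegularAt he hy).contDiffAt_inv_firstForm i j)
  have h1 : ∀ i j, ∫ y, chartField F e Z y i * ((areaDensity (F ∘ e.symm) y *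
      (firstForm (F ∘ e.symm) y)⁻¹ i j) * partialDeriv j ψ y) = 0 := by
    intro i j
    have h2 := chart_weak_grad hμ hF he hφ aestronglyMeasurable_const
      (hlim _ (tsupport_chartExtend (hθ i j)).1) (hθ i j) subset_rfl i
    rw [(hθ i j).integral_mul_partialDeriv (f := fun _ => k) (fun y _ => contDiffAt_const) i] at h2
    simpa [partialDeriv] using h2.symm
  have hint : ∀ i j, Integrable fun y => chartField F e Z y i * ((areaDensity (F ∘ e.symm) y *
      (firstForm (F ∘ e.symm) y)⁻¹ i j) * partialDeriv j ψ y) := fun i j =>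
    (hθ i j).integrable_mul fun K hK hKc => by
      have : IsFiniteMeasure (volume.restrict K) := ⟨by simpa using hKc.measure_lt_top⟩
      have h3 := (memLp_chartField hμ hF he (Lp.memLp Z) hK hKc).integrable one_le_two
      exact (EuclideanSpace.proj (𝕜 := ℝ) i : E2 →L[ℝ] ℝ).integrable_comp h3
  calc _ = ∫ y, ∑ i, ∑ j, chartField F e Z y i * ((areaDensity (F ∘ e.symm) y *
        (firstForm (F ∘ e.symm) y)⁻¹ i j) * partialDeriv j ψ y) := by
        refine integral_congr_ae (.of_forall fun y => ?_)
        simp only [Fin.sum_univ_two]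
        ring
    _ = 0 := by
        rw [integral_finsetSum _ fun i _ => integrable_finsetSum _ fun j _ => hint i j]
        refine Finset.sum_eq_zero fun i _ => ?_
        rw [integral_finsetSum _ fun j _ => hint i j]
        exact Finset.sum_eq_zero fun j _ => h1 i j

/-- On a parabolic surface the energy controls the mass on no nonempty open set. Otherwise a bump
function `ρ` would be of the form `-Δ u` with `u ≥ 0` continuous and of locally finite energy; then
`-u` is subharmonic and bounded above, hence constant, and `ρ = 0`. -/
theorem not_isHardySet_of_isParabolic [ConnectedSpace M] [μ.IsOpenPosMeasure]
    (hμ : IsSurfaceMeasure F μ) (hF : IsSmoothImmersion F) (hpar : IsParabolic F) {U : Set M}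
    (hU : IsOpen U) (hne : U.Nonempty) : ¬ IsHardySet F μ U := by
  intro hHU
  have hH : ∀ K : Set M, IsCompact K → IsHardySet F μ K := fun K hK =>
    isHardySet_of_isCompact hμ hF hU hne hHU hK
  obtain ⟨p, -⟩ := hne
  set e := chartAt E2 p
  have he : e ∈ IsManifold.maximalAtlas (𝓡 2) ∞ M := IsManifold.chart_mem_maximalAtlas p
  obtain ⟨R, hR, hRt⟩ := Metric.nhds_basis_closedBall.mem_iff.mp
    (e.open_target.mem_nhds (mem_chart_target E2 p))
  set b : ContDiffBump (e p) := ⟨R / 2, R, by positivity, by linarith⟩ with hb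
  have hbt : IsTestFunction e.target b := by
    refine ⟨b.contDiff, b.hasCompactSupport, ?_⟩
    rw [b.tsupport_eq]
    exact hRt
  set ρ := chartExtend e b with hρd
  have hρ : IsSurfaceTest ρ := hbt.chartExtend he
  have hρ0 : ∀ p, 0 ≤ ρ p := fun q => Set.indicator_nonneg (fun _ _ => b.nonneg) q
  obtain ⟨Z, hZ, φ, hφ0, hφ⟩ := exists_variational_solution hF hρ hρ0 (hH _ hρ.compact.isCompact)
  obtain ⟨u, hu, hu0, hlim⟩ := exists_continuous_limit hμ hF hρ.smooth.continuous hZ hφ hφ0 hH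
  obtain ⟨k, hk⟩ := hpar _ (isWeaklySubharmonic_neg hμ hF hρ.smooth.continuous hρ0 hZ hφ hu hlim)
    ⟨0, by rintro _ ⟨q, rfl⟩; simpa using hu0 q⟩
  have huk : u = fun _ => -k := funext fun q => by have := hk q; linarith
  rw [huk] at hlim
  have h0 := integral_eq_zero_of_const hμ hF hρ.smooth.continuous hZ hφ hlim he hbt
  have ht : IsTestFunction e.target fun y => (areaDensity (F ∘ e.symm) y * b y) * b y :=
    hbt.mul fun y hy => (hF.isRegularAt he hy).contDiffAt_areaDensity.mul b.contDiff.contDiffAt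
  have h1 : ∀ y, areaDensity (F ∘ e.symm) y * ρ (e.symm y) * b y =
      (areaDensity (F ∘ e.symm) y * b y) * b y := by
    intro y
    by_cases hy : y ∈ e.target
    · rw [hρd, chartExtend_symm e _ hy]
    · rw [hbt.eq_zero hy]; simp
  simp only [h1] at h0
  have hpos := ht.1.continuous.integral_pos_of_hasCompactSupport_nonneg_nonzero (μ := volume) ht.2.1
    (fun y => mul_nonneg (mul_nonneg (Real.sqrt_nonneg _) b.nonneg) b.nonneg) (x := e p) (by
      have h2 := (hF.isRegularAt he (mem_chart_target E2 p)).areaDensity_pos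
      have h3 : b (e p) = 1 := b.one_of_mem_closedBall (Metric.mem_closedBall_self (by positivity))
      rw [h3]
      simpa using h2.ne')
  exact hpos.ne' h0

end

/-! ### Positive supersolutions of weighted Laplacians -/

lemma IsSurfaceTest.mul_left {M : Type*} [TopologicalSpace M] [ChartedSpace E2 M] {φ ψ : M → ℝ} (hφ : IsSurfaceTest φ)
    (hψ : ContMDiff (𝓡 2) 𝓘(ℝ, ℝ) ∞ ψ) : IsSurfaceTest (ψ * φ) :=
  ⟨hψ.mul hφ.smooth, hφ.compact.mul_left⟩

section

variable {M : Type*} [TopologicalSpace M] [ChartedSpace E2 M] [IsManifold (𝓡 2) ∞ M] {F : M → E3}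

lemma exists_eq_const_of_surfaceGrad_eq_zero [ConnectedSpace M] (hF : IsSmoothImmersion F)
    {P : M → ℝ} (hP : ContMDiff (𝓡 2) 𝓘(ℝ, ℝ) ∞ P) (h0 : ∀ p, surfaceGrad F P p = 0) :
    ∃ K, ∀ p, P p = K := by
  have hloc : IsLocallyConstant P := by
    rw [IsLocallyConstant.iff_eventually_eq]
    intro p
    set e := chartAt E2 p
    have he : e ∈ IsManifold.maximalAtlas (𝓡 2) ∞ M := IsManifold.chart_mem_maximalAtlas p
    have hps : p ∈ e.source := mem_chart_source E2 p
    obtain ⟨R, hR, hRt⟩ := Metric.nhds_basis_ball.mem_iff.mp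
      (e.open_target.mem_nhds (mem_chart_target E2 p))
    have hU : e.source ∩ e ⁻¹' Metric.ball (e p) R ∈ 𝓝 p :=
      (e.isOpen_inter_preimage Metric.isOpen_ball).mem_nhds ⟨hps, Metric.mem_ball_self hR⟩
    have hd : ∀ y ∈ Metric.ball (e p) R, DifferentiableAt ℝ (P ∘ e.symm) y := fun y hy =>
      (contDiffAt_comp_symm hP he (hRt hy)).differentiableAt (by simp)
    filter_upwards [hU] with q hq
    have h1 := (convex_ball (e p) R).is_const_of_fderivWithin_eq_zero (𝕜 := ℝ)
      (f := P ∘ e.symm) (fun y hy => (hd y hy).differentiableWithinAt) (fun y hy => ?_)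
      hq.2 (Metric.mem_ball_self hR)
    · simpa only [Function.comp, e.left_inv hq.1, e.left_inv hps] using h1
    · rw [fderivWithin_of_isOpen Metric.isOpen_ball hy]
      ext v
      rw [← inner_chartGrad_fderiv (hF.isRegularAt he (hRt hy)).det_pos,
        ← surfaceGrad_eq hF he hP (hRt hy), h0, inner_zero_left]
      rfl
  obtain ⟨p⟩ := (inferInstance : Nonempty M)
  exact ⟨P p, fun q => hloc.apply_eq_of_preconnectedSpace q p⟩

variable [MeasurableSpace M] [BorelSpace M] {μ : Measure M} [IsFiniteMeasureOnCompacts μ]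

/-- A continuous function against the gradients of a smooth function and a test function. -/
lemma IsSurfaceTest.integrable_inner (hF : IsSmoothImmersion F) {Y : M → E3} (hY : Continuous Y)
    {ψ : M → ℝ} (hψ : IsSurfaceTest ψ) :
    Integrable (fun p => inner ℝ (Y p) (surfaceGrad F ψ p)) μ := by
  refine (hY.inner (continuous_surfaceGrad hF hψ.smooth)).integrable_of_hasCompactSupport
    ((hψ.hasCompactSupport_surfaceGrad (F := F)).mono fun p hp => ?_)
  rw [Function.mem_support] at hp ⊢
  exact fun h0 => hp (by rw [h0, inner_zero_right])

/-- The Hardy inequality: testing the supersolution property with `φ² / (P + 1)`. -/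
lemma hardy_inequality (hF : IsSmoothImmersion F) {κ P : M → ℝ} (hκ : Continuous κ)
    (hκ0 : ∀ p, 0 < κ p) {N : ℝ} (hκN : ∀ p, κ p ≤ N) (hP : ContMDiff (𝓡 2) 𝓘(ℝ, ℝ) ∞ P)
    (hP0 : ∀ p, 0 ≤ P p)
    (hsuper : ∀ ψ, IsSurfaceTest ψ → (∀ p, 0 ≤ ψ p) →
      0 ≤ ∫ p, inner ℝ (κ p • surfaceGrad F P p) (surfaceGrad F ψ p) ∂μ)
    {φ : M → ℝ} (hφ : IsSurfaceTest φ) :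
    ∫ p, (κ p * ‖surfaceGrad F P p‖ ^ 2 / (P p + 1) ^ 2) * φ p ^ 2 ∂μ ≤
      4 * N * ∫ p, ‖surfaceGrad F φ p‖ ^ 2 ∂μ := by
  have hP1 : ∀ p, 0 < P p + 1 := fun p => by linarith [hP0 p]
  set Q : M → ℝ := fun p => (P p + 1)⁻¹ with hQd
  have hQ : ContMDiff (𝓡 2) 𝓘(ℝ, ℝ) ∞ Q := by
    intro p
    have h1 : ContDiffAt ℝ ∞ (fun t : ℝ => (t + 1)⁻¹) (P p) :=
      (contDiffAt_id.add contDiffAt_const).inv (hP1 p).ne'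
    exact h1.contMDiffAt.comp p (hP p)
  have hsq : IsSurfaceTest fun p => φ p ^ 2 :=
    hφ.comp (g := fun t => t ^ 2) (contDiff_id.pow 2) (by simp)
  have hψ : IsSurfaceTest (Q * fun p => φ p ^ 2) := hsq.mul_left hQ
  have h1 := hsuper _ hψ fun p => mul_nonneg (inv_nonneg.mpr (hP1 p).le) (sq_nonneg _)
  have hgrad : ∀ p, surfaceGrad F (Q * fun p => φ p ^ 2) p =
      φ p ^ 2 • ((-(((P p + 1) ^ 2)⁻¹)) • surfaceGrad F P p) +
      (P p + 1)⁻¹ • ((2 * φ p) • surfaceGrad F φ p) := by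
    intro p
    rw [surfaceGrad_mul hQ hsq.smooth, surfaceGrad_comp hφ.smooth (g := fun t => t ^ 2)
      (g' := 2 * φ p) (by simpa using hasDerivAt_pow 2 (φ p)),
      surfaceGrad_comp hP (g := fun t => (t + 1)⁻¹) (g' := -(((P p + 1) ^ 2)⁻¹)) (by
        have := ((hasDerivAt_id (P p)).add_const (1 : ℝ)).inv (hP1 p).ne'
        rw [neg_div, one_div] at this
        exact this)]
  have hgc := continuous_surfaceGrad hF hP
  set L : M → ℝ := fun p => (κ p * ‖surfaceGrad F P p‖ ^ 2 / (P p + 1) ^ 2) * φ p ^ 2 with hL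
  have hLi : Integrable L μ := by
    refine Continuous.integrable_of_hasCompactSupport ?_ (hsq.compact.mul_left)
    exact ((hκ.mul (hgc.norm.pow 2)).div₀ ((hP.continuous.add continuous_const).pow 2)
      fun p => (pow_pos (hP1 p) 2).ne').mul hsq.smooth.continuous
  have hi1 : Integrable (fun p => inner ℝ (κ p • surfaceGrad F P p)
      (surfaceGrad F (Q * fun p => φ p ^ 2) p)) μ := hψ.integrable_inner hF (hκ.smul hgc)
  have hi2 := hφ.integrable_norm_sq (μ := μ) hF
  have hpt : ∀ p, inner ℝ (κ p • surfaceGrad F P p) (surfaceGrad F (Q * fun p => φ p ^ 2) p) ≤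
      2 * N * ‖surfaceGrad F φ p‖ ^ 2 - 2⁻¹ * L p := by
    intro p
    rw [hgrad, inner_add_right]
    simp only [inner_smul_left, inner_smul_right, real_inner_self_eq_norm_sq, conj_trivial, hL]
    set v := surfaceGrad F P p
    set w := surfaceGrad F φ p
    set t := (P p + 1)⁻¹ with ht
    have ht0 : 0 < t := inv_pos.mpr (hP1 p)
    rw [div_eq_mul_inv, ← inv_pow, ← ht]
    have h2 : inner ℝ v w ≤ ‖v‖ * ‖w‖ := real_inner_le_norm v w
    have h2' : -(‖v‖ * ‖w‖) ≤ inner ℝ v w := (abs_le.mp (abs_real_inner_le_norm v w)).1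
    have h3 : φ p * inner ℝ v w ≤ |φ p| * (‖v‖ * ‖w‖) := by
      rw [← abs_of_nonneg (mul_nonneg (norm_nonneg v) (norm_nonneg w))]
      refine (le_abs_self _).trans ?_
      rw [abs_mul, abs_of_nonneg (mul_nonneg (norm_nonneg v) (norm_nonneg w))]
      exact mul_le_mul_of_nonneg_left (abs_le.mpr ⟨h2', h2⟩) (abs_nonneg _)
    have h4 : κ p * ‖w‖ ^ 2 ≤ N * ‖w‖ ^ 2 := mul_le_mul_of_nonneg_right (hκN p) (sq_nonneg _)
    -- The product of `φ t ∇P` and `∇φ` is absorbed by completing this square.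
    have h5 : 0 ≤ κ p * (|φ p| * t * ‖v‖ - 2 * ‖w‖) ^ 2 := mul_nonneg (hκ0 p).le (sq_nonneg _)
    have h6 : κ p * (t * 2) * (φ p * inner ℝ v w) ≤ κ p * (t * 2) * (|φ p| * (‖v‖ * ‖w‖)) :=
      mul_le_mul_of_nonneg_left h3 (mul_nonneg (hκ0 p).le (by positivity))
    have h7 : κ p * (|φ p| * t * ‖v‖ - 2 * ‖w‖) ^ 2 = κ p * φ p ^ 2 * t ^ 2 * ‖v‖ ^ 2 -
        4 * (κ p * |φ p| * t * ‖v‖ * ‖w‖) + 4 * (κ p * ‖w‖ ^ 2) := by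
      rw [← sq_abs (φ p)]; ring
    nlinarith
  have h8 := integral_mono hi1 ((hi2.const_mul (2 * N)).sub (hLi.const_mul 2⁻¹)) hpt
  have h9 : ∫ p, (2 * N * ‖surfaceGrad F φ p‖ ^ 2 - 2⁻¹ * L p) ∂μ =
      2 * N * (∫ p, ‖surfaceGrad F φ p‖ ^ 2 ∂μ) - 2⁻¹ * ∫ p, L p ∂μ := by
    rw [integral_sub (hi2.const_mul (2 * N)) (hLi.const_mul 2⁻¹), integral_const_mul,
      integral_const_mul]
  have h10 := h1.trans (h8.trans_eq h9)
  linarith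

/-- On a parabolic surface, a nonnegative supersolution of a weighted Laplacian with bounded
weight is constant. -/
theorem exists_eq_const_of_supersolution [T2Space M] [ConnectedSpace M] [μ.IsOpenPosMeasure]
    (hμ : IsSurfaceMeasure F μ) (hF : IsSmoothImmersion F) (hpar : IsParabolic F)
    {κ P : M → ℝ} (hκ : Continuous κ)
    (hκ0 : ∀ p, 0 < κ p) {N : ℝ} (hκN : ∀ p, κ p ≤ N) (hP : ContMDiff (𝓡 2) 𝓘(ℝ, ℝ) ∞ P)
    (hP0 : ∀ p, 0 ≤ P p)
    (hsuper : ∀ ψ, IsSurfaceTest ψ → (∀ p, 0 ≤ ψ p) →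
      0 ≤ ∫ p, inner ℝ (κ p • surfaceGrad F P p) (surfaceGrad F ψ p) ∂μ) :
    ∃ K, ∀ p, P p = K := by
  refine exists_eq_const_of_surfaceGrad_eq_zero hF hP fun p => ?_
  by_contra hne
  have hP1 : ∀ p, 0 < P p + 1 := fun p => by linarith [hP0 p]
  set V : M → ℝ := fun p => κ p * ‖surfaceGrad F P p‖ ^ 2 / (P p + 1) ^ 2 with hV
  have hVc : Continuous V := (hκ.mul ((continuous_surfaceGrad hF hP).norm.pow 2)).div₀
    ((hP.continuous.add continuous_const).pow 2) fun p => (pow_pos (hP1 p) 2).ne'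
  have hV0 : ∀ q, 0 ≤ V q := fun q =>
    div_nonneg (mul_nonneg (hκ0 q).le (sq_nonneg _)) (sq_nonneg _)
  have hVp : 0 < V p := div_pos (mul_pos (hκ0 p) (pow_pos (norm_pos_iff.mpr hne) 2))
    (pow_pos (hP1 p) 2)
  set U := V ⁻¹' Set.Ioi (V p / 2)
  have hU : IsOpen U := isOpen_Ioi.preimage hVc
  refine not_isHardySet_of_isParabolic hμ hF hpar hU
    ⟨p, by show V p / 2 < V p; linarith⟩ ⟨(2 / V p) * (4 * N), fun φ hφ => ?_⟩
  have h1 := hardy_inequality hF hκ hκ0 hκN hP hP0 hsuper hφ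
  have hi : Integrable (fun q => V q * φ q ^ 2) μ := by
    refine (hVc.mul (hφ.smooth.continuous.pow 2)).integrable_of_hasCompactSupport ?_
    exact HasCompactSupport.mul_left (hφ.comp (g := fun t => t ^ 2) (contDiff_id.pow 2)
      (by simp)).compact
  rw [mul_assoc, div_mul_eq_mul_div, le_div_iff₀ hVp]
  have h2 : ∫ q in U, φ q ^ 2 * (V p / 2) ∂μ ≤ ∫ q, V q * φ q ^ 2 ∂μ := by
    refine le_trans (setIntegral_mono_on ((hφ.integrable_sq.mul_const _).integrableOn)
      hi.integrableOn hU.measurableSet fun q hq => ?_)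
      (setIntegral_le_integral hi (.of_forall fun q => mul_nonneg (hV0 q) (sq_nonneg _)))
    rw [mul_comm]
    exact mul_le_mul_of_nonneg_right (le_of_lt hq) (sq_nonneg _)
  rw [integral_mul_const] at h2
  linarith

end

/-! ### The supersolution on a translator -/

section

variable {M : Type*} [TopologicalSpace M] [ChartedSpace E2 M] [IsManifold (𝓡 2) ∞ M] {F : M → E3}
  [MeasurableSpace M] [BorelSpace M] {μ : Measure M} [IsFiniteMeasureOnCompacts μ]

/-- A weak inequality holds for all test functions if it holds for those supported in charts. -/
lemma integral_inner_nonneg_of_chart [T2Space M] [SecondCountableTopology M]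
    (hF : IsSmoothImmersion F) {Y : M → E3} (hY : Continuous Y)
    (h : ∀ ψ, IsSurfaceTest ψ → (∀ p, 0 ≤ ψ p) →
      (∃ q : M, tsupport ψ ⊆ (chartAt E2 q).source) →
      0 ≤ ∫ p, inner ℝ (Y p) (surfaceGrad F ψ p) ∂μ)
    {ψ : M → ℝ} (hψ : IsSurfaceTest ψ) (hψ0 : ∀ p, 0 ≤ ψ p) :
    0 ≤ ∫ p, inner ℝ (Y p) (surfaceGrad F ψ p) ∂μ := by
  have : LocallyCompactSpace M := ChartedSpace.locallyCompactSpace E2 M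
  obtain ⟨f, hf⟩ := SmoothPartitionOfUnity.exists_isSubordinate_chartAt_source (𝓡 2) M
  have hfin := f.locallyFinite.finite_nonempty_inter_compact hψ.compact.isCompact
  have hfs : ∀ i, ContMDiff (𝓡 2) 𝓘(ℝ, ℝ) ∞ (f i) := fun i => (f i).contMDiff
  have hterm : ∀ i, IsSurfaceTest (⇑(f i) * ψ) := fun i => hψ.mul_left (hfs i)
  have key : ∀ s : Finset M, IsSurfaceTest (∑ i ∈ s, ⇑(f i) * ψ) ∧
      0 ≤ ∫ p, inner ℝ (Y p) (surfaceGrad F (∑ i ∈ s, ⇑(f i) * ψ) p) ∂μ := by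
    intro s
    classical
    induction s using Finset.induction_on with
    | empty =>
      refine ⟨⟨contMDiff_const, HasCompactSupport.zero⟩, ?_⟩
      have : ∀ p, surfaceGrad F (∑ i ∈ (∅ : Finset M), ⇑(f i) * ψ) p = 0 := fun p =>
        surfaceGrad_eq_zero (by simp)
      simp only [this, inner_zero_right, integral_zero, le_refl]
    | insert i s hi ih =>
      rw [Finset.sum_insert hi]
      refine ⟨(hterm i).add ih.1, ?_⟩
      have e : ∀ p, inner ℝ (Y p) (surfaceGrad F (⇑(f i) * ψ + ∑ i ∈ s, ⇑(f i) * ψ) p) =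
          inner ℝ (Y p) (surfaceGrad F (⇑(f i) * ψ) p) +
          inner ℝ (Y p) (surfaceGrad F (∑ i ∈ s, ⇑(f i) * ψ) p) := fun p => by
        rw [surfaceGrad_add (hterm i).smooth ih.1.smooth, inner_add_right]
      simp only [e]
      rw [integral_add ((hterm i).integrable_inner hF hY) (ih.1.integrable_inner hF hY)]
      refine add_nonneg (h _ (hterm i) (fun p => mul_nonneg (f.nonneg i p) (hψ0 p)) ⟨i, ?_⟩) ih.2
      exact (tsupport_mul_subset_left).trans (hf i)
  have hsum : ∑ i ∈ hfin.toFinset, ⇑(f i) * ψ = ψ := by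
    ext p
    simp only [Finset.sum_apply, Pi.mul_apply]
    rw [← Finset.sum_mul]
    by_cases hp : p ∈ tsupport ψ
    · have h1 := f.sum_eq_one (Set.mem_univ p)
      rw [finsum_eq_sum_of_support_subset (s := hfin.toFinset)] at h1
      · rw [h1, one_mul]
      · intro i hi
        simp only [Set.Finite.coe_toFinset, Set.mem_ofPred_eq]
        exact ⟨p, hi, hp⟩
    · rw [image_eq_zero_of_notMem_tsupport hp, mul_zero]
  have := (key hfin.toFinset).2
  rwa [hsum] at this

/-- The divergence theorem in a chart, seen on the surface: an ambient vector field with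
nonpositive surface divergence. -/
lemma integral_inner_nonneg [T2Space M] [SecondCountableTopology M] (hμ : IsSurfaceMeasure F μ)
    (hF : IsSmoothImmersion F) {Y : E3 → E3} (hY : ContDiff ℝ ∞ Y)
    (hdiv : ∀ e ∈ IsManifold.maximalAtlas (𝓡 2) ∞ M, ∀ y ∈ e.target,
      surfaceDiv (F ∘ e.symm) (Y ∘ F ∘ e.symm) y ≤ 0)
    {ψ : M → ℝ} (hψ : IsSurfaceTest ψ) (hψ0 : ∀ p, 0 ≤ ψ p) :
    0 ≤ ∫ p, inner ℝ (Y (F p)) (surfaceGrad F ψ p) ∂μ := by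
  have hYF : Continuous fun p => Y (F p) := hY.continuous.comp hF.smooth.continuous
  refine integral_inner_nonneg_of_chart hF hYF ?_ hψ hψ0
  rintro φ hφ hφ0 ⟨q, hq⟩
  set e := chartAt E2 q
  have he : e ∈ IsManifold.maximalAtlas (𝓡 2) ∞ M := IsManifold.chart_mem_maximalAtlas q
  obtain ⟨η, hη, rfl, hηe⟩ := hφ.exists_eq_chartExtend he hq
  have h0 : ∀ p ∉ e.source,
      inner ℝ (Y (F p)) (surfaceGrad F (chartExtend e η) p) = 0 := fun p hp => by
    rw [surfaceGrad_eq_zero (notMem_tsupport_iff_eventuallyEq.mp fun h => hp (hq h)),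
      inner_zero_right]
  rw [← setIntegral_eq_integral_of_forall_compl_eq_zero h0, hμ.setIntegral_source hF he
    (hφ.integrable_inner hF hYF).aestronglyMeasurable]
  have h1 := hη.integral_inner_chartGrad (X := F ∘ e.symm) (b := Y ∘ F ∘ e.symm)
    (fun y hy => hF.isRegularAt he hy)
    (fun y hy => hY.contDiffAt.comp y (hF.isRegularAt he hy).smooth)
  have h2 : ∀ y ∉ e.target, areaDensity (F ∘ e.symm) y *
      inner ℝ ((Y ∘ F ∘ e.symm) y) (chartGrad (F ∘ e.symm) η y) = 0 := by
    intro y hy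
    simp [chartGrad, (hη.partialDeriv _).eq_zero hy]
  rw [← setIntegral_eq_integral_of_forall_compl_eq_zero h2] at h1
  have h3 : ∫ y in e.target, areaDensity (F ∘ e.symm) y *
      inner ℝ (Y (F (e.symm y))) (surfaceGrad F (chartExtend e η) (e.symm y)) =
      -∫ y, areaDensity (F ∘ e.symm) y * surfaceDiv (F ∘ e.symm) (Y ∘ F ∘ e.symm) y * η y := by
    rw [← h1]
    refine setIntegral_congr_fun e.open_target.measurableSet fun y hy => ?_
    simp only [surfaceGrad_chartExtend hF he hη hy, Function.comp]
  rw [h3, ← integral_neg]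
  refine integral_nonneg fun y => ?_
  by_cases hy : y ∈ e.target
  · have h4 : 0 ≤ η y := by rw [hηe y hy]; exact hφ0 _
    have h5 := mul_nonneg (mul_nonneg (hF.isRegularAt he hy).areaDensity_pos.le
      (neg_nonneg.mpr (hdiv e he y hy))) h4
    simpa using h5
  · simp [hη.eq_zero hy]

end

section

variable (lam α a : ℝ)

/-- The linear function `(1 - λ⁻²) x₃ - α λ⁻² x₂` of the exponent of the test field. -/
def fieldExponent : E3 →L[ℝ] ℝ :=
  (1 - (lam ^ 2)⁻¹) • EuclideanSpace.proj (𝕜 := ℝ) (2 : Fin 3) -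
    (α * (lam ^ 2)⁻¹) • EuclideanSpace.proj (𝕜 := ℝ) (1 : Fin 3)

/-- The vector field of `ℝ³` whose tangential part is the weighted gradient of
`sin ((x₁ - a) / λ) exp ((x₃ + α x₂) / λ²)`. -/
def testField (x : E3) : E3 :=
  Real.exp (fieldExponent lam α x) • (Real.cos ((x 0 - a) / lam) • !₂[lam⁻¹, 0, 0] +
    Real.sin ((x 0 - a) / lam) • !₂[0, α * (lam ^ 2)⁻¹, (lam ^ 2)⁻¹])

/-- The derivative of the bracket of `testField` in the direction of the first axis. -/
def testFieldDeriv (x : E3) : E3 :=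
  Real.exp (fieldExponent lam α x) • ((-Real.sin ((x 0 - a) / lam) * lam⁻¹) • !₂[lam⁻¹, 0, 0] +
    (Real.cos ((x 0 - a) / lam) * lam⁻¹) • !₂[0, α * (lam ^ 2)⁻¹, (lam ^ 2)⁻¹])

lemma contDiff_angle : ContDiff ℝ ∞ fun x : E3 => (x 0 - a) / lam :=
  (((EuclideanSpace.proj (𝕜 := ℝ) (0 : Fin 3)).contDiff).sub contDiff_const).div_const _

lemma contDiff_testField : ContDiff ℝ ∞ (testField lam α a) :=
  (fieldExponent lam α).contDiff.exp.smul
    (((contDiff_angle lam a).cos.smul contDiff_const).add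
      ((contDiff_angle lam a).sin.smul contDiff_const))

lemma hasFDerivAt_angle (x : E3) : HasFDerivAt (fun x : E3 => (x 0 - a) / lam)
    (lam⁻¹ • EuclideanSpace.proj (𝕜 := ℝ) (0 : Fin 3)) x := by
  have h : HasFDerivAt (fun x : E3 => x 0) (EuclideanSpace.proj (𝕜 := ℝ) (0 : Fin 3)) x :=
    (EuclideanSpace.proj (𝕜 := ℝ) (0 : Fin 3)).hasFDerivAt
  have h1 := (h.sub_const a).const_mul lam⁻¹
  refine h1.congr_of_eventuallyEq (.of_forall fun z => ?_)
  simp only [div_eq_inv_mul]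

lemma fderiv_testField (x v : E3) : fderiv ℝ (testField lam α a) x v =
    fieldExponent lam α v • testField lam α a x + v 0 • testFieldDeriv lam α a x := by
  have hθ := hasFDerivAt_angle lam a x
  have h := ((fieldExponent lam α).hasFDerivAt (x := x)).exp.smul
    ((hθ.cos.smul_const (!₂[lam⁻¹, 0, 0] : E3)).add
      (hθ.sin.smul_const (!₂[0, α * (lam ^ 2)⁻¹, (lam ^ 2)⁻¹] : E3)))
  have h1 : fderiv ℝ (testField lam α a) x = _ := h.fderiv
  rw [h1]
  ext k
  fin_cases k <;> simp [testField, testFieldDeriv] <;> ring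

end

/-- The pointwise inequality behind the supersolution property, for a normal vector `n`: the left
hand side is `(λ² - 1 - α²) n₁² - (n₂ - α n₃)²` times a nonnegative factor. -/
lemma test_inequality {lam α s c E : ℝ} (hlam : 0 < lam) (hα : lam ^ 2 - 1 ≤ α ^ 2) (hs : 0 ≤ s)
    (hE : 0 < E) {n : E3} (hn : 0 < (inner ℝ n n : ℝ)) {B C w : E3}
    (hB : B = E • (c • !₂[lam⁻¹, 0, 0] + s • !₂[0, α * (lam ^ 2)⁻¹, (lam ^ 2)⁻¹]))
    (hC : C = E • ((-s * lam⁻¹) • !₂[lam⁻¹, 0, 0] +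
      (c * lam⁻¹) • !₂[0, α * (lam ^ 2)⁻¹, (lam ^ 2)⁻¹]))
    (hw : w = !₂[0, -(α * (lam ^ 2)⁻¹), 1 - (lam ^ 2)⁻¹]) :
    (inner ℝ w B - inner ℝ w n * inner ℝ B n / inner ℝ n n) +
      (C 0 - n 0 * inner ℝ C n / inner ℝ n n) + inner ℝ B n * n 2 / inner ℝ n n ≤ 0 := by
  have key : (inner ℝ w B - inner ℝ w n * inner ℝ B n / inner ℝ n n) +
      (C 0 - n 0 * inner ℝ C n / inner ℝ n n) + inner ℝ B n * n 2 / inner ℝ n n =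
      E * s / (lam ^ 4 * inner ℝ n n) *
        ((lam ^ 2 - 1 - α ^ 2) * n 0 ^ 2 - (n 1 - α * n 2) ^ 2) := by
    obtain ⟨D, hD⟩ : ∃ D, D = (inner ℝ n n : ℝ) := ⟨_, rfl⟩
    rw [← hD] at hn ⊢
    rw [inner_E3] at hD
    have hn' := hn.ne'
    subst hB hC hw
    simp only [inner_E3]
    simp
    field_simp
    rw [hD]
    ring
  rw [key]
  refine mul_nonpos_of_nonneg_of_nonpos (by positivity) ?_
  nlinarith [mul_nonneg (show 0 ≤ 1 + α ^ 2 - lam ^ 2 by linarith) (sq_nonneg (n 0)),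
    sq_nonneg (n 1 - α * n 2)]

/-- On a translator in the slab, the surface divergence of the test field is nonpositive. -/
lemma surfaceDiv_testField_nonpos {lam α a : ℝ} (hlam : 0 < lam) (hα : lam ^ 2 - 1 ≤ α ^ 2)
    {X : E2 → E3} {y : E2} (hX : IsRegularAt X y)
    (hH : meanCurvature X y = normalPart X y e₃)
    (hs : 0 ≤ Real.sin ((X y 0 - a) / lam)) :
    surfaceDiv X (testField lam α a ∘ X) y ≤ 0 := by
  have hd := hX.det_pos
  set w : E3 := !₂[0, -(α * (lam ^ 2)⁻¹), 1 - (lam ^ 2)⁻¹] with hw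
  set B := testField lam α a (X y) with hB
  set C := testFieldDeriv lam α a (X y) with hC
  set n := chartNormal X y with hn
  have hpd : ∀ j, partialDeriv j (testField lam α a ∘ X) y =
      inner ℝ w (partialDeriv j X y) • B +
        inner ℝ (EuclideanSpace.single (0 : Fin 3) (1 : ℝ)) (partialDeriv j X y) • C := by
    intro j
    have h1 : inner ℝ w (partialDeriv j X y) = fieldExponent lam α (partialDeriv j X y) := by
      rw [inner_E3]
      simp [hw, fieldExponent]
      ring
    have h2 : inner ℝ (EuclideanSpace.single (0 : Fin 3) (1 : ℝ)) (partialDeriv j X y) =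
        partialDeriv j X y 0 := by
      rw [inner_E3]; simp
    rw [h1, h2]
    have h3 : fderiv ℝ (testField lam α a ∘ X) y =
        (fderiv ℝ (testField lam α a) (X y)).comp (fderiv ℝ X y) :=
      fderiv_comp y ((contDiff_testField lam α a).differentiable (by simp) _)
        (hX.smooth.differentiableAt (by simp))
    rw [partialDeriv, h3, ContinuousLinearMap.comp_apply, fderiv_testField]
    rfl
  have h1 : ∑ i, ∑ j, (firstForm X y)⁻¹ i j *
      inner ℝ (partialDeriv j (testField lam α a ∘ X) y) (partialDeriv i X y) =
      (inner ℝ B w - inner ℝ B n * inner ℝ w n / (firstForm X y).det) +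
      (inner ℝ C (EuclideanSpace.single (0 : Fin 3) (1 : ℝ)) - inner ℝ C n *
        inner ℝ (EuclideanSpace.single (0 : Fin 3) (1 : ℝ)) n / (firstForm X y).det) := by
    rw [← sum_inv_firstForm hd, ← sum_inv_firstForm hd, ← Finset.sum_add_distrib]
    refine Finset.sum_congr rfl fun i _ => ?_
    rw [← Finset.sum_add_distrib]
    refine Finset.sum_congr rfl fun j _ => ?_
    rw [hpd, inner_add_left, inner_smul_left, inner_smul_left]
    simp only [conj_trivial]
    ring
  have h2 : inner ℝ ((testField lam α a ∘ X) y) (meanCurvature X y) =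
      inner ℝ B n * n 2 / (firstForm X y).det := by
    rw [hH, normalPart_eq hd, inner_smul_right]
    have : inner ℝ e₃ n = n 2 := by rw [e₃, inner_E3]; simp
    rw [← hn, this]
    change n 2 / _ * inner ℝ B n = _
    ring
  have hnn : (firstForm X y).det = inner ℝ n n := det_firstForm X y
  have h3 := test_inequality (n := n) hlam hα hs (Real.exp_pos (fieldExponent lam α (X y)))
    (hnn ▸ hd) (B := B) (C := C) (w := w) (c := Real.cos ((X y 0 - a) / lam)) rfl rfl hw
  rw [surfaceDiv, h1, h2, hnn]
  have h4 : inner ℝ C (EuclideanSpace.single (0 : Fin 3) (1 : ℝ)) = C 0 := by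
    rw [inner_E3]; simp
  have h5 : inner ℝ (EuclideanSpace.single (0 : Fin 3) (1 : ℝ)) n = n 0 := by
    rw [inner_E3]; simp
  rw [h4, h5, real_inner_comm w B, mul_comm (inner ℝ B n) (inner ℝ w n),
    mul_comm (inner ℝ C n) (n 0)]
  exact h3

/-- The function `sin ((x₁ - a) / λ) exp ((x₃ + α x₂) / λ²)`. -/
def barrier (lam α a : ℝ) (x : E3) : ℝ :=
  Real.sin ((x 0 - a) / lam) * Real.exp ((x 2 + α * x 1) / lam ^ 2)

/-- The weight `exp (-(2 / λ²) ((1 - λ² / 2) x₃ + α x₂))`, which is bounded on the half-spaces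
`(1 - λ² / 2) x₃ + α x₂ ≥ c`. -/
def weight (lam α : ℝ) (x : E3) : ℝ :=
  Real.exp (-(2 / lam ^ 2 * ((1 - lam ^ 2 / 2) * x 2 + α * x 1)))

lemma contDiff_barrier (lam α a : ℝ) : ContDiff ℝ ∞ (barrier lam α a) :=
  (contDiff_angle lam a).sin.mul (ContDiff.exp (ContDiff.div_const
    (((EuclideanSpace.proj (𝕜 := ℝ) (2 : Fin 3)).contDiff).add
      (contDiff_const.mul (EuclideanSpace.proj (𝕜 := ℝ) (1 : Fin 3)).contDiff)) _))

lemma weight_mul_fderiv_barrier {lam : ℝ} (hlam : 0 < lam) (α a : ℝ) (x v : E3) :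
    weight lam α x * fderiv ℝ (barrier lam α a) x v = inner ℝ (testField lam α a x) v := by
  have hθ := hasFDerivAt_angle lam a x
  have h2 : HasFDerivAt (fun x : E3 => (x 2 + α * x 1) / lam ^ 2)
      ((lam ^ 2)⁻¹ • (EuclideanSpace.proj (𝕜 := ℝ) (2 : Fin 3) +
        α • EuclideanSpace.proj (𝕜 := ℝ) (1 : Fin 3)) : E3 →L[ℝ] ℝ) x := by
    have h := ((lam ^ 2)⁻¹ • (EuclideanSpace.proj (𝕜 := ℝ) (2 : Fin 3) +
        α • EuclideanSpace.proj (𝕜 := ℝ) (1 : Fin 3)) : E3 →L[ℝ] ℝ).hasFDerivAt (x := x)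
    refine h.congr_of_eventuallyEq (.of_forall fun z => ?_)
    simp [div_eq_inv_mul, mul_add]
  have h3 : fderiv ℝ (barrier lam α a) x = _ := (hθ.sin.mul h2.exp).fderiv
  have h4 : fieldExponent lam α x = -(2 / lam ^ 2 * ((1 - lam ^ 2 / 2) * x 2 + α * x 1)) +
      (x 2 + α * x 1) / lam ^ 2 := by
    simp [fieldExponent]
    field_simp
    ring
  rw [h3, testField, h4, Real.exp_add, weight, inner_E3]
  simp
  ring

section

variable {M : Type*} [TopologicalSpace M] [ChartedSpace E2 M] [IsManifold (𝓡 2) ∞ M] {F : M → E3}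

lemma weight_smul_surfaceGrad_barrier (hF : IsSmoothImmersion F) {lam : ℝ} (hlam : 0 < lam)
    (α a : ℝ) (ψ : M → ℝ) (p : M) :
    inner ℝ (weight lam α (F p) • surfaceGrad F (fun q => barrier lam α a (F q)) p)
      (surfaceGrad F ψ p) = inner ℝ (testField lam α a (F p)) (surfaceGrad F ψ p) := by
  set e := chartAt E2 p
  have he : e ∈ IsManifold.maximalAtlas (𝓡 2) ∞ M := IsManifold.chart_mem_maximalAtlas p
  have hp : e.symm (e p) = p := e.left_inv (mem_chart_source E2 p)
  have hreg := hF.isRegularAt he (mem_chart_target E2 p)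
  obtain ⟨v, hv⟩ := chartGrad_mem_range (F ∘ e.symm) (ψ ∘ e.symm) (e p)
  have hv' : fderiv ℝ (F ∘ e.symm) (e p) v = surfaceGrad F ψ p := hv
  have h1 : surfaceGrad F (fun q => barrier lam α a (F q)) p =
      chartGrad (F ∘ e.symm) (barrier lam α a ∘ (F ∘ e.symm)) (e p) := rfl
  rw [← hv', h1, inner_smul_left, inner_chartGrad_fderiv hreg.det_pos, fderiv_comp _
    ((contDiff_barrier lam α a).differentiable (by simp) _) (hreg.smooth.differentiableAt (by simp)),
    ContinuousLinearMap.comp_apply, Function.comp, hp, conj_trivial,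
    weight_mul_fderiv_barrier hlam]

/-- On a parabolic translator in the slab and in the half-space, the barrier is a nonnegative
supersolution of the Laplacian weighted by `weight`, and therefore constant. -/
theorem exists_barrier_eq [T2Space M] [SecondCountableTopology M] [ConnectedSpace M]
    (hF : IsTranslator F) (hpar : IsParabolic F) {lam α c a : ℝ} (hlam : 0 < lam)
    (hα : lam ^ 2 - 1 ≤ α ^ 2) (hslab : ∀ p, F p 0 ∈ Set.Icc a (a + lam * Real.pi))
    (hhalf : ∀ p, c ≤ (1 - lam ^ 2 / 2) * F p 2 + α * F p 1) :
    ∃ K, ∀ p, barrier lam α a (F p) = K := by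
  have hI : IsSmoothImmersion F := ⟨hF.smooth, hF.immersion⟩
  let _ : MeasurableSpace M := borel M
  have : BorelSpace M := ⟨rfl⟩
  obtain ⟨μ, hμ⟩ := exists_isSurfaceMeasure hI
  have := hμ.isLocallyFiniteMeasure hI
  have := hμ.isOpenPosMeasure hI
  have hsin : ∀ p, 0 ≤ Real.sin ((F p 0 - a) / lam) := by
    intro p
    obtain ⟨h1, h2⟩ := hslab p
    refine Real.sin_nonneg_of_nonneg_of_le_pi (div_nonneg (by linarith) hlam.le) ?_
    rw [div_le_iff₀ hlam]
    linarith
  have hFc := hF.smooth.continuous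
  refine exists_eq_const_of_supersolution hμ hI hpar (κ := fun p => weight lam α (F p))
    (N := Real.exp (-(2 / lam ^ 2 * c))) ?_ (fun p => Real.exp_pos _) (fun p => ?_)
    ((contDiff_barrier lam α a).contMDiff.comp hF.smooth)
    (fun p => mul_nonneg (hsin p) (Real.exp_pos _).le) fun ψ hψ hψ0 => ?_
  · unfold weight
    fun_prop
  · refine Real.exp_le_exp.mpr (neg_le_neg ?_)
    exact mul_le_mul_of_nonneg_left (hhalf p) (by positivity)
  · have e : ∀ p, inner ℝ (weight lam α (F p) • surfaceGrad F
        (fun q => barrier lam α a (F q)) p) (surfaceGrad F ψ p) =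
        inner ℝ (testField lam α a (F p)) (surfaceGrad F ψ p) :=
      weight_smul_surfaceGrad_barrier hI hlam α a ψ
    have h := integral_inner_nonneg (μ := μ) hμ hI (contDiff_testField lam α a) (fun e he y hy =>
      surfaceDiv_testField_nonpos hlam hα (hI.isRegularAt he hy) (hF.meanCurvature_eq e he y hy)
        (hsin _)) hψ hψ0
    simp only [← e] at h
    exact h

end

/-! ### Complete surfaces with a global parametrization -/

section

variable {M : Type*} [TopologicalSpace M] {P : M → E2}

/-- `γ` lifts the segment `t ↦ x + t v`, `0 ≤ t ≤ T`, through `P`, starting at `p`. -/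
structure IsSegmentLift (P : M → E2) (p : M) (v : E2) (T : ℝ) (γ : ℝ → M) : Prop where
  continuousOn : ContinuousOn γ (Set.Icc 0 T)
  zero : γ 0 = p
  lift : ∀ t ∈ Set.Icc 0 T, P (γ t) = P p + t • v

lemma IsSegmentLift.mono {p : M} {v : E2} {T T' : ℝ} {γ : ℝ → M}
    (h : IsSegmentLift P p v T γ) (hT : T' ≤ T) : IsSegmentLift P p v T' γ :=
  ⟨h.continuousOn.mono (Set.Icc_subset_Icc_right hT), h.zero,
    fun t ht => h.lift t ⟨ht.1, ht.2.trans hT⟩⟩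

lemma IsSegmentLift.eqOn [T2Space M] (hloc : IsLocalHomeomorph P) {p : M} {v : E2} {T : ℝ}
    {γ γ' : ℝ → M} (h : IsSegmentLift P p v T γ) (h' : IsSegmentLift P p v T γ')
    (hT : 0 ≤ T) : Set.EqOn γ γ' (Set.Icc 0 T) :=
  (T2Space.isSeparatedMap P).eqOn_of_comp_eqOn hloc.isLocallyInjective isPreconnected_Icc
    h.continuousOn h'.continuousOn (fun t ht => (h.lift t ht).trans (h'.lift t ht).symm)
    (Set.left_mem_Icc.mpr hT) (h.zero.trans h'.zero.symm)

end

section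

variable {M : Type*} [TopologicalSpace M] [ChartedSpace E2 M]
  {F : M → E3} {P : M → E2} {D : Set E2} {Ψ : E2 → E3}

lemma injective_fderiv_of_eq_comp (hF : IsSmoothImmersion F) (hD : IsOpen D)
    (hP : ContMDiff (𝓡 2) 𝓘(ℝ, E2) ∞ P) (hPD : ∀ p, P p ∈ D) (hΨ : ContDiffOn ℝ ∞ Ψ D)
    (hFP : ∀ p, F p = Ψ (P p)) {e : OpenPartialHomeomorph M E2}
    (he : e ∈ IsManifold.maximalAtlas (𝓡 2) ∞ M) {y : E2} (hy : y ∈ e.target) :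
    Function.Injective (fderiv ℝ (P ∘ e.symm) y) := by
  have h1 := (hF.isRegularAt he hy).injective_fderiv
  have h2 : F ∘ e.symm = Ψ ∘ (P ∘ e.symm) := funext fun z => hFP _
  rw [h2, fderiv_comp y
    ((hΨ.contDiffAt (hD.mem_nhds (hPD _))).differentiableAt (by simp))
    ((contDiffAt_comp_symm hP he hy).differentiableAt (by simp))] at h1
  exact Function.Injective.of_comp (f := fderiv ℝ Ψ ((P ∘ e.symm) y)) h1

/-- A smooth map to the plane through which an immersion factors has smooth local inverses. -/
lemma exists_local_inverse [IsManifold (𝓡 2) ∞ M] (hF : IsSmoothImmersion F) (hD : IsOpen D)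
    (hP : ContMDiff (𝓡 2) 𝓘(ℝ, E2) ∞ P) (hPD : ∀ p, P p ∈ D) (hΨ : ContDiffOn ℝ ∞ Ψ D)
    (hFP : ∀ p, F p = Ψ (P p)) (p : M) : ∃ h : OpenPartialHomeomorph M E2, p ∈ h.source ∧
      Set.EqOn P h h.source ∧ ContMDiffOn 𝓘(ℝ, E2) (𝓡 2) ∞ h.symm h.target := by
  set e := chartAt E2 p
  have he : e ∈ IsManifold.maximalAtlas (𝓡 2) ∞ M := IsManifold.chart_mem_maximalAtlas p
  have key : ∀ y ∈ e.target, ∃ A : E2 ≃L[ℝ] E2,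
      HasFDerivAt (P ∘ e.symm) (A : E2 →L[ℝ] E2) y := by
    intro y hy
    refine ⟨(LinearEquiv.ofInjectiveEndo (fderiv ℝ (P ∘ e.symm) y : E2 →ₗ[ℝ] E2)
      (injective_fderiv_of_eq_comp hF hD hP hPD hΨ hFP he hy)).toContinuousLinearEquiv, ?_⟩
    have h := ((contDiffAt_comp_symm hP he hy).differentiableAt (by simp)).hasFDerivAt
    exact h.congr_fderiv (by ext v : 1; rfl)
  obtain ⟨A, hA⟩ := key (e p) (mem_chart_target E2 p)
  have hs := contDiffAt_comp_symm hP he (mem_chart_target E2 p)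
  let g := hs.toOpenPartialHomeomorph _ hA (by simp)
  have hg : ⇑g = P ∘ e.symm := rfl
  refine ⟨e.trans g, ?_, ?_, ?_⟩
  · rw [OpenPartialHomeomorph.trans_source]
    exact ⟨mem_chart_source E2 p, hs.mem_toOpenPartialHomeomorph_source hA (by simp)⟩
  · intro q hq
    rw [OpenPartialHomeomorph.trans_source] at hq
    simp only [OpenPartialHomeomorph.coe_trans, Function.comp, hg, e.left_inv hq.1]
  · intro x hx
    rw [OpenPartialHomeomorph.trans_target] at hx
    obtain ⟨B, hB⟩ := key _ hx.2
    have h1 : ContDiffAt ℝ ∞ g.symm x :=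
      g.contDiffAt_symm hx.1 hB (contDiffAt_comp_symm hP he hx.2)
    exact ((contMDiffAt_symm_of_mem_maximalAtlas he hx.2).comp x
      h1.contMDiffAt).contMDiffWithinAt

/-- Near each parameter, the lift is the image of the segment under a smooth local inverse of
`P`. -/
lemma IsSegmentLift.contMDiffOn
    (hloc : ∀ p, ∃ h : OpenPartialHomeomorph M E2, p ∈ h.source ∧
      Set.EqOn P h h.source ∧ ContMDiffOn 𝓘(ℝ, E2) (𝓡 2) ∞ h.symm h.target)
    {p : M} {v : E2} {T : ℝ} {γ : ℝ → M} (hγ : IsSegmentLift P p v T γ) :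
    ContMDiffOn 𝓘(ℝ, ℝ) (𝓡 2) ∞ γ (Set.Icc 0 T) := by
  intro t ht
  obtain ⟨h, hp, hPh, hs⟩ := hloc (γ t)
  have hline : ContMDiff 𝓘(ℝ, ℝ) 𝓘(ℝ, E2) ∞ (fun t : ℝ => P p + t • v) :=
    ContDiff.contMDiff (by fun_prop)
  have key : ∀ s ∈ Set.Icc 0 T, γ s ∈ h.source → γ s = h.symm (P p + s • v) := by
    intro s hs' hss
    rw [← hγ.lift s hs', hPh hss, h.left_inv hss]
  have ht' : P p + t • v ∈ h.target := by
    rw [← hγ.lift t ht, hPh hp]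
    exact h.map_source hp
  have h1 : ContMDiffAt 𝓘(ℝ, ℝ) (𝓡 2) ∞ (fun s : ℝ => h.symm (P p + s • v)) t :=
    ((hs _ ht').contMDiffAt (h.open_target.mem_nhds ht')).comp t hline.contMDiffAt
  refine h1.contMDiffWithinAt.congr_of_eventuallyEq ?_ (key t ht hp)
  filter_upwards [self_mem_nhdsWithin, (hγ.continuousOn t ht).preimage_mem_nhdsWithin
    (h.open_source.mem_nhds hp)] with s h1 h2 using key s h1 h2

/-- The lift of a segment is Lipschitz for the intrinsic distance. -/
lemma IsSegmentLift.intrinsicDist_le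
    (hloc : ∀ p, ∃ h : OpenPartialHomeomorph M E2, p ∈ h.source ∧
      Set.EqOn P h h.source ∧ ContMDiffOn 𝓘(ℝ, E2) (𝓡 2) ∞ h.symm h.target)
    (hD : IsOpen D) (hPD : ∀ p, P p ∈ D) (hΨ : ContDiffOn ℝ ∞ Ψ D)
    (hFP : ∀ p, F p = Ψ (P p))
    {p : M} {v : E2} {T : ℝ} {γ : ℝ → M} (hγ : IsSegmentLift P p v T γ) {C : ℝ}
    (hC : ∀ t ∈ Set.Icc 0 T, ‖fderiv ℝ Ψ (P p + t • v) v‖ ≤ C) {t₁ t₂ : ℝ}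
    (h₁ : t₁ ∈ Set.Icc 0 T) (h₂ : t₂ ∈ Set.Icc 0 T) :
    intrinsicDist F (γ t₁) (γ t₂) ≤ ENNReal.ofReal (C * |t₂ - t₁|) := by
  set l : ℝ → ℝ := fun τ => t₁ + τ * (t₂ - t₁) with hl
  have hmaps : Set.MapsTo l (Set.Icc 0 1) (Set.Icc 0 T) := by
    intro τ hτ
    have := (convex_Icc 0 T).add_smul_sub_mem h₁ h₂ hτ
    simpa [l] using this
  have hsm : ContMDiffOn 𝓘(ℝ, ℝ) (𝓡 2) 1 (γ ∘ l) (Set.Icc 0 1) :=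
    ((hγ.contMDiffOn hloc).of_le (by norm_cast)).comp
      (ContDiff.contMDiff (by fun_prop)).contMDiffOn hmaps
  have hle : intrinsicDist F (γ t₁) (γ t₂) ≤
      ∫⁻ t in Set.Icc (0 : ℝ) 1, ‖deriv (F ∘ γ ∘ l) t‖ₑ :=
    iInf₂_le_of_le (γ ∘ l) hsm <| iInf₂_le_of_le (by simp [l]) (by simp [l]) le_rfl
  refine hle.trans ?_
  rw [← Measure.restrict_congr_set (Ioo_ae_eq_Icc (μ := volume) (a := (0 : ℝ)) (b := 1))]
  have hbound : ∀ τ ∈ Set.Ioo (0 : ℝ) 1,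
      ‖deriv (F ∘ γ ∘ l) τ‖ₑ ≤ ENNReal.ofReal (C * |t₂ - t₁|) := by
    intro τ hτ
    have hτ' := hmaps (Set.Ioo_subset_Icc_self hτ)
    have hmem : P p + l τ • v ∈ D := by
      rw [← hγ.lift _ hτ']
      exact hPD _
    have heq : F ∘ γ ∘ l =ᶠ[𝓝 τ] fun s => Ψ (P p + l s • v) := by
      filter_upwards [isOpen_Ioo.mem_nhds hτ] with s hs
      simp only [Function.comp, hFP, hγ.lift _ (hmaps (Set.Ioo_subset_Icc_self hs))]
    have hd : HasDerivAt (fun s => Ψ (P p + l s • v))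
        (fderiv ℝ Ψ (P p + l τ • v) ((t₂ - t₁) • v)) τ := by
      have h1 : HasDerivAt l (t₂ - t₁) τ := by
        simpa [l] using ((hasDerivAt_id τ).mul_const (t₂ - t₁)).const_add t₁
      exact ((hΨ.contDiffAt (hD.mem_nhds hmem)).differentiableAt
        (by simp)).hasFDerivAt.comp_hasDerivAt τ ((h1.smul_const v).const_add (P p))
    rw [heq.deriv_eq, hd.deriv, ← ofReal_norm, map_smul, norm_smul, Real.norm_eq_abs, mul_comm]
    exact ENNReal.ofReal_le_ofReal
      (mul_le_mul_of_nonneg_right (hC _ hτ') (abs_nonneg _))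
  refine (setLIntegral_mono' measurableSet_Ioo hbound).trans ?_
  simp

/-- A segment which stays in the domain `D` of the parametrization lifts: a lift up to time `s`
has finite length, so that by completeness it has an end point at time `s`, from which it can be
prolonged. -/
lemma exists_isSegmentLift [T2Space M]
    (hloc : ∀ p, ∃ h : OpenPartialHomeomorph M E2, p ∈ h.source ∧
      Set.EqOn P h h.source ∧ ContMDiffOn 𝓘(ℝ, E2) (𝓡 2) ∞ h.symm h.target)
    (hF : IsCompleteSurface F) (hD : IsOpen D) (hPD : ∀ p, P p ∈ D) (hΨ : ContDiffOn ℝ ∞ Ψ D)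
    (hFP : ∀ p, F p = Ψ (P p)) (p : M) {v : E2} (hv : ∀ t ∈ Set.Icc (0 : ℝ) 1, P p + t • v ∈ D) :
    ∃ γ, IsSegmentLift P p v 1 γ := by
  have hhomeo : IsLocalHomeomorph P := IsLocalHomeomorph.mk P fun q => by
    obtain ⟨h, h1, h2, -⟩ := hloc q
    exact ⟨h, h1, h2⟩
  have hPc := hhomeo.continuous
  obtain ⟨C, hC⟩ : ∃ C, ∀ t ∈ Set.Icc (0 : ℝ) 1, ‖fderiv ℝ Ψ (P p + t • v) v‖ ≤ C := by
    refine isCompact_Icc.exists_bound_of_continuousOn ?_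
    have h1 : ContinuousOn (fderiv ℝ Ψ) D := hΨ.continuousOn_fderiv_of_isOpen hD (by simp)
    exact (h1.comp (by fun_prop : Continuous fun t : ℝ => P p + t • v).continuousOn hv).clm_apply
      continuousOn_const
  set S : Set ℝ := {T | T ∈ Set.Icc 0 1 ∧ ∃ γ, IsSegmentLift P p v T γ} with hS
  have hS0 : (0 : ℝ) ∈ S := by
    refine ⟨by simp, fun _ => p, continuousOn_const, rfl, fun t ht => ?_⟩
    have : t = 0 := le_antisymm ht.2 ht.1
    simp [this]
  have hSb : BddAbove S := ⟨1, fun T hT => hT.1.2⟩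
  obtain ⟨u, hu, hlim, huS⟩ := exists_seq_tendsto_sSup ⟨0, hS0⟩ hSb
  choose γ hγ using fun n => (huS n).2
  set s := sSup S
  have hs : s ∈ Set.Icc (0 : ℝ) 1 := ⟨le_csSup hSb hS0, csSup_le ⟨0, hS0⟩ fun T hT => hT.1.2⟩
  have hcons : ∀ m k, m ≤ k → γ m (u m) = γ k (u m) := fun m k hmk =>
    (hγ m).eqOn hhomeo ((hγ k).mono (hu hmk)) (huS m).1.1 (Set.right_mem_Icc.mpr (huS m).1.1)
  have hdist : ∀ m n, intrinsicDist F (γ m (u m)) (γ n (u n)) ≤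
      ENNReal.ofReal (C * |u n - u m|) := by
    intro m n
    rw [hcons m (max m n) (le_max_left _ _), hcons n (max m n) (le_max_right _ _)]
    refine (hγ (max m n)).intrinsicDist_le hloc hD hPD hΨ hFP (fun t ht => hC t
      ⟨ht.1, ht.2.trans (huS _).1.2⟩) ⟨(huS m).1.1, hu (le_max_left _ _)⟩
      ⟨(huS n).1.1, hu (le_max_right _ _)⟩
  have hC0 : 0 ≤ C := (norm_nonneg _).trans (hC 0 (by simp))
  obtain ⟨q, hq⟩ := hF (fun n => γ n (u n)) fun ε hε => by
    obtain ⟨δ, -, hδ, hδε⟩ := ENNReal.lt_iff_exists_real_btwn.mp hε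
    rw [ENNReal.ofReal_pos] at hδ
    obtain ⟨N, hN⟩ := Metric.cauchySeq_iff.mp hlim.cauchySeq (δ / (C + 1)) (by positivity)
    refine ⟨N, fun m hm n hn => (hdist m n).trans_lt (lt_of_le_of_lt ?_ hδε)⟩
    refine ENNReal.ofReal_le_ofReal ?_
    have h1 := hN n hn m hm
    rw [Real.dist_eq, lt_div_iff₀ (by positivity)] at h1
    nlinarith [abs_nonneg (u n - u m)]
  have hPq : P q = P p + s • v := by
    refine tendsto_nhds_unique ((hPc.tendsto q).comp hq) ?_
    have h1 : (P ∘ fun n => γ n (u n)) = fun n => P p + u n • v :=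
      funext fun n => (hγ n).lift _ (Set.right_mem_Icc.mpr (huS n).1.1)
    rw [h1]
    exact (hlim.smul_const v).const_add _
  obtain ⟨h, hqh, hPh, hsm⟩ := hloc q
  have hline : Continuous fun t : ℝ => P p + t • v := by fun_prop
  have hst : P p + s • v ∈ h.target := by
    rw [← hPq, hPh hqh]
    exact h.map_source hqh
  obtain ⟨δ, hδ, hball⟩ := Metric.mem_nhds_iff.mp
    (hline.continuousAt.preimage_mem_nhds (h.open_target.mem_nhds hst))
  -- The lift up to a parameter close to `s` is prolonged past `s` by the local inverse at `q`.
  obtain ⟨n, hn1, hn2⟩ := ((hq.eventually_mem (h.open_source.mem_nhds hqh)).and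
    (hlim.eventually (lt_mem_nhds (sub_lt_self s hδ)))).exists
  have hun : u n ≤ s := le_csSup hSb (huS n)
  have hnp := (hγ n).lift _ (Set.right_mem_Icc.mpr (huS n).1.1)
  have hext : ∀ T ≤ 1, u n ≤ T → T < s + δ →
      IsSegmentLift P p v T (fun t => if t ≤ u n then γ n t else h.symm (P p + t • v)) := by
    intro T hT1 hT2 hT3
    have hmem : ∀ t ∈ Set.Icc (u n) T, P p + t • v ∈ h.target := fun t ht => hball (by
      rw [Metric.mem_ball, Real.dist_eq, abs_lt]
      constructor <;> linarith [ht.1, ht.2])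
    refine ⟨?_, by simp [(huS n).1.1, (hγ n).zero], fun t ht => ?_⟩
    · have hIcc : Set.Icc 0 T = Set.Icc 0 (u n) ∪ Set.Icc (u n) T :=
        (Set.Icc_union_Icc_eq_Icc (huS n).1.1 hT2).symm
      rw [hIcc]
      refine ContinuousOn.union_of_isClosed ?_ ?_ isClosed_Icc isClosed_Icc
      · exact (hγ n).continuousOn.congr fun t ht => if_pos ht.2
      · have h2 : ContinuousOn (fun t : ℝ => h.symm (P p + t • v)) (Set.Icc (u n) T) :=
          h.continuousOn_symm.comp hline.continuousOn hmem
        refine h2.congr fun t ht => ?_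
        rcases ht.1.eq_or_lt with rfl | hlt
        · simp only [le_refl, if_true]
          rw [← hnp, hPh hn1, h.left_inv hn1]
        · exact if_neg (not_le.mpr hlt)
    · split_ifs with hle
      · exact (hγ n).lift t ⟨ht.1, hle⟩
      · have h3 := hmem t ⟨(not_le.mp hle).le, ht.2⟩
        rw [hPh (h.map_target h3), h.right_inv h3]
  by_cases hs1 : 1 < s + δ
  · exact ⟨_, hext 1 le_rfl (hun.trans hs.2) hs1⟩
  · have h4 : s + δ / 2 ∈ S :=
      ⟨⟨by linarith [hs.1], by linarith⟩, _, hext _ (by linarith) (by linarith) (by linarith)⟩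
    linarith [le_csSup hSb h4]

/-- A complete surface which is parametrized, locally, by the open convex set `D` is globally
parametrized by it. -/
theorem isOpenEmbedding_of_isCompleteSurface [IsManifold (𝓡 2) ∞ M] [T2Space M]
    [ConnectedSpace M] (hI : IsSmoothImmersion F) (hF : IsCompleteSurface F) (hD : IsOpen D)
    (hconv : Convex ℝ D) (hP : ContMDiff (𝓡 2) 𝓘(ℝ, E2) ∞ P) (hPD : ∀ p, P p ∈ D)
    (hΨ : ContDiffOn ℝ ∞ Ψ D) (hFP : ∀ p, F p = Ψ (P p)) :
    Topology.IsOpenEmbedding P ∧ Set.range P = D := by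
  have hloc := exists_local_inverse hI hD hP hPD hΨ hFP
  have hhomeo : IsLocalHomeomorph P := IsLocalHomeomorph.mk P fun q => by
    obtain ⟨h, h1, h2, -⟩ := hloc q
    exact ⟨h, h1, h2⟩
  have hsep := T2Space.isSeparatedMap P
  obtain ⟨p⟩ := (inferInstance : Nonempty M)
  have hseg : ∀ x : D, ∀ t ∈ Set.Icc (0 : ℝ) 1, P p + t • ((x : E2) - P p) ∈ D :=
    fun x t ht => hconv.add_smul_sub_mem (hPD p) x.2 ht
  choose γ hγ using fun x : D => exists_isSegmentLift hloc hF hD hPD hΨ hFP p (hseg x)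
  let f : C(unitInterval × D, E2) :=
    ⟨fun z => P p + (z.1 : ℝ) • ((z.2 : E2) - P p), by fun_prop⟩
  have hcont : Continuous fun z : unitInterval × D => γ z.2 z.1 := by
    refine hhomeo.continuous_lift hsep f (funext fun z => (hγ z.2).lift _ z.1.2) ?_ fun x => ?_
    · simp only [Set.Icc.coe_zero, (hγ _).zero]
      exact continuous_const
    · exact (hγ x).continuousOn.comp_continuous continuous_subtype_val fun t => t.2
  set σ : D → M := fun x => γ x 1
  have hσ : Continuous σ := hcont.comp (by fun_prop : Continuous fun x : D => ((1 : unitInterval), x))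
  have hPσ : ∀ x, P (σ x) = x := fun x => by
    simpa using (hγ x).lift 1 (by simp)
  have hσp : σ ⟨P p, hPD p⟩ = p := by
    have h1 : IsSegmentLift P p ((⟨P p, hPD p⟩ : D) - P p : E2) 1 fun _ => p :=
      ⟨continuousOn_const, rfl, fun t _ => by simp⟩
    exact (hγ ⟨P p, hPD p⟩).eqOn hhomeo h1 zero_le_one (by simp)
  have hid : (fun q => σ ⟨P q, hPD q⟩) = id :=
    hsep.eq_of_comp_eq hhomeo.isLocallyInjective
      (hσ.comp (hhomeo.continuous.subtype_mk hPD)) continuous_id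
      (funext fun q => hPσ _) p hσp
  have hinj : Function.Injective P := fun q q' h => by
    have h1 := congrFun hid q
    have h2 := congrFun hid q'
    simp only [h] at h1
    exact h1.symm.trans h2
  refine ⟨hhomeo.isOpenEmbedding_of_injective hinj, Set.Subset.antisymm ?_ ?_⟩
  · rintro _ ⟨q, rfl⟩
    exact hPD q
  · exact fun x hx => ⟨σ ⟨x, hx⟩, hPσ _⟩

end

/-! ### Translators on which the barrier is constant -/

/-- The pair of the coordinates `i` and `j` of a point of `ℝ³`. -/
def coordPair (i j : Fin 3) (x : E3) : E2 := !₂[x i, x j]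

lemma contDiff_coordPair (i j : Fin 3) : ContDiff ℝ ∞ (coordPair i j) := by
  rw [contDiff_euclidean]
  intro k
  fin_cases k <;> simp [coordPair] <;> fun_prop

lemma eq_zero_of_forall_le_mul {b c : ℝ} (h : ∀ t : ℝ, c ≤ b * t) : b = 0 := by
  by_contra hb
  have := h ((c - 1) / b)
  rw [mul_div_cancel₀ _ hb] at this
  linarith

section

variable {M : Type*} [TopologicalSpace M] [T2Space M] [ConnectedSpace M]
  [ChartedSpace E2 M] [IsManifold (𝓡 2) ∞ M] {F : M → E3} {lam α c a : ℝ}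

/-- If `x₁` is constant, the surface is a vertical plane, which no half-space of the given
kind contains. -/
lemma not_forall_coord_zero_eq (hF : IsTranslator F) (hα : lam ^ 2 - 1 ≤ α ^ 2)
    (hhalf : ∀ p, c ≤ (1 - lam ^ 2 / 2) * F p 2 + α * F p 1) (k : ℝ) :
    ¬ ∀ p, F p 0 = k := by
  intro hk
  have hI : IsSmoothImmersion F := ⟨hF.smooth, hF.immersion⟩
  obtain ⟨-, hr⟩ := isOpenEmbedding_of_isCompleteSurface (P := fun p => coordPair 1 2 (F p))
    (D := Set.univ) (Ψ := fun y => !₂[k, y 0, y 1]) hI hF.complete isOpen_univ convex_univ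
    ((contDiff_coordPair 1 2).contMDiff.comp hF.smooth) (fun _ => trivial)
    (ContDiff.contDiffOn (by
      rw [contDiff_euclidean]
      intro i
      fin_cases i <;> simp <;> fun_prop))
    (fun p => by ext i; fin_cases i <;> simp [coordPair, hk])
  have hsurj : ∀ s t : ℝ, c ≤ (1 - lam ^ 2 / 2) * t + α * s := by
    intro s t
    obtain ⟨p, hp⟩ : (!₂[s, t] : E2) ∈ Set.range fun p => coordPair 1 2 (F p) := by
      rw [hr]; trivial
    have h1 : F p 1 = s := congrArg (fun y : E2 => y 0) hp
    have h2 : F p 2 = t := congrArg (fun y : E2 => y 1) hp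
    rw [← h1, ← h2]
    exact hhalf p
  have h1 : α = 0 := eq_zero_of_forall_le_mul (c := c) fun s => by simpa using hsurj s 0
  have h2 : 1 - lam ^ 2 / 2 = 0 :=
    eq_zero_of_forall_le_mul (c := c) fun t => by simpa using hsurj 0 t
  subst h1
  nlinarith

/-- If the barrier is constant, it is positive: if it vanished, the surface would lie in the two
boundary planes of the slab. -/
lemma barrier_const_pos (hF : IsTranslator F) (hlam : 0 < lam) (hα : lam ^ 2 - 1 ≤ α ^ 2)
    (hslab : ∀ p, F p 0 ∈ Set.Icc a (a + lam * Real.pi))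
    (hhalf : ∀ p, c ≤ (1 - lam ^ 2 / 2) * F p 2 + α * F p 1) {K : ℝ}
    (hK : ∀ p, barrier lam α a (F p) = K) : 0 < K := by
  have hmem : ∀ p, (F p 0 - a) / lam ∈ Set.Icc 0 Real.pi := fun p => by
    obtain ⟨h1, h2⟩ := hslab p
    refine ⟨div_nonneg (by linarith) hlam.le, ?_⟩
    rw [div_le_iff₀ hlam]
    linarith
  obtain ⟨q⟩ := (inferInstance : Nonempty M)
  have hK0 : 0 ≤ K := hK q ▸ mul_nonneg (Real.sin_nonneg_of_mem_Icc (hmem q)) (Real.exp_pos _).le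
  refine hK0.lt_of_ne' fun h0 => not_forall_coord_zero_eq hF hα hhalf (F q 0) fun p => ?_
  have hmaps : ∀ p, F p 0 ∈ ({a, a + lam * Real.pi} : Set ℝ) := by
    intro p
    have h1 : Real.sin ((F p 0 - a) / lam) = 0 :=
      (mul_eq_zero.mp ((hK p).trans h0)).resolve_right (Real.exp_pos _).ne'
    rcases (hmem p).1.eq_or_lt with h2 | h2
    · left
      have := (div_eq_zero_iff.mp h2.symm).resolve_right hlam.ne'
      linarith
    · right
      rcases (hmem p).2.eq_or_lt with h3 | h3
      · rw [div_eq_iff hlam.ne'] at h3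
        rw [Set.mem_singleton_iff]
        linarith
      · exact absurd h1 (Real.sin_pos_of_pos_of_lt_pi h2 h3).ne'
  have hc : Continuous fun p => F p 0 := by
    have := hF.smooth.continuous
    fun_prop
  exact isPreconnected_univ.constant_of_mapsTo (Set.toFinite _).isDiscrete hc.continuousOn (fun p _ => hmaps p)
    (Set.mem_univ p) (Set.mem_univ q)

/-- If the barrier is a positive constant, the surface is the entire graph over the open strip
of the function obtained by solving for the height. -/
lemma isEmbedding_and_graph (hF : IsTranslator F) (hlam : 0 < lam) {K : ℝ} (hK0 : 0 < K)
    (hslab : ∀ p, F p 0 ∈ Set.Icc a (a + lam * Real.pi))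
    (hK : ∀ p, barrier lam α a (F p) = K) :
    Topology.IsEmbedding F ∧ Set.range F = {x | x 0 ∈ Set.Ioo a (a + lam * Real.pi) ∧
      x 2 = lam ^ 2 * Real.log K - α * x 1 - lam ^ 2 * Real.log (Real.sin ((x 0 - a) / lam))} := by
  have hI : IsSmoothImmersion F := ⟨hF.smooth, hF.immersion⟩
  have hsin : ∀ p, Real.sin ((F p 0 - a) / lam) ≠ 0 := fun p h => by
    have := hK p
    rw [barrier, h, zero_mul] at this
    exact hK0.ne this
  have hmem : ∀ p, F p 0 ∈ Set.Ioo a (a + lam * Real.pi) := by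
    refine fun p => ⟨(hslab p).1.lt_of_ne fun h => hsin p (by simp [← h]),
      (hslab p).2.lt_of_ne fun h => hsin p ?_⟩
    rw [h, add_sub_cancel_left, mul_div_cancel_left₀ _ hlam.ne', Real.sin_pi]
  have hheight : ∀ p, F p 2 = lam ^ 2 * Real.log K - α * F p 1 -
      lam ^ 2 * Real.log (Real.sin ((F p 0 - a) / lam)) := by
    intro p
    rw [← hK p, barrier, Real.log_mul (hsin p) (Real.exp_pos _).ne', Real.log_exp]
    field_simp
    ring
  set D : Set E2 := {y | y 0 ∈ Set.Ioo a (a + lam * Real.pi)}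
  have hD : D = EuclideanSpace.proj (𝕜 := ℝ) (0 : Fin 2) ⁻¹' Set.Ioo a (a + lam * Real.pi) := rfl
  have hDo : IsOpen D := hD ▸ isOpen_Ioo.preimage (ContinuousLinearMap.continuous _)
  have hDc : Convex ℝ D := hD ▸ (convex_Ioo _ _).linear_preimage
    (EuclideanSpace.proj (𝕜 := ℝ) (0 : Fin 2) : E2 →ₗ[ℝ] ℝ)
  set Ψ : E2 → E3 := fun y => !₂[y 0, y 1, lam ^ 2 * Real.log K - α * y 1 -
    lam ^ 2 * Real.log (Real.sin ((y 0 - a) / lam))]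
  have hΨ : ContDiffOn ℝ ∞ Ψ D := by
    rw [contDiffOn_euclidean]
    have hs : ∀ y ∈ D, Real.sin ((y 0 - a) / lam) ≠ 0 := fun y hy => by
      refine (Real.sin_pos_of_pos_of_lt_pi (div_pos (by linarith [hy.1]) hlam) ?_).ne'
      rw [div_lt_iff₀ hlam]
      linarith [hy.2]
    have hsd : ContDiff ℝ ∞ fun y : E2 => Real.sin ((y 0 - a) / lam) :=
      Real.contDiff_sin.comp (by fun_prop)
    have hl : ContDiffOn ℝ ∞ (fun y : E2 => Real.log (Real.sin ((y 0 - a) / lam))) D :=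
      hsd.contDiffOn.log hs
    intro i
    fin_cases i
    · exact ContDiff.contDiffOn (by simp only [Ψ]; simp; fun_prop)
    · exact ContDiff.contDiffOn (by simp only [Ψ]; simp; fun_prop)
    · have h1 : ContDiffOn ℝ ∞ (fun y : E2 => lam ^ 2 * Real.log K - α * y 1) D :=
        ContDiff.contDiffOn (by fun_prop)
      exact h1.sub (contDiffOn_const.mul hl)
  have hFΨ : ∀ p, F p = Ψ (coordPair 0 1 (F p)) := by
    intro p
    ext i
    fin_cases i <;> simp [Ψ, coordPair]
    exact hheight p
  obtain ⟨he, hr⟩ := isOpenEmbedding_of_isCompleteSurface (P := fun p => coordPair 0 1 (F p))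
    hI hF.complete hDo hDc ((contDiff_coordPair 0 1).contMDiff.comp hF.smooth) hmem hΨ hFΨ
  refine ⟨Topology.IsEmbedding.of_comp hF.smooth.continuous (contDiff_coordPair 0 1).continuous
    he.isEmbedding, Set.Subset.antisymm ?_ ?_⟩
  · rintro _ ⟨p, rfl⟩
    exact ⟨hmem p, hheight p⟩
  · rintro x ⟨hx0, hx2⟩
    obtain ⟨p, hp⟩ : coordPair 0 1 x ∈ Set.range fun p => coordPair 0 1 (F p) := by
      rw [hr]; exact hx0
    have hp' : coordPair 0 1 (F p) = coordPair 0 1 x := hp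
    refine ⟨p, ?_⟩
    rw [hFΨ, hp']
    ext i
    fin_cases i <;> simp [Ψ, coordPair]
    exact hx2.symm

end

end Translator

end

theorem mainTheorem2 {M : Type*} [TopologicalSpace M] [T2Space M]
    [SecondCountableTopology M] [ConnectedSpace M]
    [ChartedSpace Translator.E2 M] [IsManifold (𝓡 2) ∞ M]
    (F : M → Translator.E3)
    (hF : Translator.IsTranslator F) (hpar : Translator.IsParabolic F)
    (lam α c a : ℝ) (hlam : lam ∈ Set.Icc 1 (√2)) (hα : lam ^ 2 - 1 ≤ α ^ 2)
    (hslab : ∀ p, F p 0 ∈ Set.Icc a (a + lam * Real.pi))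
    (hhalf : ∀ p, c ≤ (1 - lam ^ 2 / 2) * F p 2 + α * F p 1) :
    lam = 1 ∧ α = 0 ∧
      Topology.IsEmbedding F ∧ ∃ b : ℝ, Set.range F = Translator.grimReaperCylinder a b := by
  have hlam0 : 0 < lam := zero_lt_one.trans_le hlam.1
  obtain ⟨K, hK⟩ := Translator.exists_barrier_eq hF hpar hlam0 hα hslab hhalf
  have hK0 := Translator.barrier_const_pos hF hlam0 hα hslab hhalf hK
  obtain ⟨hemb, hrange⟩ := Translator.isEmbedding_and_graph hF hlam0 hK0 hslab hK
  -- On the middle line of the strip the linear function of the half-space has slope `α λ² / 2`.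
  have hα0 : α = 0 := by
    have h1 : α * (lam ^ 2 / 2) = 0 := Translator.eq_zero_of_forall_le_mul
      (c := c - (1 - lam ^ 2 / 2) * (lam ^ 2 * Real.log K)) fun t => by
        have hx : (!₂[a + lam * (Real.pi / 2), t, lam ^ 2 * Real.log K - α * t] : Translator.E3) ∈
            Set.range F := by
          rw [hrange]
          refine ⟨⟨?_, ?_⟩, ?_⟩
          · simp; positivity
          · simp; nlinarith [Real.pi_pos]
          · simp [mul_div_cancel_left₀ _ hlam0.ne']
        obtain ⟨p, hp⟩ := hx
        have h2 := hhalf p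
        rw [hp] at h2
        simp at h2
        linarith
    exact (mul_eq_zero.mp h1).resolve_right (by positivity)
  have hlam1 : lam = 1 := by
    rw [hα0] at hα
    nlinarith [hlam.1]
  refine ⟨hlam1, hα0, hemb, Real.log K, ?_⟩
  rw [hrange, Translator.grimReaperCylinder, hlam1, hα0]
  simp
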